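/- Fix a finite alphabet $\Sigma$. Patterns are the regular expressions built from $\varepsilon$, the letters $\sigma\in\Sigma$, $P_1+P_2$, $P_1\cdot P_2$ and $P_1^*$; $L(P)$ is the language of $P$. Nodes of the syntax tree are addressed by words over $\{1,2\}$ (the root is the empty word $\lambda$, and $1$, $2$ lead to the first and second operand); $bn(P)$ is the set of bindable nodes, those without a proper ancestor labeled $*$. An association is a function $V$ from $bn(P)$ to $\Sigma^*\cup\{\bot\}$. The relation "$w$ is matched by $P$ yielding $V$", written $w\in P\leadsto V$, is defined together with "$(w_1,w_2)\in P_1\cdot P_2\leadsto(V_1,V_2)$"; write $w\in P$ if $w\in P\leadsto V$ for some $V$. $[\lambda\to w]$ has the single value $w$ at the root; $V_1+P_2$ has the root value of $V_1$, the values of $V_1$ below $1$ and $\bot$ below $2$, and $P_1+V_2$ is symmetric; $V_1\cdot V_2$ has $V_1(\lambda)V_2(\lambda)$ at the root ($\bot$ if one of these is $\bot$) and the values of $V_1$, $V_2$ below $1$, $2$. The rules are: $\lambda\in\varepsilon\leadsto[\lambda\to\lambda]$; $\sigma\in\sigma\leadsto[\lambda\to\sigma]$; $\lambda\in P^*\leadsto[\lambda\to\lambda]$;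 $w_1w_2\in P^*\leadsto[\lambda\to w_1w_2]$ if $w_1\in P$, $w_2\in P^*$, $w_1\neq\lambda$; $w\in P_1+P_2\leadsto V+P_2$ if $w\in P_1\leadsto V$; $w\in P_1+P_2\leadsto P_1+V$ if $w\in P_2\leadsto V$ and $w\notin P_1$; $w_1w_2\in P_1\cdot P_2\leadsto V_1\cdot V_2$ if $(w_1,w_2)\in P_1\cdot P_2\leadsto(V_1,V_2)$. For pairs: if $P_1$ is $\varepsilon$ or a letter, $(w_1,w_2)\in P_1\cdot P\leadsto(V_1,V_2)$ if $w_1\in P_1\leadsto V_1$ and $w_2\in P\leadsto V_2$; $(w_1,w_2)\in(P_1+P_2)\cdot P_3\leadsto(V_1+P_2,V_2)$ if $(w_1,w_2)\in P_1\cdot P_3\leadsto(V_1,V_2)$; $(w_1,w_2)\in(P_1+P_2)\cdot P_3\leadsto(P_1+V_1,V_2)$ if $(w_1,w_2)\in P_2\cdot P_3\leadsto(V_1,V_2)$ and $w_1w_2\notin P_1\cdot P_3$; $(w_1w_2,w_3)\in(P_1\cdot P_2)\cdot P_3\leadsto(V_1\cdot V_2,V_3)$ if $(w_1,w_2w_3)\in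 P_1\cdot(P_2\cdot P_3)\leadsto(V_1,W)$ for some $W$ and $(w_2,w_3)\in P_2\cdot P_3\leadsto(V_2,V_3)$; $(w_1,w_2)\in P_1^*\cdot P_2\leadsto(V_1,V_2)$ if $w_1\in P_1^*\leadsto V_1$, $w_2\in P_2\leadsto V_2$ and there are no $w_3\neq\lambda$, $w_4$ with $w_2=w_3w_4$, $w_1w_3\in P_1^*$, $w_4\in P_2$. For a language $C$, the type $T(n,P,C)$ of $n\in bn(P)$ is the set of words $w$ such that $w'\in P\leadsto V$ and $V(n)=w$ for some $w'\in C$ and some $V$. An NFA $A=(Q_A,I_A,F_A,\delta_A)$ is finite and may have $\lambda$-transitions; deterministic automata are complete, and their $\lambda$-transitions are exactly the loops $(q,\lambda,q)$. An accepting run on $w=\sigma_1\cdots\sigma_l$ is a sequence $(q_0,k_0),\dots,(q_m,k_m)$ with $q_0\in I_A$, $k_0=0$, $q_m\in F_A$, $k_m=l$, in which each step either uses a transition of $\delta_A$ labeled $\sigma_{k_i+1}$ and has $k_{i+1}=k_i+1$, or uses a $\lambda$-transition with $q_i\neq q_{i+1}$ and $k_{i+1}=k_i$. $L(Q,I,F,\delta_A)$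 is the set of words that have such a run from $I$ to $F$. If a run $\tau$ visits a set $S$ of states, $w_{\mathrm{bound}(\tau,S)}$ is the subword of $w$ between the least and the greatest position $k_i$ with $q_i\in S$; if it does not, it is $\bot$. For a regular language $C$, the algorithm $H(P,C)$ returns a pair $(A,f)$ of an NFA $A$ and a function $f$ that maps each $n\in bn(P)$ to a triple $f(n)=(Q_n,I_n,F_n)$ of subsets of $Q_A$. Write $K\backslash L=\{s\mid\exists p\in K: ps\in L\}$ and $L/K=\{p\mid\exists s\in K: ps\in L\}$. State sets of different automata are taken disjoint. Unless stated otherwise, $f(\lambda)=(Q_A,I_A,F_A)$. (a) $P=\varepsilon$, $\sigma$ or $P_1^*$: $A$ is any deterministic automaton for $L(P)\cap C$. (b) $P=P_1+P_2$: with $(A_1,f_1)=H(P_1,C)$ and $(A_2,f_2)=H(P_2,C-L(P_1))$, $A$ is the union $A_1\cup A_2$, $f(1n)=f_1(n)$, $f(2n)=f_2(n)$. (c) $P=P_1\cdot P_2$ with $P_1=\varepsilon$ or $P_1=\sigma$: with $(A_1,f_1)=H(P_1,C/L(P_2))$ and $(A_2,f_2)=H(P_2,L(P_1)\backslash C)$,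 $A=A_1\cdot A_2$ is obtained by adding $\lambda$-transitions from the final states of $A_1$ to the initial states of $A_2$ (initial states $I_{A_1}$, final states $F_{A_2}$), $f(1n)=f_1(n)$, $f(2n)=f_2(n)$. (d) $P=P_1^*\cdot P_2$: let $\Box\notin\Sigma$ and let $R$ be the set of pairs $(p,s)$ with $ps\in C$, $p\in L(P_1^*)$, $s\in L(P_2)$ for which there are no $w_3\neq\lambda$, $w_4$ with $s=w_3w_4$, $pw_3\in L(P_1^*)$, $w_4\in L(P_2)$. Put $T_1=\{p\mid\exists s:(p,s)\in R\}$, $C_2=\{s\mid\exists p:(p,s)\in R\}$, $I=\{p\Box s\mid(p,s)\in R\}$. Take any deterministic automata $A_{T_1}$ for $T_1$ (over $\Sigma$) and $A_I$ for $I$ (over $\Sigma\cup\{\Box\}$), the minimal deterministic automaton $A_\Box$ for $\{\Box\}$ (over $\Sigma\cup\{\Box\}$), and $(A_2,f_2)=H(P_2,C_2)$. Then $A=\pi((A_{T_1}\cdot A_\Box\cdot A_2)\cap A_I)$, where $\cap$ is the product construction and $\pi$ turns $\Box$-transitions into $\lambda$-transitions; $f(1)=(Q_{T_1},I_{T_1},F_{T_1})\times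 Q_{A_I}$, and $f(2n)=f_2(n)\times Q_{A_I}$, where the product is taken in each component. (e) $P=(P_1\cdot P_2)\cdot P_3$: with $(A',f')=H(P_1\cdot(P_2\cdot P_3),C)$ and $f'(n)=(Q'_n,I'_n,F'_n)$, $A=A'$, $f(\lambda)=f'(\lambda)$, $f(2n)=f'(22n)$, $f(11n)=f'(1n)$, $f(12n)=f'(21n)$ and $f(1)=(Q_1,I_1,F_1)$ with $Q_1=Q'_1\cup Q'_{21}$, $I_1=Q_1\cap I_{A'}$, and $F_1$ the set of $q\in F'_{21}$ such that some $q'\in I'_{22}$ is reachable from $q$ by $\lambda$-transitions and some state of $F_{A'}$ is reachable from $q'$. (f) $P=(P_1+P_2)\cdot P_3$: with $(A',f')=H(P_1\cdot P_3+P_2\cdot P_3,C)$, $A=A'$, $f(\lambda)=f'(\lambda)$, $f(1)=f'(11)\cup f'(21)$, $f(11n)=f'(11n)$, $f(12n)=f'(21n)$, $f(2n)=f'(12n)\cup f'(22n)$, where the union is taken in each component. **Theorem.** Let $P$ be a pattern and $C$ a regular language over $\Sigma$. Then $H(P,C)$ has a result, and every result $(A,f)$, with $f(n)=(Q_n,I_n,F_n)$,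 has the following properties. 1. For every $n\in bn(P)$: $I_n,F_n\subseteq Q_n$ and $L(Q_n,I_n,F_n,\delta_A)=T(n,P,C)$. 2. $A$ is unambiguous: for every word $w$ there is at most one accepting run of $A$ on $w$. 3. For every word $w$ and every $V:bn(P)\to\Sigma^*\cup\{\bot\}$: $w\in C$ and $w\in P\leadsto V$ hold if and only if there is an accepting run $\tau$ of $A$ on $w$ such that $V(n)=w_{\mathrm{bound}(\tau,Q_n)}$ for every $n\in bn(P)$. Moreover, matching takes linear time: for each list $n_1,\dots,n_r$ of bindable nodes of $P$ there are a multi-stack Turing machine and a constant $c$, depending only on $P$, $C$ and the list, such that on each input $w$ the machine halts after at most $c\,(|w|+1)$ steps and outputs $V(n_1),\dots,V(n_r)$ if $w\in C$ and $w\in P\leadsto V$, and the answer "no match" if $w\notin C$ or $w\notin P$. -/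

import Mathlib

/-! ### Patterns, nodes and bindable nodes -/

/-- Regular expression patterns over the alphabet `α`. -/
inductive Pattern (α : Type) : Type
  | eps : Pattern α
  | sym : α → Pattern α
  | alt : Pattern α → Pattern α → Pattern α
  | cat : Pattern α → Pattern α → Pattern α
  | star : Pattern α → Pattern α

/-- The two letters from which node addresses are built. -/
inductive Dir : Type
  | one : Dir
  | two : Dir

/-- Nodes are words over `{1, 2}`. -/
abbrev Node : Type := List Dir

/-- Labels of the nodes of a syntax tree. -/
inductive NodeLabel (α : Type) : Type
  | eps : NodeLabel α
  | sym : α → NodeLabel α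
  | alt : NodeLabel α
  | cat : NodeLabel α
  | star : NodeLabel α

namespace Pattern

variable {α : Type}

/-- A pattern as a partial function from nodes to labels (`none` means undefined). -/
def label : Pattern α → Node → Option (NodeLabel α)
  | eps, [] => some NodeLabel.eps
  | sym a, [] => some (NodeLabel.sym a)
  | alt _ _, [] => some NodeLabel.alt
  | alt P _, Dir.one :: n => label P n
  | alt _ Q, Dir.two :: n => label Q n
  | cat _ _, [] => some NodeLabel.cat
  | cat P _, Dir.one :: n => label P n
  | cat _ Q, Dir.two :: n => label Q n
  | star _, [] => some NodeLabel.star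
  | star P, Dir.one :: n => label P n
  | _, _ => none

/-- The bindable nodes: nodes of the pattern without a (proper) ancestor labeled `*`. -/
def bindable (P : Pattern α) : Set Node :=
  {n | P.label n ≠ none ∧ ¬ ∃ m n' : Node, n' ≠ [] ∧ n = m ++ n' ∧ P.label m = some NodeLabel.star}

/-- The size of a pattern: its number of nodes. -/
def size : Pattern α → ℕ
  | eps => 1
  | sym _ => 1
  | alt P Q => 1 + P.size + Q.size
  | cat P Q => 1 + P.size + Q.size
  | star P => 1 + P.size

/-- The size of the left operand of a concatenation (and `0` for the other patterns). It is used
only in termination proofs. -/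
def leftSize : Pattern α → ℕ
  | cat P _ => P.size
  | _ => 0

/-- The language of a pattern. -/
def lang : Pattern α → Language α
  | eps => 1
  | sym a => ({[a]} : Set (List α))
  | alt P Q => P.lang + Q.lang
  | cat P Q => P.lang * Q.lang
  | star P => KStar.kstar P.lang

/-- The patterns `ε` and `σ`. -/
def IsAtom (P : Pattern α) : Prop := P = eps ∨ ∃ a, P = sym a

/-- The patterns `ε`, `σ` and `P₁*`. -/
def IsBase (P : Pattern α) : Prop := P = eps ∨ (∃ a, P = sym a) ∨ ∃ P₁, P = star P₁

end Pattern

/-! ### Associations and the matching relation -/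

/-- Associations map nodes to words or to `⊥` (represented by `none`). An association for a pattern
`P` is a function on the bindable nodes of `P`; it is represented by a function on all nodes that
has the value `⊥` outside of the bindable nodes of `P`. -/
abbrev Assoc (α : Type) : Type := Node → Option (List α)

namespace Assoc

variable {α : Type}

/-- The association `[λ → w]`. -/
def single (w : List α) : Assoc α
  | [] => some w
  | _ :: _ => none

/-- The association `V₁ + P₂`. -/
def orLeft (V : Assoc α) : Assoc α
  | [] => V []
  | Dir.one :: n => V n
  | Dir.two :: _ => none

/-- The association `P₁ + V₂`. -/
def orRight (V : Assoc α) : Assoc α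
  | [] => V []
  | Dir.one :: _ => none
  | Dir.two :: n => V n

/-- The association `V₁ · V₂`. -/
def cat (V₁ V₂ : Assoc α) : Assoc α
  | [] => match V₁ [], V₂ [] with
    | some w₁, some w₂ => some (w₁ ++ w₂)
    | _, _ => none
  | Dir.one :: n => V₁ n
  | Dir.two :: n => V₂ n

end Assoc

/-- The words derivable with the two rules for the Kleene closure, where `M u` says that `u` is
matched by the pattern under the star. -/
inductive KleeneDerivable {α : Type} (M : List α → Prop) : List α → Prop
  | empty : KleeneDerivable M []
  | closure {w₁ w₂ : List α} : M w₁ → KleeneDerivable M w₂ → w₁ ≠ [] →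
      KleeneDerivable M (w₁ ++ w₂)

mutual

/-- `Matches P w V`: the word `w` is matched by `P`, yielding the associations `V`. Each clause lists
the inference rules with a conclusion of the given shape. Since the rules use the negation of the
relation on smaller patterns, the relation is defined by well-founded recursion on patterns. -/
def Matches {α : Type} : Pattern α → List α → Assoc α → Prop
  | .eps, w, V => w = [] ∧ V = Assoc.single []
  | .sym a, w, V => w = [a] ∧ V = Assoc.single [a]
  | .star P, w, V => KleeneDerivable (fun u => ∃ V₁, Matches P u V₁) w ∧ V = Assoc.single w
  | .alt P₁ P₂, w, V =>
      (∃ V₁, Matches P₁ w V₁ ∧ V = V₁.orLeft) ∨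
      (∃ V₂, Matches P₂ w V₂ ∧ (¬ ∃ V₁, Matches P₁ w V₁) ∧ V = V₂.orRight)
  | .cat P₁ P₂, w, V =>
      ∃ w₁ w₂ V₁ V₂, MatchesPair P₁ P₂ w₁ w₂ V₁ V₂ ∧ w = w₁ ++ w₂ ∧ V = V₁.cat V₂
termination_by P => (P.size, P.leftSize, 1)
decreasing_by
  all_goals simp [Prod.lex_def, Pattern.size, Pattern.leftSize]
  all_goals omega

/-- `MatchesPair P₁ P₂ w₁ w₂ V₁ V₂`: the pair `(w₁, w₂)` is matched by `P₁ · P₂`, yielding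
`(V₁, V₂)`. -/
def MatchesPair {α : Type} :
    Pattern α → Pattern α → List α → List α → Assoc α → Assoc α → Prop
  | .eps, P, w₁, w₂, V₁, V₂ => w₁ = [] ∧ V₁ = Assoc.single [] ∧ Matches P w₂ V₂
  | .sym a, P, w₁, w₂, V₁, V₂ => w₁ = [a] ∧ Matches (.sym a) w₁ V₁ ∧ Matches P w₂ V₂
  | .alt P₁ P₂, P₃, w₁, w₂, V, V₂ =>
      (∃ V₁, MatchesPair P₁ P₃ w₁ w₂ V₁ V₂ ∧ V = V₁.orLeft) ∨
      (∃ V₁, MatchesPair P₂ P₃ w₁ w₂ V₁ V₂ ∧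
        (¬ ∃ V', Matches (.cat P₁ P₃) (w₁ ++ w₂) V') ∧ V = V₁.orRight)
  | .cat P₁ P₂, P₃, w, w₃, V, V₃ =>
      ∃ w₁ w₂ V₁ V₂ W, MatchesPair P₁ (.cat P₂ P₃) w₁ (w₂ ++ w₃) V₁ W ∧
        MatchesPair P₂ P₃ w₂ w₃ V₂ V₃ ∧ w = w₁ ++ w₂ ∧ V = V₁.cat V₂
  | .star P₁, P₂, w₁, w₂, V₁, V₂ =>
      Matches (.star P₁) w₁ V₁ ∧ Matches P₂ w₂ V₂ ∧
      ¬ ∃ w₃ w₄, w₃ ≠ [] ∧ w₂ = w₃ ++ w₄ ∧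
        (∃ V, Matches (.star P₁) (w₁ ++ w₃) V) ∧ (∃ V, Matches P₂ w₄ V)
termination_by P Q => (1 + P.size + Q.size, P.size, 0)
decreasing_by
  all_goals simp [Prod.lex_def, Pattern.size, Pattern.leftSize]
  all_goals omega

end

/-- The type of the node `n` in `P` relative to the context `C`. -/
def typeOf {α : Type} (n : Node) (P : Pattern α) (C : Language α) : Language α :=
  {w | ∃ w' ∈ C, ∃ V, Matches P w' V ∧ V n = some w}

/-! ### Languages used by the algorithm -/

/-- The left quotient `K \ L`. -/
def leftQuot {α : Type} (K L : Language α) : Language α := {s | ∃ p ∈ K, p ++ s ∈ L}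

/-- The right quotient `L / K`. -/
def rightQuot {α : Type} (L K : Language α) : Language α := {p | ∃ s ∈ K, p ++ s ∈ L}

/-- The alphabet extended by the special symbol `□`, which is `none`. -/
abbrev Boxed (α : Type) : Type := Option α

/-- The word `p □ s`. -/
def boxWord {α : Type} (p s : List α) : List (Boxed α) := p.map some ++ none :: s.map some

/-- The splittings `p s` of words in `C` that obey the longest match policy for `P₁* · P₂`. -/
def StarSplit {α : Type} (P₁ P₂ : Pattern α) (C : Language α) (p s : List α) : Prop :=
  p ++ s ∈ C ∧ p ∈ (Pattern.star P₁).lang ∧ s ∈ P₂.lang ∧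
  ¬ ∃ w₃ w₄, w₃ ≠ [] ∧ w₃ ++ w₄ = s ∧ p ++ w₃ ∈ (Pattern.star P₁).lang ∧ w₄ ∈ P₂.lang

/-- The language `I` of all `p □ s` for such splittings. -/
def starI {α : Type} (P₁ P₂ : Pattern α) (C : Language α) : Language (Boxed α) :=
  {u | ∃ p s, u = boxWord p s ∧ StarSplit P₁ P₂ C p s}

/-- The language `T₁` of the left parts of such splittings. -/
def starT {α : Type} (P₁ P₂ : Pattern α) (C : Language α) : Language α :=
  {p | ∃ s, StarSplit P₁ P₂ C p s}

/-- The language `C₂` of the right parts of such splittings. -/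
def starC {α : Type} (P₁ P₂ : Pattern α) (C : Language α) : Language α :=
  {s | ∃ p, StarSplit P₁ P₂ C p s}

/-! ### Automata, runs and constructions on automata

An NFA with `λ`-transitions is an `εNFA` of Mathlib: `A.step q none` is the set of `λ`-successors. -/

/-- A deterministic automaton as an NFA; its `λ`-transitions are exactly the loops. -/
def DFA.toLoopNFA {β σ : Type} (M : DFA β σ) : εNFA β σ where
  step q x := match x with
    | none => {q}
    | some a => {M.step q a}
  start := {M.start}
  accept := M.accept

namespace εNFA

variable {β σ τ : Type}

/-- `A₁ ∪ A₂`: the disjoint union. -/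
def disjUnion (A : εNFA β σ) (B : εNFA β τ) : εNFA β (σ ⊕ τ) where
  step q x := match q with
    | Sum.inl q => Sum.inl '' A.step q x
    | Sum.inr q => Sum.inr '' B.step q x
  start := Sum.inl '' A.start ∪ Sum.inr '' B.start
  accept := Sum.inl '' A.accept ∪ Sum.inr '' B.accept

/-- `A₁ · A₂`: the final states of `A₁` are connected to the initial states of `A₂` by
`λ`-transitions. -/
def concat (A : εNFA β σ) (B : εNFA β τ) : εNFA β (σ ⊕ τ) where
  step q x := match q with
    | Sum.inl q => Sum.inl '' A.step q x ∪
        {r | x = none ∧ q ∈ A.accept ∧ ∃ t ∈ B.start, r = Sum.inr t}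
    | Sum.inr q => Sum.inr '' B.step q x
  start := Sum.inl '' A.start
  accept := Sum.inr '' B.accept

/-- `A₁ ∩ A₂`: the product construction. -/
def product (A : εNFA β σ) (B : εNFA β τ) : εNFA β (σ × τ) where
  step q x := A.step q.1 x ×ˢ B.step q.2 x
  start := A.start ×ˢ B.start
  accept := A.accept ×ˢ B.accept

/-- An automaton over `Σ`, seen as an automaton over `Σ ∪ {□}` without `□`-transitions. -/
def liftBox (A : εNFA β σ) : εNFA (Boxed β) σ where
  step q x := match x with
    | none => A.step q none
    | some none => ∅
    | some (some a) => A.step q (some a)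
  start := A.start
  accept := A.accept

/-- `π(A)`: every `□`-transition becomes a `λ`-transition. -/
def projBox (A : εNFA (Boxed β) σ) : εNFA β σ where
  step q x := match x with
    | none => A.step q none ∪ A.step q (some none)
    | some a => A.step q (some (some a))
  start := A.start
  accept := A.accept

end εNFA

/-- The states of the minimal deterministic automaton for `{□}`. -/
inductive BoxState : Type
  | before : BoxState
  | after : BoxState
  | sink : BoxState

instance : Finite BoxState :=
  Finite.of_surjective
    (fun i : Fin 3 => if i = 0 then BoxState.before else if i = 1 then BoxState.after
      else BoxState.sink)
    (fun s => by
      cases s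
      · exact ⟨0, rfl⟩
      · exact ⟨1, rfl⟩
      · exact ⟨2, rfl⟩)

/-- The minimal deterministic automaton for `{□}`. -/
def boxDFA (α : Type) : DFA (Boxed α) BoxState where
  step q x := match q, x with
    | BoxState.before, none => BoxState.after
    | _, _ => BoxState.sink
  start := BoxState.before
  accept := {BoxState.after}

section Runs

variable {α σ : Type}

/-- One move of a run on `w`: from state `x.1` at position `x.2` to state `y.1` at position `y.2`. A
`λ`-move has to change the state. -/
def RunStep (A : εNFA α σ) (w : List α) (x y : σ × ℕ) : Prop :=
  (∃ a, w[x.2]? = some a ∧ y.1 ∈ A.step x.1 (some a) ∧ y.2 = x.2 + 1) ∨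
  (y.1 ∈ A.step x.1 none ∧ y.2 = x.2 ∧ x.1 ≠ y.1)

/-- `ρ = (q₀, k₀), …, (q_m, k_m)` is a run on `w` with the transitions of `A` from a state in `I` at
position `0` to a state in `F` at position `|w|`. -/
def IsRun (A : εNFA α σ) (I F : Set σ) (w : List α) (ρ : List (σ × ℕ)) : Prop :=
  ρ.IsChain (RunStep A w) ∧
  (∃ q ∈ I, ρ.head? = some (q, 0)) ∧
  (∃ q ∈ F, ρ.getLast? = some (q, w.length))

/-- Accepting runs of `A` on `w`. -/
def IsAcceptingRun (A : εNFA α σ) (w : List α) (ρ : List (σ × ℕ)) : Prop :=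
  IsRun A A.start A.accept w ρ

/-- The positions at which the run `ρ` is in a state of `S`. -/
def positions (ρ : List (σ × ℕ)) (S : Set σ) : Set ℕ := {k | ∃ q ∈ S, (q, k) ∈ ρ}

open Classical in
/-- The least and the greatest position at which `ρ` is in `S`; `none` stands for `(-1, -1)`. -/
noncomputable def bound (ρ : List (σ × ℕ)) (S : Set σ) : Option (ℕ × ℕ) :=
  if (positions ρ S).Nonempty then some (sInf (positions ρ S), sSup (positions ρ S)) else none

/-- The subword `w_{i+1} … w_j` of `w` bounded by `(i, j)`, and `⊥` for invalid bounds. -/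
def subword (w : List α) : Option (ℕ × ℕ) → Option (List α)
  | some (i, j) => if i ≤ j ∧ j ≤ w.length then some ((w.take j).drop i) else none
  | none => none

end Runs

/-! ### Hyperautomata and the algorithm -/

/-- Triples `(Q, I, F)` of sets of states. -/
structure StateTriple (σ : Type) where
  Q : Set σ
  I : Set σ
  F : Set σ

namespace StateTriple

variable {σ τ : Type}

/-- The triple `(Q_A, I_A, F_A)` of an automaton. -/
def ofAut {α : Type} (A : εNFA α σ) : StateTriple σ := ⟨Set.univ, A.start, A.accept⟩

/-- The empty triple. It is the value of `f` at addresses that are not bindable nodes. -/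
def empty : StateTriple σ := ⟨∅, ∅, ∅⟩

/-- The image of a triple under an embedding of the state set. -/
def map (g : σ → τ) (t : StateTriple σ) : StateTriple τ := ⟨g '' t.Q, g '' t.I, g '' t.F⟩

/-- The componentwise union. -/
def union (t u : StateTriple σ) : StateTriple σ := ⟨t.Q ∪ u.Q, t.I ∪ u.I, t.F ∪ u.F⟩

/-- The triple `(Q × τ, I × τ, F × τ)`. -/
def timesAll (t : StateTriple σ) (τ : Type) : StateTriple (σ × τ) :=
  ⟨t.Q ×ˢ Set.univ, t.I ×ˢ Set.univ, t.F ×ˢ Set.univ⟩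

end StateTriple

/-- A pair `(A, f)` of an NFA `A` and a function `f` from nodes to triples of sets of states. -/
structure Hyperautomaton (α : Type) where
  State : Type
  finite : Finite State
  A : εNFA α State
  f : Node → StateTriple State

namespace Hyperautomaton

variable {α : Type}

/-- The result for `ε`, `σ` and `P₁*`. -/
def base {σ : Type} [Finite σ] (M : DFA α σ) : Hyperautomaton α where
  State := σ
  finite := inferInstance
  A := M.toLoopNFA
  f n := match n with
    | [] => StateTriple.ofAut M.toLoopNFA
    | _ :: _ => StateTriple.empty

/-- The result for `P₁ + P₂`. -/
def alt (H₁ H₂ : Hyperautomaton α) : Hyperautomaton α where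
  State := H₁.State ⊕ H₂.State
  finite := by
    have := H₁.finite
    have := H₂.finite
    infer_instance
  A := H₁.A.disjUnion H₂.A
  f n := match n with
    | [] => StateTriple.ofAut (H₁.A.disjUnion H₂.A)
    | Dir.one :: n => (H₁.f n).map Sum.inl
    | Dir.two :: n => (H₂.f n).map Sum.inr

/-- The result for `ε · P₂` and `σ · P₂`. -/
def concat (H₁ H₂ : Hyperautomaton α) : Hyperautomaton α where
  State := H₁.State ⊕ H₂.State
  finite := by
    have := H₁.finite
    have := H₂.finite
    infer_instance
  A := H₁.A.concat H₂.A
  f n := match n with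
    | [] => StateTriple.ofAut (H₁.A.concat H₂.A)
    | Dir.one :: n => (H₁.f n).map Sum.inl
    | Dir.two :: n => (H₂.f n).map Sum.inr

/-- The automaton `π((A_T · A_□ · A₂) ∩ A_I)`. -/
def starAut {σ τ ν : Type} (AT : DFA α σ) (AI : DFA (Boxed α) τ) (A₂ : εNFA α ν) :
    εNFA α ((σ ⊕ (BoxState ⊕ ν)) × τ) :=
  ((AT.toLoopNFA.liftBox.concat ((boxDFA α).toLoopNFA.concat A₂.liftBox)).product
    AI.toLoopNFA).projBox

/-- The result for `P₁* · P₂`. -/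
def starConcat {σ τ : Type} [Finite σ] [Finite τ] (AT : DFA α σ) (AI : DFA (Boxed α) τ)
    (H₂ : Hyperautomaton α) : Hyperautomaton α where
  State := (σ ⊕ (BoxState ⊕ H₂.State)) × τ
  finite := by
    have := H₂.finite
    infer_instance
  A := starAut AT AI H₂.A
  f n := match n with
    | [] => StateTriple.ofAut (starAut AT AI H₂.A)
    | [Dir.one] => ((StateTriple.ofAut AT.toLoopNFA).map Sum.inl).timesAll τ
    | Dir.one :: _ :: _ => StateTriple.empty
    | Dir.two :: n => ((H₂.f n).map (fun q => Sum.inr (Sum.inr q))).timesAll τ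

/-- The triple of the node `1` in `(P₁ · P₂) · P₃`, from the result for `P₁ · (P₂ · P₃)`. -/
def reassocTriple (H : Hyperautomaton α) : StateTriple H.State where
  Q := (H.f [Dir.one]).Q ∪ (H.f [Dir.two, Dir.one]).Q
  I := ((H.f [Dir.one]).Q ∪ (H.f [Dir.two, Dir.one]).Q) ∩ H.A.start
  F := {q | q ∈ (H.f [Dir.two, Dir.one]).F ∧ ∃ q' ∈ (H.f [Dir.two, Dir.two]).I,
    Relation.ReflTransGen (fun r r' => r' ∈ H.A.step r none) q q' ∧
    ∃ q'' ∈ H.A.accept, Relation.ReflTransGen (fun r r' => ∃ x, r' ∈ H.A.step r x) q' q''}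

/-- The result for `(P₁ · P₂) · P₃`, from the result for `P₁ · (P₂ · P₃)`. -/
def reassoc (H : Hyperautomaton α) : Hyperautomaton α where
  State := H.State
  finite := H.finite
  A := H.A
  f n := match n with
    | [] => H.f []
    | [Dir.one] => H.reassocTriple
    | Dir.one :: Dir.one :: n => H.f (Dir.one :: n)
    | Dir.one :: Dir.two :: n => H.f (Dir.two :: Dir.one :: n)
    | Dir.two :: n => H.f (Dir.two :: Dir.two :: n)

/-- The result for `(P₁ + P₂) · P₃`, from the result for `P₁ · P₃ + P₂ · P₃`. -/
def distrib (H : Hyperautomaton α) : Hyperautomaton α where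
  State := H.State
  finite := H.finite
  A := H.A
  f n := match n with
    | [] => H.f []
    | [Dir.one] => (H.f [Dir.one, Dir.one]).union (H.f [Dir.two, Dir.one])
    | Dir.one :: Dir.one :: n => H.f (Dir.one :: Dir.one :: n)
    | Dir.one :: Dir.two :: n => H.f (Dir.two :: Dir.one :: n)
    | Dir.two :: n => (H.f (Dir.one :: Dir.two :: n)).union (H.f (Dir.two :: Dir.two :: n))

end Hyperautomaton

/-- `Computes P C H`: the algorithm, on input `P` and `C`, may return `H`. The algorithm is
nondeterministic since it may use any finite deterministic automaton for the languages `L(P) ∩ C`,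
`T₁` and `I`. -/
inductive Computes {α : Type} : Pattern α → Language α → Hyperautomaton α → Prop
  | base {P : Pattern α} {C : Language α} {σ : Type} [Finite σ] (M : DFA α σ) :
      P.IsBase → M.accepts = P.lang ⊓ C → Computes P C (Hyperautomaton.base M)
  | alt {P₁ P₂ : Pattern α} {C : Language α} {H₁ H₂ : Hyperautomaton α} :
      Computes P₁ C H₁ → Computes P₂ (C - P₁.lang) H₂ →
      Computes (.alt P₁ P₂) C (H₁.alt H₂)
  | catAtom {P₁ P₂ : Pattern α} {C : Language α} {H₁ H₂ : Hyperautomaton α} :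
      P₁.IsAtom → Computes P₁ (rightQuot C P₂.lang) H₁ →
      Computes P₂ (leftQuot P₁.lang C) H₂ → Computes (.cat P₁ P₂) C (H₁.concat H₂)
  | catStar {P₁ P₂ : Pattern α} {C : Language α} {H₂ : Hyperautomaton α} {σ τ : Type}
      [Finite σ] [Finite τ] (AT : DFA α σ) (AI : DFA (Boxed α) τ) :
      AT.accepts = starT P₁ P₂ C → AI.accepts = starI P₁ P₂ C →
      Computes P₂ (starC P₁ P₂ C) H₂ →
      Computes (.cat (.star P₁) P₂) C (Hyperautomaton.starConcat AT AI H₂)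
  | catCat {P₁ P₂ P₃ : Pattern α} {C : Language α} {H : Hyperautomaton α} :
      Computes (.cat P₁ (.cat P₂ P₃)) C H → Computes (.cat (.cat P₁ P₂) P₃) C H.reassoc
  | catAlt {P₁ P₂ P₃ : Pattern α} {C : Language α} {H : Hyperautomaton α} :
      Computes (.alt (.cat P₁ P₃) (.cat P₂ P₃)) C H →
      Computes (.cat (.alt P₁ P₂) P₃) C H.distrib

namespace Hyperautomaton

variable {α : Type}

/-- The language of `(Q_n, I_n, F_n, δ_A)`: the words with a run of `A` from `I_n` to `F_n`. -/
def langAt (H : Hyperautomaton α) (n : Node) : Language α :=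
  {w | ∃ ρ, IsRun H.A (H.f n).I (H.f n).F w ρ}

end Hyperautomaton

/-! ### Matching in linear time on a multi-stack Turing machine -/

/-- The output alphabet of a machine that performs the matching. -/
inductive OutSym (α : Type) : Type
  | letter : α → OutSym α
  | endMark : OutSym α
  | bot : OutSym α
  | noMatch : OutSym α

/-- The output for one node: `⊥`, or the letters of the associated word and an end marker. -/
def encodeValue {α : Type} : Option (List α) → List (OutSym α)
  | none => [OutSym.bot]
  | some u => u.map OutSym.letter ++ [OutSym.endMark]

/-- The output for a list of nodes; `none` says that the word is not matched. -/
def encodeResult {α : Type} : Option (List (Option (List α))) → List (OutSym α)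
  | none => [OutSym.noMatch]
  | some l => l.flatMap encodeValue

/-- `g` is the result of matching words by `P` in the context `C`: for `w ∈ C` matched by `P` with
associations `V` it is the list of the values of `V` at the nodes in `ns`, and for all other `w` it
is the answer that there is no match. -/
def IsMatchResult {α : Type} (P : Pattern α) (C : Language α) (ns : List Node)
    (g : List α → Option (List (Option (List α)))) : Prop :=
  (∀ w V, w ∈ C → Matches P w V → g w = some (ns.map V)) ∧
  (∀ w, ¬ (w ∈ C ∧ ∃ V, Matches P w V) → g w = none)

/-- Some multi-stack Turing machine computes the result of matching `w` by `P` in the context `C`,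
for the associations at the nodes in `ns`, in at most `c * (|w| + 1)` steps, for a constant `c`. -/
def LinearTimeMatching {α : Type} (P : Pattern α) (C : Language α) (ns : List Node) : Prop :=
  ∃ g, IsMatchResult P C ns g ∧
    ∃ M : Turing.TM2ComputableInTime (fun w : List α => w) encodeResult g,
      ∃ c : ℕ, ∀ k, M.time k ≤ c * (k + 1)

/-! ### The matching relation -/

-- The matching relation is a partial function: a pattern matches exactly the words of its language,
-- and each of them with a single association (`Pattern.matchSpec`). For pairs this rests on the
-- longest-match policy, which singles out one split of a word. So the task is to identify the
-- accepting runs of a result with the matched words of the context, one run per word, and to read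
-- the association off the run.
--
-- This is an induction over the rules of `Computes`, with the invariant `Correct`
-- (`Computes.correct`). An accepting run of a union is an accepting run of one summand; for a
-- concatenation and for the automaton of `P₁* · P₂` it consists of accepting runs of the
-- components, glued at λ-moves (`isRun_disjUnion`, `isAcceptingRun_concat`,
-- `isAcceptingRun_starAut`). The contexts of the recursive calls make this decomposition unique:
-- the right summand never sees a word of the left one, an atom has only one word, and `A_I` accepts
-- `p □ s` only for the longest-match split. The contexts are also exact, in that each of their
-- matched words is a part of a matched word of `C`. Therefore the runs inside one component spell
-- precisely the types of its nodes.
--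
-- Reassociation creates one new node, the left operand of `(P₁ · P₂) · P₃`, whose states lie in two
-- places. For it the invariant must record how a run passes a concatenation node (`CatNodeSpec`):
-- at one position, without reading a letter, and never back. Then the visits of the new node
-- stretch from `0` to the second switch. Conversely, a run that stops in the prescribed final
-- states extends to an accepting run that switches where it stopped. For distributivity, the two
-- halves of a disjoint union do not communicate, so uniting triples creates no mixed runs.
--
-- A result exists because every language that occurs is regular. Each membership condition depends
-- on data with finitely many values that are compatible with adding a letter at one end
-- (`isRegular_of_snoc`, `isRegular_of_cons`). The recursion ends since reassociation keeps the size
-- and shrinks the left operand.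
--
-- For linear time, unambiguity makes visits local: the only accepting run visits `S` at a position
-- if and only if a path from the start on the prefix and a path to acceptance on the suffix meet
-- there in `S` (`mem_positions_iff`). A letter lies in the bounded subword if and only if `S` is
-- visited before it and after it. A backward and a forward scan with sets of states detect this,
-- and a machine with finitely many stacks carries them out (`SpanScan.exists_linearTime`).

theorem kleeneDerivable_iff {α : Type} {M : List α → Prop} {L : Language α}
    (hM : ∀ u, M u ↔ u ∈ L) {w : List α} : KleeneDerivable M w ↔ w ∈ KStar.kstar L := by
  constructor
  · intro h
    induction h with
    | empty => exact Language.nil_mem_kstar _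
    | closure h₁ _ _ ih =>
      obtain ⟨L, rfl, hL⟩ := ih
      exact ⟨_ :: L, rfl, List.forall_mem_cons.2 ⟨(hM _).1 h₁, hL⟩⟩
  -- The closure rule demands a nonempty first factor, so the star is used in its form with nonempty
  -- factors.
  · rw [Language.mem_kstar_iff_exists_nonempty]
    rintro ⟨S, rfl, hS⟩
    induction S with
    | nil => exact .empty
    | cons x S ih =>
      rw [List.forall_mem_cons] at hS
      exact .closure ((hM _).2 hS.1.1) (ih hS.2) hS.1.2

namespace Pattern

variable {α : Type}

/-- `P` matches exactly the words of its language, with unique associations that map the root to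
the matched word. -/
structure MatchSpec (P : Pattern α) : Prop where
  mem : ∀ w, (∃ V, Matches P w V) ↔ w ∈ P.lang
  unique : ∀ w V V', Matches P w V → Matches P w V' → V = V'
  root : ∀ w V, Matches P w V → V [] = some w

/-- The analogue of `MatchSpec` for the matching of pairs. -/
structure PairSpec (P Q : Pattern α) : Prop where
  mem : ∀ w, (∃ w₁ w₂ V₁ V₂, MatchesPair P Q w₁ w₂ V₁ V₂ ∧ w = w₁ ++ w₂) ↔ w ∈ P.lang * Q.lang
  unique : ∀ w₁ w₂ V₁ V₂ w₁' w₂' V₁' V₂', MatchesPair P Q w₁ w₂ V₁ V₂ →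
    MatchesPair P Q w₁' w₂' V₁' V₂' → w₁ ++ w₂ = w₁' ++ w₂' →
    w₁ = w₁' ∧ w₂ = w₂' ∧ V₁ = V₁' ∧ V₂ = V₂'
  right : ∀ w₁ w₂ V₁ V₂, MatchesPair P Q w₁ w₂ V₁ V₂ → Matches Q w₂ V₂
  root : ∀ w₁ w₂ V₁ V₂, MatchesPair P Q w₁ w₂ V₁ V₂ → V₁ [] = some w₁

theorem PairSpec.matchSpec {P Q : Pattern α} (h : PairSpec P Q) (hQ : MatchSpec Q) :
    MatchSpec (cat P Q) where
  mem w := by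
    rw [lang, ← h.mem]
    simp only [Matches]
    constructor
    · rintro ⟨V, w₁, w₂, V₁, V₂, hm, hw, -⟩
      exact ⟨w₁, w₂, V₁, V₂, hm, hw⟩
    · rintro ⟨w₁, w₂, V₁, V₂, hm, hw⟩
      exact ⟨_, w₁, w₂, V₁, V₂, hm, hw, rfl⟩
  unique w V V' := by
    simp only [Matches]
    rintro ⟨w₁, w₂, V₁, V₂, hm, rfl, rfl⟩ ⟨w₁', w₂', V₁', V₂', hm', hw, rfl⟩
    obtain ⟨-, -, rfl, rfl⟩ := h.unique _ _ _ _ _ _ _ _ hm hm' hw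
    rfl
  root w V := by
    simp only [Matches]
    rintro ⟨w₁, w₂, V₁, V₂, hm, rfl, rfl⟩
    simp [Assoc.cat, h.root _ _ _ _ hm, hQ.root _ _ (h.right _ _ _ _ hm)]

theorem exists_longest {p : ℕ → Prop} {n : ℕ} (h : ∃ k ≤ n, p k) :
    ∃ k ≤ n, p k ∧ ∀ j ≤ n, p j → j ≤ k := by
  classical
  obtain ⟨k, hk, hp⟩ := h
  exact ⟨Nat.findGreatest p n, Nat.findGreatest_le n, Nat.findGreatest_spec hk hp,
    fun j hj hpj => Nat.le_findGreatest hj hpj⟩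

/-- Among the finitely many cuts of the word into a part in `K` and a part in `L`, take the one with
the longest left part; a further `w₃` would give a longer one. -/
theorem exists_longest_split {K L : Language α} {w : List α} (h : w ∈ K * L) :
    ∃ p s, p ++ s = w ∧ p ∈ K ∧ s ∈ L ∧
      ¬ ∃ w₃ w₄, w₃ ≠ [] ∧ s = w₃ ++ w₄ ∧ p ++ w₃ ∈ K ∧ w₄ ∈ L := by
  obtain ⟨a, ha, b, hb, rfl⟩ := Language.mem_mul.1 h
  obtain ⟨k, hk, ⟨hk₁, hk₂⟩, hmax⟩ := exists_longest
    (p := fun k => (a ++ b).take k ∈ K ∧ (a ++ b).drop k ∈ L) (n := (a ++ b).length)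
    ⟨a.length, by simp, by simpa using ha, by simpa using hb⟩
  refine ⟨_, _, List.take_append_drop k (a ++ b), hk₁, hk₂, ?_⟩
  rintro ⟨w₃, w₄, h₃, hs, h₁, h₂⟩
  have hw : a ++ b = (a ++ b).take k ++ (w₃ ++ w₄) := by rw [← hs, List.take_append_drop]
  have hl : ((a ++ b).take k).length = k := by simpa using hk
  generalize (a ++ b).take k = p at *
  rw [hw] at hmax
  have h0 : 0 < w₃.length := List.length_pos_iff.2 h₃
  have := hmax (p ++ w₃).length (by simp) ⟨by
    rw [← List.append_assoc, List.take_left]; exact h₁, by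
    rw [← List.append_assoc, List.drop_left]; exact h₂⟩
  simp only [List.length_append] at this
  omega

/-- Of two prefixes of a word one extends the other. If the extension is nonempty, it contradicts
the maximality of the shorter prefix. -/
theorem longest_split_unique {K L : Language α} {p s p' s' : List α} (he : p ++ s = p' ++ s')
    (hp : p ∈ K) (hs : s ∈ L) (hp' : p' ∈ K) (hs' : s' ∈ L)
    (hm : ¬ ∃ w₃ w₄, w₃ ≠ [] ∧ s = w₃ ++ w₄ ∧ p ++ w₃ ∈ K ∧ w₄ ∈ L)
    (hm' : ¬ ∃ w₃ w₄, w₃ ≠ [] ∧ s' = w₃ ++ w₄ ∧ p' ++ w₃ ∈ K ∧ w₄ ∈ L) : p = p' ∧ s = s' := by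
  rcases List.append_eq_append_iff.1 he with ⟨a, rfl, h⟩ | ⟨a, rfl, h⟩
  · rcases eq_or_ne a [] with rfl | ha
    · simpa using h
    · exact (hm ⟨a, s', ha, h, hp', hs'⟩).elim
  · rcases eq_or_ne a [] with rfl | ha
    · simpa using h.symm
    · exact (hm' ⟨a, s, ha, h, hp, hs⟩).elim

theorem MatchSpec.star {P : Pattern α} (hP : MatchSpec P) : MatchSpec (star P) where
  mem w := by
    simp [Matches, kleeneDerivable_iff hP.mem, lang]
  unique w V V' := by
    simp only [Matches]
    rintro ⟨-, rfl⟩ ⟨-, rfl⟩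
    rfl
  root w V := by
    simp only [Matches]
    rintro ⟨-, rfl⟩
    rfl

theorem matchesPair_star_iff {P Q : Pattern α} (hP : MatchSpec P) (hQ : MatchSpec Q)
    {w₁ w₂ : List α} {V₁ V₂ : Assoc α} :
    MatchesPair (star P) Q w₁ w₂ V₁ V₂ ↔ V₁ = Assoc.single w₁ ∧ Matches Q w₂ V₂ ∧
      w₁ ∈ (star P).lang ∧
      ¬ ∃ w₃ w₄, w₃ ≠ [] ∧ w₂ = w₃ ++ w₄ ∧ w₁ ++ w₃ ∈ (star P).lang ∧ w₄ ∈ Q.lang := by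
  rw [MatchesPair]
  simp only [hQ.mem, hP.star.mem]
  have : Matches (star P) w₁ V₁ ↔ w₁ ∈ (star P).lang ∧ V₁ = Assoc.single w₁ := by
    rw [← hP.star.mem]
    simp [Matches]
  rw [this]
  tauto

/-- The two specifications need each other: a concatenation is matched through pairs, and the pair
rules refer back to matching. The right operand stays universally quantified because the rule for
`(P₁ · P₂) · Q` calls `P₁` with another right operand. -/
theorem matchSpec_and_pairSpec (P : Pattern α) :
    MatchSpec P ∧ ∀ Q, MatchSpec Q → PairSpec P Q := by
  induction P with
  | eps =>
    refine ⟨⟨fun w => by simp [Matches, lang], ?_, ?_⟩, fun Q hQ => ⟨fun w => ?_, ?_, ?_, ?_⟩⟩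
    · simp only [Matches]
      rintro w V V' ⟨-, rfl⟩ ⟨-, rfl⟩
      rfl
    · simp only [Matches]
      rintro w V ⟨rfl, rfl⟩
      rfl
    · simp only [MatchesPair, lang, one_mul, ← hQ.mem]
      constructor
      · rintro ⟨w₁, w₂, V₁, V₂, ⟨rfl, rfl, hm⟩, rfl⟩
        exact ⟨V₂, hm⟩
      · rintro ⟨V, hV⟩
        exact ⟨[], w, _, V, ⟨rfl, rfl, hV⟩, rfl⟩
    · simp only [MatchesPair]
      rintro w₁ w₂ V₁ V₂ w₁' w₂' V₁' V₂' ⟨rfl, rfl, hm⟩ ⟨rfl, rfl, hm'⟩ h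
      obtain rfl : w₂ = w₂' := h
      exact ⟨rfl, rfl, rfl, hQ.unique _ _ _ hm hm'⟩
    · simp only [MatchesPair]
      exact fun _ _ _ _ h => h.2.2
    · simp only [MatchesPair]
      rintro _ _ _ _ ⟨rfl, rfl, -⟩
      rfl
  | sym a =>
    refine ⟨⟨fun w => by simp only [Matches, lang]; simp; rfl, ?_, ?_⟩,
      fun Q hQ => ⟨fun w => ?_, ?_, ?_, ?_⟩⟩
    · simp only [Matches]
      rintro w V V' ⟨-, rfl⟩ ⟨-, rfl⟩
      rfl
    · simp only [Matches]
      rintro w V ⟨rfl, rfl⟩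
      rfl
    · refine Iff.trans ?_ Language.mem_mul.symm
      simp only [MatchesPair, Matches, ← hQ.mem]
      constructor
      · rintro ⟨w₁, w₂, V₁, V₂, ⟨rfl, -, hm⟩, rfl⟩
        exact ⟨_, rfl, _, ⟨V₂, hm⟩, rfl⟩
      · rintro ⟨_, rfl, w, ⟨V, hV⟩, rfl⟩
        exact ⟨[a], w, _, V, ⟨rfl, ⟨rfl, rfl⟩, hV⟩, rfl⟩
    · simp only [MatchesPair, Matches]
      rintro w₁ w₂ V₁ V₂ w₁' w₂' V₁' V₂' ⟨rfl, ⟨-, rfl⟩, hm⟩ ⟨rfl, ⟨-, rfl⟩, hm'⟩ h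
      obtain rfl : w₂ = w₂' := by simpa using h
      exact ⟨rfl, rfl, rfl, hQ.unique _ _ _ hm hm'⟩
    · simp only [MatchesPair]
      exact fun _ _ _ _ h => h.2.2
    · simp only [MatchesPair, Matches]
      rintro _ _ _ _ ⟨rfl, ⟨-, rfl⟩, -⟩
      rfl
  | star P ih =>
    refine ⟨ih.1.star, fun Q hQ => ⟨fun w => ?_, ?_, ?_, ?_⟩⟩
    · simp only [matchesPair_star_iff ih.1 hQ]
      constructor
      · rintro ⟨w₁, w₂, V₁, V₂, ⟨-, h₂, h₁, -⟩, rfl⟩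
        exact Language.append_mem_mul h₁ ((hQ.mem _).1 ⟨_, h₂⟩)
      · intro hw
        obtain ⟨p, s, rfl, hp, hs, h⟩ := exists_longest_split hw
        obtain ⟨V, hV⟩ := (hQ.mem _).2 hs
        exact ⟨p, s, _, V, ⟨rfl, hV, hp, h⟩, rfl⟩
    · simp only [matchesPair_star_iff ih.1 hQ]
      rintro w₁ w₂ V₁ V₂ w₁' w₂' V₁' V₂' ⟨rfl, h₂, h₁, hm⟩ ⟨rfl, h₂', h₁', hm'⟩ h
      obtain ⟨rfl, rfl⟩ := longest_split_unique h h₁ ((hQ.mem _).1 ⟨_, h₂⟩) h₁'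
        ((hQ.mem _).1 ⟨_, h₂'⟩) hm hm'
      exact ⟨rfl, rfl, rfl, hQ.unique _ _ _ h₂ h₂'⟩
    · simp only [matchesPair_star_iff ih.1 hQ]
      exact fun _ _ _ _ h => h.2.1
    · simp only [matchesPair_star_iff ih.1 hQ]
      rintro _ _ _ _ ⟨rfl, -⟩
      rfl
  | alt P₁ P₂ ih₁ ih₂ =>
    refine ⟨⟨fun w => ?_, ?_, ?_⟩, fun Q hQ => ⟨fun w => ?_, ?_, ?_, ?_⟩⟩
    · simp only [Matches, lang, Language.mem_add, ← ih₁.1.mem, ← ih₂.1.mem]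
      constructor
      · rintro ⟨V, ⟨V₁, h, -⟩ | ⟨V₂, h, -⟩⟩
        exacts [.inl ⟨_, h⟩, .inr ⟨_, h⟩]
      · intro h
        by_cases h₁ : ∃ V, Matches P₁ w V
        · obtain ⟨V, hV⟩ := h₁
          exact ⟨_, .inl ⟨V, hV, rfl⟩⟩
        · obtain ⟨V, hV⟩ := h.resolve_left h₁
          exact ⟨_, .inr ⟨V, hV, h₁, rfl⟩⟩
    · simp only [Matches]
      rintro w V V' (⟨V₁, h, rfl⟩ | ⟨V₂, h, hn, rfl⟩) (⟨V₁', h', rfl⟩ | ⟨V₂', h', hn', rfl⟩)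
      · rw [ih₁.1.unique _ _ _ h h']
      · exact (hn' ⟨_, h⟩).elim
      · exact (hn ⟨_, h'⟩).elim
      · rw [ih₂.1.unique _ _ _ h h']
    · simp only [Matches]
      rintro w V (⟨V₁, h, rfl⟩ | ⟨V₂, h, hn, rfl⟩)
      · exact ih₁.1.root _ V₁ h
      · exact ih₂.1.root _ V₂ h
    -- The negative side condition of the second pair rule speaks of `P₁ · Q`, whose language is
    -- known from the pair specification of `P₁`.
    · have h₁ := ((ih₁.2 Q hQ).matchSpec hQ).mem
      rw [lang, add_mul, Language.mem_add]
      simp only [MatchesPair, h₁]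
      constructor
      · rintro ⟨w₁, w₂, V₁, V₂, ⟨V, h, -⟩ | ⟨V, h, -⟩, rfl⟩
        exacts [.inl (((ih₁.2 Q hQ).mem _).1 ⟨_, _, _, _, h, rfl⟩),
          .inr (((ih₂.2 Q hQ).mem _).1 ⟨_, _, _, _, h, rfl⟩)]
      · intro h
        by_cases hc : w ∈ P₁.lang * Q.lang
        · obtain ⟨w₁, w₂, V₁, V₂, hm, rfl⟩ := ((ih₁.2 Q hQ).mem w).2 hc
          exact ⟨w₁, w₂, _, V₂, .inl ⟨V₁, hm, rfl⟩, rfl⟩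
        · obtain ⟨w₁, w₂, V₁, V₂, hm, rfl⟩ := ((ih₂.2 Q hQ).mem w).2 (h.resolve_left hc)
          exact ⟨w₁, w₂, _, V₂, .inr ⟨V₁, hm, hc, rfl⟩, rfl⟩
    · have h₁ := ((ih₁.2 Q hQ).matchSpec hQ).mem
      simp only [MatchesPair, h₁]
      have key : ∀ w₁ w₂ V₁ V₂, MatchesPair P₁ Q w₁ w₂ V₁ V₂ → w₁ ++ w₂ ∈ (cat P₁ Q).lang :=
        fun w₁ w₂ V₁ V₂ h => ((ih₁.2 Q hQ).mem _).1 ⟨_, _, _, _, h, rfl⟩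
      rintro w₁ w₂ V₁ V₂ w₁' w₂' V₁' V₂' (⟨V, h, rfl⟩ | ⟨V, h, hn, rfl⟩)
        (⟨V', h', rfl⟩ | ⟨V', h', hn', rfl⟩) he
      · obtain ⟨rfl, rfl, rfl, rfl⟩ := (ih₁.2 Q hQ).unique _ _ _ _ _ _ _ _ h h' he
        exact ⟨rfl, rfl, rfl, rfl⟩
      · exact (hn' (he ▸ key _ _ _ _ h)).elim
      · exact (hn (he ▸ key _ _ _ _ h')).elim
      · obtain ⟨rfl, rfl, rfl, rfl⟩ := (ih₂.2 Q hQ).unique _ _ _ _ _ _ _ _ h h' he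
        exact ⟨rfl, rfl, rfl, rfl⟩
    · simp only [MatchesPair]
      rintro w₁ w₂ V₁ V₂ (⟨V, h, rfl⟩ | ⟨V, h, hn, rfl⟩)
      exacts [(ih₁.2 Q hQ).right _ _ _ _ h, (ih₂.2 Q hQ).right _ _ _ _ h]
    · simp only [MatchesPair]
      rintro w₁ w₂ V₁ V₂ (⟨V, h, rfl⟩ | ⟨V, h, hn, rfl⟩)
      · exact (ih₁.2 Q hQ).root _ _ V _ h
      · exact (ih₂.2 Q hQ).root _ _ V _ h
  | cat P₁ P₂ ih₁ ih₂ =>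
    refine ⟨(ih₁.2 _ ih₂.1).matchSpec ih₂.1, fun Q hQ => ?_⟩
    -- The specification of `P₂ · Q` comes from the hypothesis for `P₂`; the hypothesis for `P₁` is
    -- then used with this right operand.
    have hB := ih₂.2 Q hQ
    have hA := hB.matchSpec hQ
    have hC := ih₁.2 _ hA
    refine ⟨fun w => ?_, ?_, ?_, ?_⟩
    · rw [lang, mul_assoc]
      refine Iff.trans ?_ (hC.mem w)
      simp only [MatchesPair]
      constructor
      · rintro ⟨_, w₃, _, V₃, ⟨w₁, w₂, V₁, V₂, W, h₁, h₂, rfl, rfl⟩, rfl⟩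
        exact ⟨_, _, _, _, h₁, List.append_assoc _ _ _⟩
      · rintro ⟨w₁, w, V₁, W, h, rfl⟩
        -- The rule asks for a separate match of the pair `(w₂, w₃)`; it is contained in the match
        -- of the right operand `P₂ · Q`.
        have := hC.right _ _ _ _ h
        rw [Matches] at this
        obtain ⟨w₂, w₃, V₂, V₃, h₂, rfl, -⟩ := this
        exact ⟨w₁ ++ w₂, w₃, _, V₃, ⟨w₁, w₂, V₁, V₂, W, h, h₂, rfl, rfl⟩,
          (List.append_assoc _ _ _).symm⟩
    · simp only [MatchesPair]
      rintro w w₃ V V₃ w' w₃' V' V₃' ⟨w₁, w₂, V₁, V₂, W, h₁, h₂, rfl, rfl⟩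
        ⟨w₁', w₂', V₁', V₂', W', h₁', h₂', rfl, rfl⟩ he
      rw [List.append_assoc, List.append_assoc] at he
      obtain ⟨rfl, he, rfl, rfl⟩ := hC.unique _ _ _ _ _ _ _ _ h₁ h₁' he
      obtain ⟨rfl, rfl, rfl, rfl⟩ := hB.unique _ _ _ _ _ _ _ _ h₂ h₂' he
      exact ⟨rfl, rfl, rfl, rfl⟩
    · simp only [MatchesPair]
      rintro w w₃ V V₃ ⟨w₁, w₂, V₁, V₂, W, h₁, h₂, rfl, rfl⟩
      exact hB.right _ _ _ _ h₂
    · simp only [MatchesPair]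
      rintro w w₃ V V₃ ⟨w₁, w₂, V₁, V₂, W, h₁, h₂, rfl, rfl⟩
      simp [Assoc.cat, hC.root _ _ _ _ h₁, hB.root _ _ _ _ h₂]

theorem matchSpec (P : Pattern α) : MatchSpec P := (matchSpec_and_pairSpec P).1

theorem pairSpec (P Q : Pattern α) : PairSpec P Q := (matchSpec_and_pairSpec P).2 Q (matchSpec Q)

end Pattern

-- Matching under reassociation and distributivity

namespace Assoc

variable {α : Type}

/-- The associations for `(P₁ · P₂) · P₃` from those for `P₁ · (P₂ · P₃)`. -/
def reassoc (V : Assoc α) : Assoc α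
  | [] => V []
  | [Dir.one] => match V [Dir.one], V [Dir.two, Dir.one] with
    | some w₁, some w₂ => some (w₁ ++ w₂)
    | _, _ => none
  | Dir.one :: Dir.one :: n => V (Dir.one :: n)
  | Dir.one :: Dir.two :: n => V (Dir.two :: Dir.one :: n)
  | Dir.two :: n => V (Dir.two :: Dir.two :: n)

/-- The associations for `(P₁ + P₂) · P₃` from those for `P₁ · P₃`. -/
def distribLeft (V : Assoc α) : Assoc α
  | [] => V []
  | [Dir.one] => V [Dir.one]
  | Dir.one :: Dir.one :: n => V (Dir.one :: n)
  | Dir.one :: Dir.two :: _ => none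
  | Dir.two :: n => V (Dir.two :: n)

/-- The associations for `(P₁ + P₂) · P₃` from those for `P₂ · P₃`. -/
def distribRight (V : Assoc α) : Assoc α
  | [] => V []
  | [Dir.one] => V [Dir.one]
  | Dir.one :: Dir.one :: _ => none
  | Dir.one :: Dir.two :: n => V (Dir.one :: n)
  | Dir.two :: n => V (Dir.two :: n)

theorem reassoc_cat (V₁ V₂ V₃ : Assoc α) :
    (V₁.cat (V₂.cat V₃)).reassoc = (V₁.cat V₂).cat V₃ := by
  funext n
  match n with
  | [] =>
    simp only [reassoc, cat]
    cases V₁ [] <;> cases V₂ [] <;> cases V₃ [] <;> simp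
  | [Dir.one] => rfl
  | Dir.one :: Dir.one :: n => rfl
  | Dir.one :: Dir.two :: n => rfl
  | Dir.two :: n => rfl

theorem distribLeft_cat (V₁ V₂ : Assoc α) : (V₁.cat V₂).distribLeft = V₁.orLeft.cat V₂ := by
  funext n
  match n with
  | [] => rfl
  | [Dir.one] => rfl
  | Dir.one :: Dir.one :: n => rfl
  | Dir.one :: Dir.two :: n => rfl
  | Dir.two :: n => rfl

theorem distribRight_cat (V₁ V₂ : Assoc α) : (V₁.cat V₂).distribRight = V₁.orRight.cat V₂ := by
  funext n
  match n with
  | [] => rfl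
  | [Dir.one] => rfl
  | Dir.one :: Dir.one :: n => rfl
  | Dir.one :: Dir.two :: n => rfl
  | Dir.two :: n => rfl

end Assoc

namespace Pattern

variable {α : Type} {P₁ P₂ P₃ : Pattern α} {w : List α} {V : Assoc α}

/-- The association `W` that the rule leaves open is forced to be `V₂.cat V₃`, because the right
operand `P₂ · P₃` matches with a unique association. -/
theorem matches_catCat_iff :
    Matches (cat (cat P₁ P₂) P₃) w V ↔
      ∃ V', Matches (cat P₁ (cat P₂ P₃)) w V' ∧ V = V'.reassoc := by
  rw [Matches]
  constructor
  · simp only [MatchesPair]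
    rintro ⟨_, w₃, _, V₃, ⟨w₁, w₂, V₁, V₂, W, h₁, h₂, rfl, rfl⟩, rfl, rfl⟩
    have hW : W = V₂.cat V₃ := by
      refine (matchSpec (cat P₂ P₃)).unique _ _ _ ((pairSpec _ _).right _ _ _ _ h₁) ?_
      rw [Matches]
      exact ⟨_, _, _, _, h₂, rfl, rfl⟩
    subst hW
    refine ⟨V₁.cat (V₂.cat V₃), ?_, (Assoc.reassoc_cat _ _ _).symm⟩
    rw [Matches]
    exact ⟨_, _, _, _, h₁, List.append_assoc _ _ _, rfl⟩
  · rintro ⟨V', h, rfl⟩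
    rw [Matches] at h
    obtain ⟨w₁, w, V₁, W, h₁, rfl, rfl⟩ := h
    have := (pairSpec _ _).right _ _ _ _ h₁
    rw [Matches] at this
    obtain ⟨w₂, w₃, V₂, V₃, h₂, rfl, rfl⟩ := this
    refine ⟨w₁ ++ w₂, w₃, V₁.cat V₂, V₃, ?_, (List.append_assoc _ _ _).symm,
      Assoc.reassoc_cat _ _ _⟩
    rw [MatchesPair]
    exact ⟨_, _, _, _, _, h₁, h₂, rfl, rfl⟩

theorem matches_catAlt_iff :
    Matches (cat (alt P₁ P₂) P₃) w V ↔
      (∃ V', Matches (cat P₁ P₃) w V' ∧ V = V'.distribLeft) ∨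
      (∃ V', Matches (cat P₂ P₃) w V' ∧ (¬ ∃ V', Matches (cat P₁ P₃) w V') ∧
        V = V'.distribRight) := by
  constructor
  · intro h
    rw [Matches] at h
    obtain ⟨w₁, w₂, V, V₂, h, rfl, rfl⟩ := h
    rw [MatchesPair] at h
    obtain ⟨V₁, h, rfl⟩ | ⟨V₁, h, hn, rfl⟩ := h
    · refine .inl ⟨V₁.cat V₂, ?_, (Assoc.distribLeft_cat _ _).symm⟩
      rw [Matches]
      exact ⟨_, _, _, _, h, rfl, rfl⟩
    · refine .inr ⟨V₁.cat V₂, ?_, hn, (Assoc.distribRight_cat _ _).symm⟩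
      rw [Matches]
      exact ⟨_, _, _, _, h, rfl, rfl⟩
  · rintro (⟨V', h, rfl⟩ | ⟨V', h, hn, rfl⟩)
    · rw [Matches] at h
      obtain ⟨w₁, w₂, V, V₂, h, rfl, rfl⟩ := h
      rw [Matches, Assoc.distribLeft_cat]
      refine ⟨_, _, _, _, ?_, rfl, rfl⟩
      rw [MatchesPair]
      exact .inl ⟨_, h, rfl⟩
    · rw [Matches] at h
      obtain ⟨w₁, w₂, V, V₂, h, rfl, rfl⟩ := h
      rw [Matches, Assoc.distribRight_cat]
      refine ⟨_, _, _, _, ?_, rfl, rfl⟩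
      rw [MatchesPair]
      exact .inr ⟨_, h, hn, rfl⟩

theorem matches_base_iff {P : Pattern α} (hP : P.IsBase) :
    Matches P w V ↔ w ∈ P.lang ∧ V = Assoc.single w := by
  rw [← (matchSpec P).mem]
  constructor
  · intro h
    refine ⟨⟨V, h⟩, ?_⟩
    obtain rfl | ⟨a, rfl⟩ | ⟨P₁, rfl⟩ := hP
    all_goals
      rw [Matches] at h
      obtain ⟨h₁, rfl⟩ := h
      first | rfl | rw [h₁]
  · rintro ⟨⟨V', h⟩, rfl⟩
    obtain rfl | ⟨a, rfl⟩ | ⟨P₁, rfl⟩ := hP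
    all_goals
      rw [Matches] at h ⊢
      obtain ⟨h₁, rfl⟩ := h
      exact ⟨h₁, by first | rfl | rw [h₁]⟩

theorem matchesPair_atom_iff {P Q : Pattern α} (hP : P.IsAtom) {w₁ w₂ : List α}
    {V₁ V₂ : Assoc α} :
    MatchesPair P Q w₁ w₂ V₁ V₂ ↔ Matches P w₁ V₁ ∧ Matches Q w₂ V₂ := by
  obtain rfl | ⟨a, rfl⟩ := hP
  · simp only [MatchesPair, Matches]
    tauto
  · simp only [MatchesPair, Matches]
    tauto

theorem matches_starCat_iff {P Q : Pattern α} {C : Language α} :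
    (w ∈ C ∧ Matches (cat (star P) Q) w V) ↔
      ∃ p s V₂, w = p ++ s ∧ StarSplit P Q C p s ∧ Matches Q s V₂ ∧
        V = (Assoc.single p).cat V₂ := by
  rw [Matches]
  simp only [matchesPair_star_iff (matchSpec P) (matchSpec Q), StarSplit,
    ← (matchSpec Q).mem, eq_comm (b := (_ ++ _ : List α))]
  constructor
  · rintro ⟨hw, p, s, _, V₂, ⟨rfl, h₂, h₁, h⟩, rfl, rfl⟩
    exact ⟨p, s, V₂, rfl, ⟨hw, h₁, ⟨_, h₂⟩, h⟩, h₂, rfl⟩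
  · rintro ⟨p, s, V₂, rfl, ⟨hw, h₁, -, h⟩, h₂, rfl⟩
    exact ⟨hw, p, s, _, V₂, ⟨rfl, h₂, h₁, h⟩, rfl, rfl⟩

theorem starSplit_unique {P Q : Pattern α} {C : Language α} {p s p' s' : List α}
    (h : StarSplit P Q C p s) (h' : StarSplit P Q C p' s') (he : p ++ s = p' ++ s') :
    p = p' ∧ s = s' := by
  obtain ⟨-, h₁, h₂, h₃⟩ := h
  obtain ⟨-, h₁', h₂', h₃'⟩ := h'
  simp only [eq_comm (b := s)] at h₃
  simp only [eq_comm (b := s')] at h₃'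
  exact longest_split_unique he h₁ h₂ h₁' h₂' h₃ h₃'

end Pattern

/-! ### Chains -/

namespace List

variable {β γ : Type*} {R : β → β → Prop} {l : List β} {x y : β}

theorem IsChain.reflTransGen_head (h : l.IsChain R) (hx : l.head? = some x) (hy : y ∈ l) :
    Relation.ReflTransGen R x y := by
  induction l generalizing x with
  | nil => cases hy
  | cons a l ih =>
    obtain rfl : a = x := by simpa using hx
    rcases mem_cons.1 hy with rfl | hy
    · exact .refl
    · cases l with
      | nil => cases hy
      | cons b l =>
        rw [isChain_cons_cons] at h
        exact .head h.1 (ih h.2 rfl hy)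

theorem IsChain.reflTransGen_getLast (h : l.IsChain R) (hx : l.getLast? = some x) (hy : y ∈ l) :
    Relation.ReflTransGen R y x := by
  have h' : l.reverse.IsChain (fun a b => R b a) := isChain_reverse.2 h
  have := h'.reflTransGen_head (by rwa [head?_reverse]) (mem_reverse.2 hy)
  exact Relation.reflTransGen_swap.1 this

theorem IsChain.pairwise_reflTransGen (h : l.IsChain R) :
    l.Pairwise (Relation.ReflTransGen R) :=
  (h.imp fun _ _ => Relation.ReflTransGen.single).pairwise

/-- Decides which of two visits of a run comes first; combined with non-reachability it orders the
visits of two state sets. -/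
theorem IsChain.reflTransGen_total (h : l.IsChain R) (hx : x ∈ l) (hy : y ∈ l) :
    Relation.ReflTransGen R x y ∨ Relation.ReflTransGen R y x :=
  haveI : Std.Symm fun x y => Relation.ReflTransGen R x y ∨ Relation.ReflTransGen R y x :=
    ⟨fun _ _ => Or.symm⟩
  Pairwise.forall_of_forall (R := fun x y => Relation.ReflTransGen R x y ∨
      Relation.ReflTransGen R y x) (fun _ _ => Or.inl .refl)
    (h.pairwise_reflTransGen.imp fun h => Or.inl h) hx hy

theorem IsChain.forall_of_closed (h : l.IsChain R) {p : β → Prop}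
    (hp : ∀ x y, p x → R x y → p y) (hx : l.head? = some x) (hpx : p x) : ∀ y ∈ l, p y := by
  intro y hy
  have := h.reflTransGen_head hx hy
  clear hy
  induction this with
  | refl => exact hpx
  | tail _ h₂ ih => exact hp _ _ ih h₂

/-- Determinism only makes one chain a prefix of the other. The predicate `f` describes dead ends,
and both chains end in one, so they stop together. -/
theorem IsChain.eq_of_deterministic {l' : List β} (hR : ∀ x y z, R x y → R x z → y = z)
    {f : β → Prop} (hf : ∀ x y, f x → ¬ R x y) (h : l.IsChain R) (h' : l'.IsChain R)
    (hx : l.head? = some x) (hx' : l'.head? = some x) (hl : ∀ y ∈ l.getLast?, f y)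
    (hl' : ∀ y ∈ l'.getLast?, f y) : l = l' := by
  induction l generalizing l' x with
  | nil => cases hx
  | cons a l ih =>
    obtain rfl : a = x := by simpa using hx
    obtain ⟨l', rfl⟩ : ∃ m, l' = a :: m := by
      cases l' with
      | nil => cases hx'
      | cons b l' => exact ⟨l', by simpa using hx'⟩
    cases l with
    | nil =>
      cases l' with
      | nil => rfl
      | cons b l' => exact (hf _ _ (hl a rfl) (isChain_cons_cons.1 h').1).elim
    | cons b l =>
      cases l' with
      | nil => exact (hf _ _ (hl' a rfl) (isChain_cons_cons.1 h).1).elim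
      | cons c l' =>
        rw [isChain_cons_cons] at h h'
        obtain rfl := hR _ _ _ h.1 h'.1
        rw [ih h.2 h'.2 rfl rfl (by simpa using hl) (by simpa using hl')]

theorem exists_map_eq_of_forall {f : γ → β} (h : ∀ x ∈ l, ∃ z, f z = x) : ∃ m : List γ, l = m.map f := by
  induction l with
  | nil => exact ⟨[], rfl⟩
  | cons a l ih =>
    rw [forall_mem_cons] at h
    obtain ⟨⟨z, rfl⟩, h⟩ := h
    obtain ⟨m, rfl⟩ := ih h
    exact ⟨z :: m, rfl⟩

/-- A chain of a relation that never leaves `p` splits into a part outside of `p` and a part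
in `p`. -/
theorem IsChain.exists_append_of_closed (h : l.IsChain R) {p : β → Prop}
    (hp : ∀ x y, p x → R x y → p y) :
    ∃ l₁ l₂, l = l₁ ++ l₂ ∧ (∀ x ∈ l₁, ¬ p x) ∧ ∀ x ∈ l₂, p x := by
  induction l with
  | nil => exact ⟨[], [], rfl, by simp, by simp⟩
  | cons a l ih =>
    by_cases ha : p a
    · exact ⟨[], a :: l, rfl, by simp, h.forall_of_closed hp rfl ha⟩
    · obtain ⟨l₁, l₂, rfl, h₁, h₂⟩ := ih h.of_cons
      exact ⟨a :: l₁, l₂, rfl, by simpa using ⟨ha, h₁⟩, h₂⟩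

end List

/-! ### Runs -/

section RunLemmas

variable {α σ τ : Type} {A : εNFA α σ} {B : εNFA α τ} {w u : List α} {x y : σ × ℕ}

/-- Reachability in an automaton. -/
def Reach (A : εNFA α σ) : σ → σ → Prop := Relation.ReflTransGen (fun r r' => ∃ x, r' ∈ A.step r x)

/-- Reachability by `λ`-transitions. -/
def EpsReach (A : εNFA α σ) : σ → σ → Prop := Relation.ReflTransGen (fun r r' => r' ∈ A.step r none)

theorem RunStep.pos_le (h : RunStep A w x y) : x.2 ≤ y.2 := by
  obtain ⟨a, -, -, h⟩ | ⟨-, h, -⟩ := h <;> omega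

theorem RunStep.append (h : RunStep A w x y) : RunStep A (w ++ u) x y := by
  obtain ⟨a, ha, h⟩ | h := h
  · refine .inl ⟨a, ?_, h⟩
    rw [List.getElem?_append_left (List.getElem?_eq_some_iff.1 ha).1, ha]
  · exact .inr h

theorem RunStep.of_append (h : RunStep A (w ++ u) x y) (hy : y.2 ≤ w.length) :
    RunStep A w x y := by
  obtain ⟨a, ha, h, h'⟩ | h := h
  · refine .inl ⟨a, ?_, h, h'⟩
    rwa [List.getElem?_append_left (by omega)] at ha
  · exact .inr h

theorem runStep_shift {q q' : σ} {i j : ℕ} :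
    RunStep A (u ++ w) (q, i + u.length) (q', j + u.length) ↔ RunStep A w (q, i) (q', j) := by
  simp only [RunStep, List.getElem?_append_right (Nat.le_add_left u.length i),
    Nat.add_sub_cancel, Nat.add_right_comm _ u.length 1, Nat.add_right_cancel_iff]

theorem reflTransGen_runStep_le (h : Relation.ReflTransGen (RunStep A w) x y) : x.2 ≤ y.2 := by
  induction h with
  | refl => exact le_rfl
  | tail _ h ih => exact ih.trans h.pos_le

theorem reflTransGen_runStep_reach (h : Relation.ReflTransGen (RunStep A w) x y) :
    Reach A x.1 y.1 := by
  refine Relation.ReflTransGen.lift (p := fun r r' => ∃ x, r' ∈ A.step r x) Prod.fst ?_ _ _ h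
  rintro _ _ (⟨a, -, h, -⟩ | ⟨h, -⟩)
  exacts [⟨_, h⟩, ⟨_, h⟩]

theorem reflTransGen_runStep_epsReach (h : Relation.ReflTransGen (RunStep A w) x y)
    (hxy : x.2 = y.2) : EpsReach A x.1 y.1 := by
  induction h with
  | refl => exact .refl
  | @tail y z h₁ h₂ ih =>
    have h₃ := reflTransGen_runStep_le h₁
    obtain ⟨a, -, -, h⟩ | ⟨h, h', -⟩ := h₂
    · omega
    · exact (ih (by omega)).tail h

/-- Moving a run to the right by `k` positions. -/
def shiftRun (k : ℕ) (ρ : List (σ × ℕ)) : List (σ × ℕ) := ρ.map fun x => (x.1, x.2 + k)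

theorem isChain_shiftRun {ρ : List (σ × ℕ)} :
    (shiftRun u.length ρ).IsChain (RunStep A (u ++ w)) ↔ ρ.IsChain (RunStep A w) := by
  rw [shiftRun, List.isChain_map]
  simp only [runStep_shift]

theorem head?_shiftRun {k : ℕ} {ρ : List (σ × ℕ)} :
    (shiftRun k ρ).head? = ρ.head?.map fun x => (x.1, x.2 + k) := by
  simp [shiftRun]

theorem getLast?_shiftRun {k : ℕ} {ρ : List (σ × ℕ)} :
    (shiftRun k ρ).getLast? = ρ.getLast?.map fun x => (x.1, x.2 + k) := by
  simp [shiftRun]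

theorem IsRun.ne_nil {I F : Set σ} {ρ : List (σ × ℕ)} (h : IsRun A I F w ρ) : ρ ≠ [] := by
  rintro rfl
  obtain ⟨_, _, h⟩ := h.2.1
  cases h

theorem IsRun.pos_le {I F : Set σ} {ρ : List (σ × ℕ)} (h : IsRun A I F w ρ) (hx : x ∈ ρ) :
    x.2 ≤ w.length := by
  obtain ⟨h₁, -, q, -, h₂⟩ := h
  exact reflTransGen_runStep_le (h₁.reflTransGen_getLast h₂ hx)

theorem IsRun.mono {I I' F F' : Set σ} {ρ : List (σ × ℕ)} (h : IsRun A I F w ρ) (hI : I ⊆ I')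
    (hF : F ⊆ F') : IsRun A I' F' w ρ :=
  ⟨h.1, h.2.1.imp fun _ h => ⟨hI h.1, h.2⟩, h.2.2.imp fun _ h => ⟨hF h.1, h.2⟩⟩

/-- Gluing runs at a `λ`-transition. -/
theorem IsRun.glue {I F I' F' : Set σ} {ρ ρ' : List (σ × ℕ)} (h : IsRun A I F u ρ)
    (h' : IsRun A I' F' w ρ') (hs : ∀ q ∈ F, ∀ q' ∈ I', q' ∈ A.step q none ∧ q ≠ q') :
    IsRun A I F' (u ++ w) (ρ ++ shiftRun u.length ρ') := by
  have hne := h.ne_nil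
  have hne' := h'.ne_nil
  obtain ⟨h₁, ⟨q₁, hq₁, h₂⟩, q₂, hq₂, h₃⟩ := h
  obtain ⟨h₁', ⟨q₁', hq₁', h₂'⟩, q₂', hq₂', h₃'⟩ := h'
  refine ⟨List.isChain_append.2 ⟨h₁.imp fun _ _ h => h.append, isChain_shiftRun.2 h₁', ?_⟩,
    ⟨q₁, hq₁, ?_⟩, q₂', hq₂', ?_⟩
  · rw [h₃, head?_shiftRun, h₂']
    rintro _ ⟨⟩ _ ⟨⟩
    exact .inr ⟨(hs _ hq₂ _ hq₁').1, by simp, (hs _ hq₂ _ hq₁').2⟩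
  · rw [List.head?_append_of_ne_nil _ hne, h₂]
  · rw [List.getLast?_append_of_ne_nil _ (by simpa [shiftRun] using hne'), getLast?_shiftRun, h₃']
    simp [Nat.add_comm]

/-- Cutting a run at a place where no letter can be read. -/
theorem IsRun.cut {I F : Set σ} {ρ ρ' : List (σ × ℕ)} (h : IsRun A I F w (ρ ++ ρ'))
    (hne : ρ ≠ []) (hne' : ρ' ≠ [])
    (hs : ∀ x ∈ ρ.getLast?, ∀ y ∈ ρ'.head?, ∀ a, y.1 ∉ A.step x.1 (some a)) :
    ∃ w₁ w₂ ρ₂ q q', w = w₁ ++ w₂ ∧ ρ' = shiftRun w₁.length ρ₂ ∧ IsRun A I {q} w₁ ρ ∧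
      IsRun A {q'} F w₂ ρ₂ ∧ q' ∈ A.step q none ∧ q ≠ q' := by
  have hle : ∀ x ∈ ρ ++ ρ', x.2 ≤ w.length := fun x hx => h.pos_le hx
  obtain ⟨h₁, ⟨q₁, hq₁, h₂⟩, q₂, hq₂, h₃⟩ := h
  rw [List.isChain_append] at h₁
  obtain ⟨h₁, h₁', h₄⟩ := h₁
  obtain ⟨⟨q, k⟩, hx⟩ : ∃ x, ρ.getLast? = some x := ⟨_, List.getLast?_eq_some_getLast hne⟩
  obtain ⟨⟨q', k'⟩, hy⟩ : ∃ x, ρ'.head? = some x := ⟨_, List.head?_eq_some_head hne'⟩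
  -- The step across the cut cannot read a letter, so both sides are at the same position, and there
  -- the word is split.
  obtain ⟨a, -, h₅, -⟩ | ⟨hst, hk, hqq⟩ := h₄ _ hx _ hy
  · exact (hs _ hx _ hy a h₅).elim
  obtain rfl : k' = k := hk
  have hkw : k' ≤ w.length := hle (q, k') (List.mem_append_left _ (List.mem_of_getLast? hx))
  obtain ⟨w₁, w₂, rfl, rfl⟩ : ∃ w₁ w₂, w = w₁ ++ w₂ ∧ k' = w₁.length :=
    ⟨w.take k', w.drop k', (List.take_append_drop _ _).symm, by simp [hkw]⟩
  obtain ⟨ρ₂, rfl⟩ : ∃ ρ₂, ρ' = shiftRun w₁.length ρ₂ := by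
    refine List.exists_map_eq_of_forall fun z hz => ⟨(z.1, z.2 - w₁.length), ?_⟩
    have := reflTransGen_runStep_le (h₁'.reflTransGen_head hy hz)
    ext <;> simp only []
    omega
  refine ⟨w₁, w₂, ρ₂, q, q', rfl, rfl, ⟨?_, ⟨q₁, hq₁, ?_⟩, q, rfl, hx⟩,
    ⟨isChain_shiftRun.1 h₁', ⟨q', rfl, ?_⟩, q₂, hq₂, ?_⟩, hst, hqq⟩
  · refine List.IsChain.imp_of_mem_imp (fun x y _ hy h => h.of_append ?_) h₁
    exact reflTransGen_runStep_le (h₁.reflTransGen_getLast hx hy)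
  · rwa [List.head?_append_of_ne_nil _ hne] at h₂
  · rw [head?_shiftRun] at hy
    obtain ⟨⟨r, i⟩, hr, hr'⟩ := Option.map_eq_some_iff.1 hy
    simp only [Prod.mk.injEq, Nat.add_eq_right] at hr'
    rw [hr, hr'.1, hr'.2]
  · rw [List.getLast?_append_of_ne_nil _ hne', getLast?_shiftRun] at h₃
    obtain ⟨⟨r, i⟩, hr, hr'⟩ := Option.map_eq_some_iff.1 h₃
    simp only [Prod.mk.injEq, List.length_append] at hr'
    rw [hr, hr'.1, show i = w₂.length by omega]

/-! ### Embeddings of automata -/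

/-- `g` embeds `A` into `B` as an induced subautomaton. -/
structure IsEmb (g : σ → τ) (A : εNFA α σ) (B : εNFA α τ) : Prop where
  inj : Function.Injective g
  step : ∀ q q' x, g q' ∈ B.step (g q) x ↔ q' ∈ A.step q x

/-- The image of a run under a map of the states. -/
def mapRun (g : σ → τ) (ρ : List (σ × ℕ)) : List (τ × ℕ) := ρ.map fun x => (g x.1, x.2)

variable {g : σ → τ}

theorem IsEmb.runStep (h : IsEmb g A B) {q q' : σ} {i j : ℕ} :
    RunStep B w (g q, i) (g q', j) ↔ RunStep A w (q, i) (q', j) := by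
  simp [RunStep, h.step, h.inj.eq_iff]

theorem IsEmb.isRun (h : IsEmb g A B) {I F : Set σ} {ρ : List (σ × ℕ)} :
    IsRun B (g '' I) (g '' F) w (mapRun g ρ) ↔ IsRun A I F w ρ := by
  have : ∀ x y : σ × ℕ, RunStep B w (g x.1, x.2) (g y.1, y.2) ↔ RunStep A w x y :=
    fun x y => h.runStep
  simp only [IsRun, mapRun, List.isChain_map, this, List.head?_map, List.getLast?_map,
    Set.exists_mem_image, Option.map_eq_some_iff, Prod.mk.injEq, h.inj.eq_iff]
  simp only [Prod.exists, exists_eq_right_right]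
  simp

theorem IsEmb.isRun_iff (h : IsEmb g A B) {I F : Set σ} {ρ : List (τ × ℕ)}
    (hρ : ∀ x ∈ ρ, x.1 ∈ Set.range g) :
    IsRun B (g '' I) (g '' F) w ρ ↔ ∃ ρ', ρ = mapRun g ρ' ∧ IsRun A I F w ρ' := by
  constructor
  · intro hr
    obtain ⟨ρ', rfl⟩ : ∃ ρ', ρ = mapRun g ρ' := by
      refine List.exists_map_eq_of_forall fun x hx => ?_
      obtain ⟨q, hq⟩ := hρ x hx
      exact ⟨(q, x.2), by simp [hq]⟩
    exact ⟨ρ', rfl, h.isRun.1 hr⟩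
  · rintro ⟨ρ', rfl, hr⟩
    exact h.isRun.2 hr

/-- Confines a run to a component that cannot be left. The next lemma treats a component that cannot
be entered from outside, arguing backwards from the final state. -/
theorem IsRun.forall_mem_of_forward {I F S : Set σ} {ρ : List (σ × ℕ)} (h : IsRun A I F w ρ)
    (hI : I ⊆ S) (hS : ∀ q ∈ S, ∀ x, A.step q x ⊆ S) : ∀ x ∈ ρ, x.1 ∈ S := by
  obtain ⟨h₁, ⟨q, hq, h₂⟩, -⟩ := h
  refine h₁.forall_of_closed (p := fun x => x.1 ∈ S) ?_ h₂ (hI hq)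
  rintro x y hx (⟨a, -, h, -⟩ | ⟨h, -⟩)
  exacts [hS _ hx _ h, hS _ hx _ h]

theorem IsRun.forall_mem_of_backward {I F S : Set σ} {ρ : List (σ × ℕ)} (h : IsRun A I F w ρ)
    (hF : F ⊆ S) (hS : ∀ q x, ∀ q' ∈ A.step q x, q' ∈ S → q ∈ S) : ∀ x ∈ ρ, x.1 ∈ S := by
  rintro ⟨p, k⟩ hx
  obtain ⟨h₁, -, ⟨q, hq, h₂⟩⟩ := h
  have := reflTransGen_runStep_reach (h₁.reflTransGen_getLast h₂ hx)
  have hqS : q ∈ S := hF hq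
  clear h₂
  change Relation.ReflTransGen _ p q at this
  clear hx
  change p ∈ S
  induction this using Relation.ReflTransGen.head_induction_on with
  | refl => exact hqS
  | head h _ ih =>
    obtain ⟨y, hy⟩ := h
    exact hS _ y _ hy ih

theorem exists_isRun {I F : Set σ} {q q' : σ} (hq : q ∈ I) (hq' : q' ∈ F)
    (h : Relation.ReflTransGen (RunStep A w) (q, 0) (q', w.length)) : ∃ ρ, IsRun A I F w ρ := by
  obtain ⟨l, h₁, h₂⟩ := List.exists_isChain_cons_of_relationReflTransGen h
  exact ⟨_, h₁, ⟨q, hq, rfl⟩, q', hq', by rw [List.getLast?_eq_some_getLast (by simp), h₂]⟩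

end RunLemmas

/-! ### Subwords bounded by runs -/

section Bounds

variable {α σ τ : Type} {w u : List α} {ρ : List (σ × ℕ)} {S : Set σ} {ρ' : List (τ × ℕ)}
  {S' : Set τ} {i j : ℕ}

theorem positions_finite (ρ : List (σ × ℕ)) (S : Set σ) : (positions ρ S).Finite := by
  refine (List.finite_toSet (ρ.map Prod.snd)).subset ?_
  rintro k ⟨q, -, h⟩
  exact List.mem_map.2 ⟨_, h, rfl⟩

theorem exists_isLeast_isGreatest (h : (positions ρ S).Nonempty) :
    ∃ i j, IsLeast (positions ρ S) i ∧ IsGreatest (positions ρ S) j := by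
  have hf := positions_finite ρ S
  obtain ⟨i, hi, hi'⟩ := Set.exists_min_image _ id hf h
  obtain ⟨j, hj, hj'⟩ := Set.exists_max_image _ id hf h
  exact ⟨i, j, ⟨hi, hi'⟩, hj, hj'⟩

theorem subword_bound (hi : IsLeast (positions ρ S) i) (hj : IsGreatest (positions ρ S) j)
    (h : j ≤ w.length) : subword w (bound ρ S) = some ((w.take j).drop i) := by
  rw [bound, if_pos ⟨i, hi.1⟩, hi.csInf_eq, hj.csSup_eq]
  simp [subword, hi.2 hj.1, h]

theorem subword_bound_eq_none (h : ¬ (positions ρ S).Nonempty) :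
    subword w (bound ρ S) = none := by
  rw [bound, if_neg h]
  rfl

theorem subword_bound_congr (h : positions ρ' S' = positions ρ S) :
    subword w (bound ρ' S') = subword w (bound ρ S) := by
  rw [bound, bound, h]

theorem subword_bound_append_left (h : ∀ k ∈ positions ρ S, k ≤ w.length)
    (hp : positions ρ' S' = positions ρ S) :
    subword (w ++ u) (bound ρ' S') = subword w (bound ρ S) := by
  by_cases hne : (positions ρ S).Nonempty
  · obtain ⟨i, j, hi, hj⟩ := exists_isLeast_isGreatest hne
    have hjw := h _ hj.1
    rw [subword_bound hi hj hjw, subword_bound (hp ▸ hi) (hp ▸ hj) (by simp; omega),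
      List.take_append_of_le_length hjw]
  · rw [subword_bound_eq_none hne, subword_bound_eq_none (hp ▸ hne)]

theorem subword_bound_append_right (h : ∀ k ∈ positions ρ S, k ≤ w.length)
    (hp : positions ρ' S' = (· + u.length) '' positions ρ S) :
    subword (u ++ w) (bound ρ' S') = subword w (bound ρ S) := by
  by_cases hne : (positions ρ S).Nonempty
  · obtain ⟨i, j, hi, hj⟩ := exists_isLeast_isGreatest hne
    have hjw := h _ hj.1
    have hmono : Monotone (· + u.length) := fun a b hab => Nat.add_le_add_right hab _
    rw [subword_bound hi hj hjw, subword_bound (hp ▸ hmono.map_isLeast hi)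
      (hp ▸ hmono.map_isGreatest hj) (by simp; omega)]
    simp [List.take_append, List.drop_append, List.drop_eq_nil_of_le]
  · rw [subword_bound_eq_none hne, subword_bound_eq_none (by rw [hp]; simpa using hne)]

theorem positions_append (ρ₁ ρ₂ : List (σ × ℕ)) (S : Set σ) :
    positions (ρ₁ ++ ρ₂) S = positions ρ₁ S ∪ positions ρ₂ S := by
  ext k
  simp [positions, and_or_left, exists_or]

theorem positions_shiftRun (k : ℕ) (ρ : List (σ × ℕ)) (S : Set σ) :
    positions (shiftRun k ρ) S = (· + k) '' positions ρ S := by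
  ext j
  simp only [positions, shiftRun, List.mem_map, Set.mem_image, Set.mem_ofPred_eq, Prod.exists,
    Prod.mk.injEq]
  constructor
  · rintro ⟨q, hq, _, i, h, rfl, rfl⟩
    exact ⟨i, ⟨_, hq, h⟩, rfl⟩
  · rintro ⟨i, ⟨q, hq, h⟩, rfl⟩
    exact ⟨q, hq, q, i, h, rfl, rfl⟩

theorem positions_mapRun {g : σ → τ} (ρ : List (σ × ℕ)) (S : Set τ) :
    positions (mapRun g ρ) S = positions ρ (g ⁻¹' S) := by
  ext j
  simp only [positions, mapRun, List.mem_map, Set.mem_ofPred_eq, Prod.exists, Prod.mk.injEq]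
  constructor
  · rintro ⟨_, hq, q, i, h, rfl, rfl⟩
    exact ⟨q, hq, h⟩
  · rintro ⟨q, hq, h⟩
    exact ⟨_, hq, q, j, h, rfl, rfl⟩

theorem positions_empty (ρ : List (σ × ℕ)) : positions ρ ∅ = ∅ := by
  simp [positions]

theorem positions_mono {S T : Set σ} (h : S ⊆ T) : positions ρ S ⊆ positions ρ T :=
  fun _ ⟨q, hq, hk⟩ => ⟨q, h hq, hk⟩

theorem positions_union (S T : Set σ) :
    positions ρ (S ∪ T) = positions ρ S ∪ positions ρ T := by
  ext k
  simp [positions, or_and_right, exists_or]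

variable {A : εNFA α σ} {I F : Set σ}

theorem IsRun.positions_le (h : IsRun A I F w ρ) : ∀ k ∈ positions ρ S, k ≤ w.length := by
  rintro k ⟨q, -, hq⟩
  exact h.pos_le hq

theorem IsRun.isLeast (h : IsRun A I F w ρ) (hS : I ⊆ S) : IsLeast (positions ρ S) 0 := by
  obtain ⟨-, ⟨q, hq, h⟩, -⟩ := h
  exact ⟨⟨q, hS hq, List.mem_of_head? h⟩, fun _ _ => Nat.zero_le _⟩

theorem IsRun.isGreatest (h : IsRun A I F w ρ) (hS : F ⊆ S) :
    IsGreatest (positions ρ S) w.length := by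
  refine ⟨?_, h.positions_le⟩
  obtain ⟨-, -, q, hq, h⟩ := h
  exact ⟨q, hS hq, List.mem_of_getLast? h⟩

theorem IsRun.subword_univ (h : IsRun A I F w ρ) : subword w (bound ρ Set.univ) = some w := by
  rw [subword_bound (h.isLeast (Set.subset_univ _)) (h.isGreatest (Set.subset_univ _)) le_rfl]
  simp

end Bounds

/-! ### Deterministic automata -/

section Deterministic

variable {α σ τ : Type} {M : DFA α σ} {w : List α}

/-- The loops of a deterministic automaton are no moves of a run, since a λ-move has to change the
state; only the letter moves remain. -/
theorem runStep_toLoopNFA {x y : σ × ℕ} :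
    RunStep M.toLoopNFA w x y ↔ ∃ a, w[x.2]? = some a ∧ y = (M.step x.1 a, x.2 + 1) := by
  simp only [RunStep, DFA.toLoopNFA, Set.mem_singleton_iff, Prod.ext_iff]
  constructor
  · rintro (⟨a, h⟩ | ⟨h, -, h'⟩)
    · exact ⟨a, h⟩
    · exact (h' h.symm).elim
  · exact .inl

theorem toLoopNFA_unique {ρ ρ' : List (σ × ℕ)} (h : IsAcceptingRun M.toLoopNFA w ρ)
    (h' : IsAcceptingRun M.toLoopNFA w ρ') : ρ = ρ' := by
  obtain ⟨h₁, ⟨_, rfl, h₂⟩, q₁, -, h₃⟩ := h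
  obtain ⟨h₁', ⟨_, rfl, h₂'⟩, q₁', -, h₃'⟩ := h'
  -- Both runs end at position `|w|`, where no letter is left and hence no move is possible.
  refine h₁.eq_of_deterministic (f := fun x => x.2 = w.length) ?_ ?_ h₁' h₂ h₂' ?_ ?_
  · simp only [runStep_toLoopNFA]
    rintro x y z ⟨a, ha, rfl⟩ ⟨b, hb, rfl⟩
    obtain rfl : a = b := by simpa [ha] using hb
    rfl
  · simp only [runStep_toLoopNFA]
    rintro x y hx ⟨a, ha, -⟩
    simp [hx] at ha
  · rw [h₃]
    rintro _ ⟨⟩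
    rfl
  · rw [h₃']
    rintro _ ⟨⟩
    rfl

theorem evalFrom_take_succ (M : DFA α σ) (q : σ) {w : List α} {k : ℕ} {a : α}
    (h : w[k]? = some a) : M.evalFrom q (w.take (k + 1)) = M.step (M.evalFrom q (w.take k)) a := by
  rw [List.take_add_one, h, DFA.evalFrom_of_append]
  rfl

theorem exists_toLoopNFA_iff : (∃ ρ, IsAcceptingRun M.toLoopNFA w ρ) ↔ w ∈ M.accepts := by
  constructor
  · rintro ⟨ρ, h₁, ⟨_, rfl, h₂⟩, q, hq, h₃⟩
    have := h₁.forall_of_closed (p := fun x => x.1 = M.evalFrom M.start (w.take x.2)) ?_ h₂ rfl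
      _ (List.mem_of_getLast? h₃)
    · rw [DFA.mem_accepts, DFA.eval]
      rw [List.take_length] at this
      exact this ▸ hq
    · simp only [runStep_toLoopNFA]
      rintro x y hx ⟨a, ha, rfl⟩
      simp only [evalFrom_take_succ M _ ha, hx]
  · intro h
    refine exists_isRun (q := M.start) (q' := M.eval w) rfl h ?_
    have : ∀ k ≤ w.length, Relation.ReflTransGen (RunStep M.toLoopNFA w) (M.start, 0)
        (M.evalFrom M.start (w.take k), k) := by
      intro k
      induction k with
      | zero => exact fun _ => .refl
      | succ k ih =>
        intro hk
        refine (ih (by omega)).tail (runStep_toLoopNFA.2 ⟨w[k], by simp, ?_⟩)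
        rw [evalFrom_take_succ M _ (a := w[k]) (by simp)]
    have hw := this _ le_rfl
    rwa [List.take_length] at hw

/-! ### Tracking a deterministic automaton along a run -/

/-- The automaton `A` together with the state that `D` reaches on the letters read so far. -/
def εNFA.track (A : εNFA α σ) (D : DFA (Boxed α) τ) : εNFA α (σ × τ) where
  step q x := match x with
    | none => A.step q.1 none ×ˢ {q.2}
    | some a => A.step q.1 (some a) ×ˢ {D.step q.2 (some a)}
  start := A.start ×ˢ {D.start}
  accept := A.accept ×ˢ Set.univ

/-- The states of `D` from `r` along a run on `w`. -/
def trackRun (D : DFA (Boxed α) τ) (r : τ) (w : List α) (ρ : List (σ × ℕ)) :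
    List ((σ × τ) × ℕ) :=
  ρ.map fun x => ((x.1, D.evalFrom r ((w.take x.2).map some)), x.2)

variable {A : εNFA α σ} {D : DFA (Boxed α) τ} {r : τ}

theorem track_runStep_iff {x y : σ × ℕ} {t : τ} :
    RunStep (A.track D) w ((x.1, D.evalFrom r ((w.take x.2).map some)), x.2) ((y.1, t), y.2) ↔
      RunStep A w x y ∧ t = D.evalFrom r ((w.take y.2).map some) := by
  have key : ∀ a, w[x.2]? = some a → D.evalFrom r ((w.take (x.2 + 1)).map some) =
      D.step (D.evalFrom r ((w.take x.2).map some)) (some a) := by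
    intro a ha
    rw [List.take_add_one, ha, List.map_append, DFA.evalFrom_of_append]
    rfl
  simp only [RunStep, εNFA.track, Set.mem_prod, Set.mem_singleton_iff]
  constructor
  · rintro (⟨a, ha, ⟨h, rfl⟩, h'⟩ | ⟨⟨h, rfl⟩, h', hne⟩)
    · exact ⟨.inl ⟨a, ha, h, h'⟩, by rw [h', key a ha]⟩
    · refine ⟨.inr ⟨h, h', ?_⟩, by rw [h']⟩
      rintro he
      exact hne (by rw [he])
  · rintro ⟨⟨a, ha, h, h'⟩ | ⟨h, h', hne⟩, rfl⟩
    · exact .inl ⟨a, ha, ⟨h, by rw [h', key a ha]⟩, h'⟩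
    · exact .inr ⟨⟨h, by rw [h']⟩, h', fun he => hne (Prod.ext_iff.1 he).1⟩

/-- Along a run that starts with `r`, the second component is a function of the position. Tracking
therefore leaves the runs of `A` as they are and only tests the final value against `T`. -/
theorem track_isRun_iff {I F : Set σ} {ρ : List ((σ × τ) × ℕ)} {T : Set τ} :
    IsRun (A.track D) (I ×ˢ {r}) (F ×ˢ T) w ρ ↔
      ∃ ρ', ρ = trackRun D r w ρ' ∧ IsRun A I F w ρ' ∧ D.evalFrom r (w.map some) ∈ T := by
  have hstep : ∀ x y : σ × ℕ, RunStep (A.track D) w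
      ((x.1, D.evalFrom r ((w.take x.2).map some)), x.2)
      ((y.1, D.evalFrom r ((w.take y.2).map some)), y.2) ↔ RunStep A w x y :=
    fun x y => track_runStep_iff.trans (and_iff_left rfl)
  constructor
  · rintro ⟨h₁, ⟨⟨q, t₀⟩, ⟨hq, ht₀⟩, h₂⟩, ⟨q', t⟩, ⟨hq', ht⟩, h₃⟩
    obtain rfl : r = t₀ := Eq.symm ht₀
    have key := h₁.forall_of_closed
      (p := fun x => x.1.2 = D.evalFrom r ((w.take x.2).map some)) ?_ h₂ rfl
    · obtain ⟨ρ', rfl⟩ : ∃ ρ', ρ = trackRun D r w ρ' := by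
        refine List.exists_map_eq_of_forall fun x hx => ⟨(x.1.1, x.2), ?_⟩
        simp only [← key x hx]
      refine ⟨ρ', rfl, ⟨?_, ⟨q, hq, ?_⟩, q', hq', ?_⟩, ?_⟩
      · rw [trackRun, List.isChain_map] at h₁
        exact h₁.imp fun x y h => (hstep x y).1 h
      · simp only [trackRun, List.head?_map, Option.map_eq_some_iff] at h₂
        obtain ⟨⟨p, k⟩, h, h'⟩ := h₂
        simp only [Prod.mk.injEq] at h'
        rw [h, h'.1.1, h'.2]
      · simp only [trackRun, List.getLast?_map, Option.map_eq_some_iff] at h₃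
        obtain ⟨⟨p, k⟩, h, h'⟩ := h₃
        simp only [Prod.mk.injEq] at h'
        rw [h, h'.1.1, h'.2]
      · have := key _ (List.mem_of_getLast? h₃)
        simp only [List.take_length] at this
        exact this ▸ ht
    · rintro ⟨⟨q, t⟩, i⟩ ⟨⟨q', t'⟩, j⟩ (ht : t = D.evalFrom r ((w.take i).map some)) h
      subst ht
      exact ((track_runStep_iff (x := (q, i)) (y := (q', j))).1 h).2
  · rintro ⟨ρ', rfl, ⟨h₁, ⟨q, hq, h₂⟩, q', hq', h₃⟩, ht⟩
    refine ⟨?_, ⟨(q, r), ⟨hq, rfl⟩, ?_⟩, (q', _), ⟨hq', ht⟩, ?_⟩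
    · rw [trackRun, List.isChain_map]
      exact h₁.imp fun x y h => (hstep x y).2 h
    · simp [trackRun, h₂]
    · simp only [trackRun, List.getLast?_map, h₃, Option.map_some, List.take_length]
      rfl

theorem positions_trackRun (ρ : List (σ × ℕ)) (S : Set σ) :
    positions (trackRun D r w ρ) (S ×ˢ Set.univ) = positions ρ S := by
  ext j
  simp only [positions, trackRun, List.mem_map, Set.mem_ofPred_eq, Prod.exists, Prod.mk.injEq,
    Set.mem_prod, Set.mem_univ, and_true]
  constructor
  · rintro ⟨q, t, hq, q', i, h, ⟨rfl, -⟩, rfl⟩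
    exact ⟨q', hq, h⟩
  · rintro ⟨q, hq, h⟩
    exact ⟨q, _, hq, q, j, h, ⟨rfl, rfl⟩, rfl⟩

end Deterministic

/-! ### Unions and concatenations of automata -/

section Constructions

variable {α σ τ : Type} {A : εNFA α σ} {B : εNFA α τ} {w : List α}

theorem isEmb_disjUnion_inl : IsEmb Sum.inl A (A.disjUnion B) :=
  ⟨Sum.inl_injective, fun q q' x => by simp [εNFA.disjUnion]⟩

theorem isEmb_disjUnion_inr : IsEmb Sum.inr B (A.disjUnion B) :=
  ⟨Sum.inr_injective, fun q q' x => by simp [εNFA.disjUnion]⟩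

/-- Final states of the other summand may be present but are never reached. With `F'` empty this
describes the runs of a node, with `F'` arbitrary one half of `isRun_disjUnion`. -/
theorem isRun_disjUnion_inl {I F : Set σ} {F' : Set τ} {ρ : List ((σ ⊕ τ) × ℕ)} :
    IsRun (A.disjUnion B) (Sum.inl '' I) (Sum.inl '' F ∪ Sum.inr '' F') w ρ ↔
      ∃ ρ', ρ = mapRun Sum.inl ρ' ∧ IsRun A I F w ρ' := by
  constructor
  · intro h
    have hρ := h.forall_mem_of_forward (S := Set.range Sum.inl) (Set.image_subset_range _ _)
      (by rintro _ ⟨q, rfl⟩ x _ ⟨q', -, rfl⟩; exact ⟨q', rfl⟩)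
    refine (isEmb_disjUnion_inl.isRun_iff hρ).1 ⟨h.1, h.2.1, ?_⟩
    obtain ⟨-, -, q, hq | ⟨q', -, rfl⟩, h⟩ := h
    · exact ⟨q, hq, h⟩
    · obtain ⟨_, ⟨⟩⟩ := hρ _ (List.mem_of_getLast? h)
  · rintro ⟨ρ', rfl, h⟩
    exact (isEmb_disjUnion_inl.isRun.2 h).mono le_rfl Set.subset_union_left

theorem isRun_disjUnion_inr {I F : Set τ} {F' : Set σ} {ρ : List ((σ ⊕ τ) × ℕ)} :
    IsRun (A.disjUnion B) (Sum.inr '' I) (Sum.inl '' F' ∪ Sum.inr '' F) w ρ ↔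
      ∃ ρ', ρ = mapRun Sum.inr ρ' ∧ IsRun B I F w ρ' := by
  constructor
  · intro h
    have hρ := h.forall_mem_of_forward (S := Set.range Sum.inr) (Set.image_subset_range _ _)
      (by rintro _ ⟨q, rfl⟩ x _ ⟨q', -, rfl⟩; exact ⟨q', rfl⟩)
    refine (isEmb_disjUnion_inr.isRun_iff hρ).1 ⟨h.1, h.2.1, ?_⟩
    obtain ⟨-, -, q, ⟨q', -, rfl⟩ | hq, h⟩ := h
    · obtain ⟨_, ⟨⟩⟩ := hρ _ (List.mem_of_getLast? h)
    · exact ⟨q, hq, h⟩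
  · rintro ⟨ρ', rfl, h⟩
    exact (isEmb_disjUnion_inr.isRun.2 h).mono le_rfl Set.subset_union_right

theorem isRun_disjUnion {I F : Set σ} {I' F' : Set τ} {ρ : List ((σ ⊕ τ) × ℕ)} :
    IsRun (A.disjUnion B) (Sum.inl '' I ∪ Sum.inr '' I') (Sum.inl '' F ∪ Sum.inr '' F') w ρ ↔
      (∃ ρ', ρ = mapRun Sum.inl ρ' ∧ IsRun A I F w ρ') ∨
      (∃ ρ', ρ = mapRun Sum.inr ρ' ∧ IsRun B I' F' w ρ') := by
  rw [← isRun_disjUnion_inl (F' := F'), ← isRun_disjUnion_inr (F' := F)]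
  constructor
  · rintro ⟨h₁, ⟨q, hq | hq, h₂⟩, h₃⟩
    exacts [.inl ⟨h₁, ⟨q, hq, h₂⟩, h₃⟩, .inr ⟨h₁, ⟨q, hq, h₂⟩, h₃⟩]
  · rintro (h | h)
    exacts [h.mono Set.subset_union_left le_rfl, h.mono Set.subset_union_right le_rfl]

theorem isEmb_concat_inl : IsEmb Sum.inl A (A.concat B) :=
  ⟨Sum.inl_injective, fun q q' x => by simp [εNFA.concat]⟩

theorem isEmb_concat_inr : IsEmb Sum.inr B (A.concat B) :=
  ⟨Sum.inr_injective, fun q q' x => by simp [εNFA.concat]⟩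

/-- No transition leads back from `B`, so a run that ends in a state of `A` has never left `A`. -/
theorem isRun_concat_inl {I F : Set σ} {ρ : List ((σ ⊕ τ) × ℕ)} :
    IsRun (A.concat B) (Sum.inl '' I) (Sum.inl '' F) w ρ ↔
      ∃ ρ', ρ = mapRun Sum.inl ρ' ∧ IsRun A I F w ρ' := by
  refine ⟨fun h => (isEmb_concat_inl.isRun_iff ?_).1 h,
    fun ⟨ρ', hρ, h⟩ => hρ ▸ isEmb_concat_inl.isRun.2 h⟩
  refine h.forall_mem_of_backward (Set.image_subset_range _ _) ?_
  rintro (q | q) x _ hq ⟨q', rfl⟩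
  · exact ⟨q, rfl⟩
  · simp [εNFA.concat] at hq

theorem isRun_concat_inr {I F : Set τ} {ρ : List ((σ ⊕ τ) × ℕ)} :
    IsRun (A.concat B) (Sum.inr '' I) (Sum.inr '' F) w ρ ↔
      ∃ ρ', ρ = mapRun Sum.inr ρ' ∧ IsRun B I F w ρ' := by
  refine ⟨fun h => (isEmb_concat_inr.isRun_iff ?_).1 h,
    fun ⟨ρ', hρ, h⟩ => hρ ▸ isEmb_concat_inr.isRun.2 h⟩
  refine h.forall_mem_of_forward (Set.image_subset_range _ _) ?_
  rintro _ ⟨q, rfl⟩ x _ ⟨q', -, rfl⟩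
  exact ⟨q', rfl⟩

/-- The run that goes through `ρ₁` and then, from position `k` on, through `ρ₂`. -/
def concatRun (k : ℕ) (ρ₁ : List (σ × ℕ)) (ρ₂ : List (τ × ℕ)) : List ((σ ⊕ τ) × ℕ) :=
  mapRun Sum.inl ρ₁ ++ shiftRun k (mapRun Sum.inr ρ₂)

/-- The states of `B` cannot be left, so a run is a block in `A` followed by a block in `B`. The
only connections are λ-moves from final to initial states; there the run and the word are cut by
`IsRun.cut`. -/
theorem isAcceptingRun_concat {ρ : List ((σ ⊕ τ) × ℕ)} :
    IsAcceptingRun (A.concat B) w ρ ↔ ∃ w₁ w₂ ρ₁ ρ₂, w = w₁ ++ w₂ ∧ IsAcceptingRun A w₁ ρ₁ ∧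
      IsAcceptingRun B w₂ ρ₂ ∧ ρ = concatRun w₁.length ρ₁ ρ₂ := by
  constructor
  · intro h
    obtain ⟨ρ₁, ρ₂, rfl, h₁, h₂⟩ := h.1.exists_append_of_closed
      (p := fun x => x.1 ∈ Set.range (Sum.inr : τ → σ ⊕ τ)) (by
        rintro x y ⟨q, hq⟩ (⟨a, -, h, -⟩ | ⟨h, -⟩) <;>
        · rw [← hq] at h
          obtain ⟨q', -, h⟩ := h
          exact ⟨q', h⟩)
    have h₁' : ∀ x ∈ ρ₁, x.1 ∈ Set.range (Sum.inl : σ → σ ⊕ τ) := by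
      rintro ⟨q | q, k⟩ hx
      · exact ⟨q, rfl⟩
      · exact (h₁ _ hx ⟨q, rfl⟩).elim
    have hne₁ : ρ₁ ≠ [] := by
      rintro rfl
      obtain ⟨-, ⟨_, ⟨q, -, rfl⟩, h⟩, -⟩ := h
      obtain ⟨_, ⟨⟩⟩ := h₂ _ (List.mem_of_head? h)
    have hne₂ : ρ₂ ≠ [] := by
      rintro rfl
      obtain ⟨-, -, _, ⟨q, -, rfl⟩, h⟩ := h
      rw [List.append_nil] at h
      obtain ⟨_, ⟨⟩⟩ := h₁' _ (List.mem_of_getLast? h)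
    obtain ⟨w₁, w₂, ρ₂, q, q', rfl, rfl, hr₁, hr₂, hs, -⟩ := IsRun.cut h hne₁ hne₂ (by
      intro x hx y hy a hxy
      obtain ⟨q, hq⟩ := h₁' x (List.mem_of_getLast? hx)
      obtain ⟨q', hq'⟩ := h₂ y (List.mem_of_head? hy)
      rw [← hq, ← hq'] at hxy
      simp [εNFA.concat] at hxy)
    obtain ⟨p, rfl⟩ : ∃ p, Sum.inl p = q := by
      obtain ⟨-, -, _, rfl, h⟩ := hr₁
      exact h₁' _ (List.mem_of_getLast? h)
    obtain ⟨p', rfl⟩ : ∃ p, Sum.inr p = q' := by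
      obtain ⟨-, ⟨_, rfl, h⟩, -⟩ := hr₂
      exact h₂ _ (List.mem_of_head? (by rw [head?_shiftRun, h]; rfl))
    obtain ⟨hp, hp'⟩ : p ∈ A.accept ∧ p' ∈ B.start := by simpa [εNFA.concat] using hs
    rw [← Set.image_singleton] at hr₁ hr₂
    obtain ⟨π₁, rfl, hπ₁⟩ := isRun_concat_inl.1 hr₁
    obtain ⟨π₂, rfl, hπ₂⟩ := isRun_concat_inr.1 hr₂
    exact ⟨w₁, w₂, π₁, π₂, rfl, hπ₁.mono le_rfl (by simpa using hp),
      hπ₂.mono (by simpa using hp') le_rfl, rfl⟩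
  · rintro ⟨w₁, w₂, ρ₁, ρ₂, rfl, h₁, h₂, rfl⟩
    refine (isRun_concat_inl.2 ⟨ρ₁, rfl, h₁⟩).glue (isRun_concat_inr.2 ⟨ρ₂, rfl, h₂⟩) ?_
    rintro _ ⟨q, hq, rfl⟩ _ ⟨q', hq', rfl⟩
    simp [εNFA.concat, hq, hq']

theorem positions_concatRun_inl (k : ℕ) (ρ₁ : List (σ × ℕ)) (ρ₂ : List (τ × ℕ)) (S : Set σ) :
    positions (concatRun k ρ₁ ρ₂) (Sum.inl '' S) = positions ρ₁ S := by
  rw [concatRun, positions_append, positions_shiftRun, positions_mapRun, positions_mapRun,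
    Set.preimage_image_eq _ Sum.inl_injective, Set.preimage_inr_image_inl, positions_empty]
  simp

theorem positions_concatRun_inr (k : ℕ) (ρ₁ : List (σ × ℕ)) (ρ₂ : List (τ × ℕ)) (S : Set τ) :
    positions (concatRun k ρ₁ ρ₂) (Sum.inr '' S) = (· + k) '' positions ρ₂ S := by
  rw [concatRun, positions_append, positions_shiftRun, positions_mapRun, positions_mapRun,
    Set.preimage_image_eq _ Sum.inr_injective, Set.preimage_inl_image_inr, positions_empty]
  simp

end Constructions

/-! ### The automaton for `P₁* · P₂` -/

section StarAutomaton

open Hyperautomaton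

variable {α σ τ ν : Type} {AT : DFA α σ} {AI : DFA (Boxed α) τ} {A₂ : εNFA α ν} {w : List α}

/-- The embedding of the states of the first automaton. -/
def starLeft (x : σ × τ) : (σ ⊕ (BoxState ⊕ ν)) × τ := (Sum.inl x.1, x.2)

/-- The embedding of the states of the last automaton. -/
def starRight (x : ν × τ) : (σ ⊕ (BoxState ⊕ ν)) × τ := (Sum.inr (Sum.inr x.1), x.2)

/-- The embedding of the states of the automaton for `□`. -/
def starBox (b : BoxState) (r : τ) : (σ ⊕ (BoxState ⊕ ν)) × τ := (Sum.inr (Sum.inl b), r)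

theorem starLeft_injective :
    Function.Injective (starLeft : σ × τ → (σ ⊕ (BoxState ⊕ ν)) × τ) := by
  rintro ⟨a, b⟩ ⟨c, d⟩ h
  simpa [starLeft] using h

theorem starRight_injective :
    Function.Injective (starRight : ν × τ → (σ ⊕ (BoxState ⊕ ν)) × τ) := by
  rintro ⟨a, b⟩ ⟨c, d⟩ h
  simpa [starRight] using h

/-- A lifted automaton has no `□`-transitions, and the λ-transitions of `AI` are loops. Hence inside
the first component, and likewise inside the last one, the product merely tracks `AI` along the
letters. -/
theorem isEmb_starLeft : IsEmb starLeft (AT.toLoopNFA.track AI) (starAut AT AI A₂) := by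
  refine ⟨starLeft_injective, ?_⟩
  rintro ⟨q, r⟩ ⟨q', r'⟩ (_ | a) <;>
    simp [starLeft, starAut, εNFA.track, εNFA.projBox, εNFA.product, εNFA.concat, εNFA.liftBox,
      DFA.toLoopNFA]

theorem isEmb_starRight : IsEmb starRight (A₂.track AI) (starAut AT AI A₂) := by
  refine ⟨starRight_injective, ?_⟩
  rintro ⟨q, r⟩ ⟨q', r'⟩ (_ | a) <;>
    simp [starRight, starAut, εNFA.track, εNFA.projBox, εNFA.product, εNFA.concat, εNFA.liftBox,
      DFA.toLoopNFA]

theorem starAut_step_right {q : ν} {r : τ} {x : Option α} {y : (σ ⊕ (BoxState ⊕ ν)) × τ}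
    (h : y ∈ (starAut AT AI A₂).step (starRight (q, r)) x) : y ∈ Set.range starRight := by
  obtain ⟨y, r'⟩ := y
  rcases x with _ | a
  · simp only [starRight, starAut, εNFA.projBox, εNFA.product, εNFA.concat, εNFA.liftBox,
      Set.mem_union, Set.mem_prod] at h
    rcases h with ⟨⟨_, ⟨q', -, rfl⟩, rfl⟩, -⟩ | ⟨⟨_, ⟨q', -, rfl⟩, rfl⟩, -⟩ <;>
    exact ⟨(q', r'), rfl⟩
  · simp only [starRight, starAut, εNFA.projBox, εNFA.product, εNFA.concat, εNFA.liftBox,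
      Set.mem_prod] at h
    obtain ⟨⟨_, ⟨q', -, rfl⟩, rfl⟩, -⟩ := h
    exact ⟨(q', r'), rfl⟩

theorem starAut_step_inr {q : BoxState ⊕ ν} {r : τ} {x : Option α}
    {y : (σ ⊕ (BoxState ⊕ ν)) × τ} (h : y ∈ (starAut AT AI A₂).step (Sum.inr q, r) x) :
    ∃ q' r', y = (Sum.inr q', r') := by
  obtain ⟨y, r'⟩ := y
  rcases x with _ | a
  · simp only [starAut, εNFA.projBox, εNFA.product, εNFA.concat, Set.mem_union,
      Set.mem_prod] at h
    rcases h with ⟨⟨q', -, rfl⟩, -⟩ | ⟨⟨q', -, rfl⟩, -⟩ <;> exact ⟨q', r', rfl⟩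
  · simp only [starAut, εNFA.projBox, εNFA.product, εNFA.concat, Set.mem_prod] at h
    obtain ⟨⟨q', -, rfl⟩, -⟩ := h
    exact ⟨q', r', rfl⟩

theorem starAut_step_left {q : σ} {q' : BoxState ⊕ ν} {r r' : τ} {x : Option α} :
    (Sum.inr q', r') ∈ (starAut AT AI A₂).step (Sum.inl q, r) x ↔
      x = none ∧ q ∈ AT.accept ∧ q' = Sum.inl BoxState.before ∧ r' = r := by
  rcases x with _ | a <;>
    simp [starAut, εNFA.projBox, εNFA.product, εNFA.concat, εNFA.liftBox, DFA.toLoopNFA, boxDFA,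
      and_assoc]

/-- The move from `before` to `after` is the projected `□`-transition; it is the one place where
`AI` reads `□`. -/
theorem starAut_step_before {r : τ} {x : Option α} {y : (σ ⊕ (BoxState ⊕ ν)) × τ}
    (h : y ∈ (starAut AT AI A₂).step (starBox .before r) x) :
    (∃ r', y = starBox .sink r') ∨
      x = none ∧ (y = starBox .before r ∨ y = starBox .after (AI.step r none)) := by
  obtain ⟨y, r'⟩ := y
  rcases x with _ | a <;>
    simp [starBox, starAut, εNFA.projBox, εNFA.product, εNFA.concat, εNFA.liftBox,
      DFA.toLoopNFA, boxDFA] at h ⊢ <;> tauto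

theorem starAut_step_after {r : τ} {x : Option α} {y : (σ ⊕ (BoxState ⊕ ν)) × τ}
    (h : y ∈ (starAut AT AI A₂).step (starBox .after r) x) :
    (∃ r', y = starBox .sink r') ∨
      x = none ∧ (y = starBox .after r ∨ ∃ q ∈ A₂.start, y = starRight (q, r)) := by
  obtain ⟨y, r'⟩ := y
  rcases x with _ | a <;>
    simp [starBox, starRight, starAut, εNFA.projBox, εNFA.product, εNFA.concat, εNFA.liftBox,
      DFA.toLoopNFA, boxDFA] at h ⊢ <;> aesop

theorem starAut_step_sink {r : τ} {x : Option α} {y : (σ ⊕ (BoxState ⊕ ν)) × τ}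
    (h : y ∈ (starAut AT AI A₂).step (starBox .sink r) x) : ∃ r', y = starBox .sink r' := by
  obtain ⟨y, r'⟩ := y
  rcases x with _ | a <;>
    simp [starBox, starAut, εNFA.projBox, εNFA.product, εNFA.concat, εNFA.liftBox,
      DFA.toLoopNFA, boxDFA] at h ⊢ <;> tauto

theorem starAut_before_after (r : τ) : starBox .after (AI.step r none) ∈
    (starAut AT AI A₂).step (starBox .before r) none := by
  simp [starBox, starAut, εNFA.projBox, εNFA.product, εNFA.concat, εNFA.liftBox,
      DFA.toLoopNFA, boxDFA]

theorem starAut_after_right {r : τ} {q : ν} (h : q ∈ A₂.start) : starRight (q, r) ∈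
    (starAut AT AI A₂).step (starBox .after r) none := by
  simp [starBox, starRight, starAut, εNFA.projBox, εNFA.product, εNFA.concat, εNFA.liftBox,
      DFA.toLoopNFA, boxDFA, h]

theorem starAut_start : (starAut AT AI A₂).start =
    starLeft '' (AT.toLoopNFA.start ×ˢ {AI.start}) := by
  ext ⟨y, r⟩
  simp [starLeft, starAut, εNFA.projBox, εNFA.product, εNFA.concat, εNFA.liftBox, DFA.toLoopNFA]

theorem starAut_accept : (starAut AT AI A₂).accept = starRight '' (A₂.accept ×ˢ AI.accept) := by
  ext ⟨y, r⟩
  simp [starRight, starAut, εNFA.projBox, εNFA.product, εNFA.concat, εNFA.liftBox, DFA.toLoopNFA]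
  aesop

theorem isRun_starAut_left {I F : Set (σ × τ)} {ρ : List (((σ ⊕ (BoxState ⊕ ν)) × τ) × ℕ)} :
    IsRun (starAut AT AI A₂) (starLeft '' I) (starLeft '' F) w ρ ↔
      ∃ ρ', ρ = mapRun starLeft ρ' ∧ IsRun (AT.toLoopNFA.track AI) I F w ρ' := by
  refine ⟨fun h => (isEmb_starLeft.isRun_iff ?_).1 h,
    fun ⟨ρ', hρ, h⟩ => hρ ▸ isEmb_starLeft.isRun.2 h⟩
  refine h.forall_mem_of_backward (Set.image_subset_range _ _) ?_
  rintro ⟨q | q, r⟩ x _ hq ⟨q', rfl⟩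
  · exact ⟨(q, r), rfl⟩
  · obtain ⟨_, _, h⟩ := starAut_step_inr hq
    simp [starLeft] at h

theorem isRun_starAut_right {I F : Set (ν × τ)} {ρ : List (((σ ⊕ (BoxState ⊕ ν)) × τ) × ℕ)} :
    IsRun (starAut AT AI A₂) (starRight '' I) (starRight '' F) w ρ ↔
      ∃ ρ', ρ = mapRun starRight ρ' ∧ IsRun (A₂.track AI) I F w ρ' := by
  refine ⟨fun h => (isEmb_starRight.isRun_iff ?_).1 h,
    fun ⟨ρ', hρ, h⟩ => hρ ▸ isEmb_starRight.isRun.2 h⟩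
  refine h.forall_mem_of_forward (Set.image_subset_range _ _) ?_
  rintro _ ⟨⟨q, r⟩, rfl⟩ x _ h
  exact starAut_step_right h

/-- The passage through `A_□` is forced. The sink is excluded because no final state can be reached
from it, and the loops are no moves; so the run visits `before`, then `after`, and enters the last
component without reading a letter. -/
theorem isRun_starAut_box {r : τ} {ρ : List (((σ ⊕ (BoxState ⊕ ν)) × τ) × ℕ)} :
    IsRun (starAut AT AI A₂) {starBox .before r} (starAut AT AI A₂).accept w ρ ↔
      ∃ ρ', ρ = (starBox .before r, 0) :: (starBox .after (AI.step r none), 0) :: ρ' ∧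
        IsRun (starAut AT AI A₂) (starRight '' (A₂.start ×ˢ {AI.step r none}))
          (starAut AT AI A₂).accept w ρ' := by
  constructor
  · intro h
    -- Every successor of a sink state is a sink state, so, going back from the final state, the run
    -- never meets one.
    have hns : ∀ x ∈ ρ, x.1 ∈ {y | ∀ r', y ≠ starBox .sink r'} := by
      refine h.forall_mem_of_backward ?_ ?_
      · rw [starAut_accept]
        rintro _ ⟨q, -, rfl⟩ r'
        simp [starRight, starBox]
      · rintro q x q' hq hq' r' rfl
        obtain ⟨r'', h⟩ := starAut_step_sink hq
        exact hq' _ h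
    obtain ⟨h₁, ⟨_, rfl, h₂⟩, q, hq, h₃⟩ := h
    obtain ⟨ρ, rfl⟩ : ∃ ρ', ρ = (starBox .before r, 0) :: ρ' := by
      cases ρ with
      | nil => cases h₂
      | cons x ρ => exact ⟨ρ, by simpa using h₂⟩
    rw [starAut_accept] at hq
    obtain ⟨⟨q, r₀⟩, hq, rfl⟩ := hq
    rcases ρ with _ | ⟨⟨y, i⟩, ρ⟩
    · simp [starBox, starRight] at h₃
    rw [List.isChain_cons_cons] at h₁
    obtain ⟨rfl, rfl⟩ : y = starBox .after (AI.step r none) ∧ i = 0 := by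
      have hy := hns (y, i) (by simp)
      obtain ⟨a, -, h, -⟩ | ⟨h, h', hne⟩ := h₁.1
      · obtain ⟨r', h⟩ | ⟨⟨⟩, -⟩ := starAut_step_before h
        exact (hy r' h).elim
      · obtain ⟨r', h⟩ | ⟨-, h | h⟩ := starAut_step_before h
        · exact (hy r' h).elim
        · exact (hne h.symm).elim
        · exact ⟨h, h'⟩
    rcases ρ with _ | ⟨⟨z, i⟩, ρ⟩
    · simp [starBox, starRight] at h₃
    rw [List.isChain_cons_cons] at h₁
    refine ⟨_, rfl, h₁.2.2, ?_, starRight (q, r₀), by rw [starAut_accept]; exact ⟨_, hq, rfl⟩,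
      by simpa using h₃⟩
    have hz := hns (z, i) (by simp)
    obtain ⟨a, -, h, -⟩ | ⟨h, h', hne⟩ := h₁.2.1
    · obtain ⟨r', h⟩ | ⟨⟨⟩, -⟩ := starAut_step_after h
      exact (hz r' h).elim
    · obtain ⟨r', h⟩ | ⟨-, h | ⟨q', hq', h⟩⟩ := starAut_step_after h
      · exact (hz r' h).elim
      · exact (hne h.symm).elim
      · exact ⟨z, ⟨(q', _), ⟨hq', rfl⟩, h.symm⟩, by rw [show i = 0 from h']; rfl⟩
  · rintro ⟨ρ', rfl, h₁, ⟨_, ⟨⟨q, _⟩, ⟨hq, rfl⟩, rfl⟩, h₂⟩, q', hq', h₃⟩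
    refine ⟨?_, ⟨_, rfl, rfl⟩, q', hq', ?_⟩
    · cases ρ' with
      | nil => cases h₂
      | cons x ρ' =>
        obtain rfl : x = _ := by simpa using h₂
        refine List.isChain_cons_cons.2 ⟨.inr ⟨starAut_before_after r, rfl, ?_⟩,
          List.isChain_cons_cons.2 ⟨.inr ⟨starAut_after_right hq, rfl, ?_⟩, h₁⟩⟩
        · simp [starBox]
        · simp [starBox, starRight]
    · cases ρ' with
      | nil => cases h₂
      | cons x ρ' => simpa using h₃

/-- The run of `starAut AT AI A₂` on `p ++ s` that goes through `ρ₁` and `ρ₂`. -/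
def starRun (AI : DFA (Boxed α) τ) (p s : List α) (ρ₁ : List (σ × ℕ)) (ρ₂ : List (ν × ℕ)) :
    List (((σ ⊕ (BoxState ⊕ ν)) × τ) × ℕ) :=
  let r := AI.evalFrom AI.start (p.map some)
  mapRun starLeft (trackRun AI AI.start p ρ₁) ++ shiftRun p.length
    ((starBox .before r, 0) :: (starBox .after (AI.step r none), 0) ::
      mapRun starRight (trackRun AI (AI.step r none) s ρ₂))

theorem boxWord_mem_accepts {p s : List α} : boxWord p s ∈ AI.accepts ↔
    AI.evalFrom (AI.step (AI.evalFrom AI.start (p.map some)) none) (s.map some) ∈ AI.accept := by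
  rw [boxWord, DFA.mem_accepts, DFA.eval, DFA.evalFrom_of_append]
  rfl

/-- The run leaves the first component once, by a λ-move into `before`, which cuts the word into `p`
and `s`. The two outer parts are tracked runs; chaining the values of `AI` through `p`, `□` and `s`
turns the final condition into acceptance of `p □ s`. -/
theorem isAcceptingRun_starAut {ρ : List (((σ ⊕ (BoxState ⊕ ν)) × τ) × ℕ)} :
    IsAcceptingRun (starAut AT AI A₂) w ρ ↔ ∃ p s ρ₁ ρ₂, w = p ++ s ∧
      IsAcceptingRun AT.toLoopNFA p ρ₁ ∧ IsAcceptingRun A₂ s ρ₂ ∧ boxWord p s ∈ AI.accepts ∧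
      ρ = starRun AI p s ρ₁ ρ₂ := by
  constructor
  · intro h
    obtain ⟨ρ₁, ρ₂, rfl, h₁, h₂⟩ := h.1.exists_append_of_closed
      (p := fun x => ∃ q r, x.1 = (Sum.inr q, r)) (by
        rintro ⟨x, i⟩ ⟨y, j⟩ ⟨q, r, hx⟩ hxy
        simp only at hx
        subst hx
        rcases hxy with ⟨a, -, h, -⟩ | ⟨h, -⟩ <;> exact starAut_step_inr h)
    have h₁' : ∀ x ∈ ρ₁, ∃ q r, x.1 = (Sum.inl q, r) := by
      rintro ⟨⟨q | q, r⟩, k⟩ hx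
      · exact ⟨q, r, rfl⟩
      · exact (h₁ _ hx ⟨q, r, rfl⟩).elim
    have hne₁ : ρ₁ ≠ [] := by
      rintro rfl
      obtain ⟨-, ⟨q, hq, h⟩, -⟩ := h
      rw [starAut_start] at hq
      obtain ⟨q, -, rfl⟩ := hq
      obtain ⟨_, _, h⟩ := h₂ _ (List.mem_of_head? h)
      simp [starLeft] at h
    have hne₂ : ρ₂ ≠ [] := by
      rintro rfl
      obtain ⟨-, -, q, hq, h⟩ := h
      rw [starAut_accept] at hq
      obtain ⟨q, -, rfl⟩ := hq
      rw [List.append_nil] at h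
      obtain ⟨_, _, h⟩ := h₁' _ (List.mem_of_getLast? h)
      simp [starRight] at h
    obtain ⟨p, s, ρ₂, q, q', rfl, rfl, hr₁, hr₂, hs, -⟩ := IsRun.cut h hne₁ hne₂ (by
      intro x hx y hy a hxy
      obtain ⟨q, r, hq⟩ := h₁' x (List.mem_of_getLast? hx)
      obtain ⟨q', r', hq'⟩ := h₂ y (List.mem_of_head? hy)
      rw [hq, hq', starAut_step_left] at hxy
      cases hxy.1)
    obtain ⟨q, r, rfl⟩ : ∃ p r, q = (Sum.inl p, r) := by
      obtain ⟨-, -, _, rfl, h⟩ := hr₁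
      exact h₁' _ (List.mem_of_getLast? h)
    obtain ⟨q', r', rfl⟩ : ∃ p r, q' = (Sum.inr p, r) := by
      obtain ⟨-, ⟨_, rfl, h⟩, -⟩ := hr₂
      exact h₂ _ (List.mem_of_head? (by rw [head?_shiftRun, h]; rfl))
    obtain ⟨-, hq, rfl, rfl⟩ := starAut_step_left.1 hs
    rw [starAut_start, show ({(Sum.inl q, r')} : Set ((σ ⊕ (BoxState ⊕ ν)) × τ)) =
      starLeft '' ({q} ×ˢ {r'}) by simp [starLeft]] at hr₁
    obtain ⟨π₁, rfl, hπ₁⟩ := isRun_starAut_left.1 hr₁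
    obtain ⟨π₁, rfl, hT, hr⟩ := track_isRun_iff.1 hπ₁
    -- The λ-move into `before` keeps the state of `AI`, so `□` is read from the state reached on
    -- `p`.
    obtain rfl : AI.evalFrom AI.start (p.map some) = r' := hr
    obtain ⟨κ, rfl, hκ⟩ := isRun_starAut_box.1 hr₂
    rw [starAut_accept] at hκ
    obtain ⟨π₂, rfl, hπ₂⟩ := isRun_starAut_right.1 hκ
    obtain ⟨π₂, rfl, hN, hb⟩ := track_isRun_iff.1 hπ₂
    exact ⟨p, s, π₁, π₂, rfl, hT.mono le_rfl (Set.singleton_subset_iff.2 hq), hN, boxWord_mem_accepts.2 hb,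
      rfl⟩
  · rintro ⟨p, s, ρ₁, ρ₂, rfl, h₁, h₂, hb, rfl⟩
    have h₂' := (isRun_starAut_box (AT := AT)).2 ⟨_, rfl, by
      rw [starAut_accept]
      exact isRun_starAut_right.2 ⟨_, rfl, track_isRun_iff.2
        ⟨ρ₂, rfl, h₂, boxWord_mem_accepts.1 hb⟩⟩⟩
    have h₁' := (isRun_starAut_left (AT := AT) (AI := AI) (A₂ := A₂)).2 ⟨_, rfl,
      (track_isRun_iff (r := AI.start)).2 ⟨ρ₁, rfl, h₁, Set.mem_singleton _⟩⟩
    rw [IsAcceptingRun, starAut_start]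
    refine h₁'.glue h₂' ?_
    rintro _ ⟨⟨q, _⟩, ⟨hq, rfl⟩, rfl⟩ _ rfl
    exact ⟨starAut_step_left.2 ⟨rfl, hq, rfl, rfl⟩, by simp [starLeft, starBox]⟩

theorem positions_cons_of_notMem {σ : Type} {q : σ} {k : ℕ} {ρ : List (σ × ℕ)} {S : Set σ}
    (h : q ∉ S) : positions ((q, k) :: ρ) S = positions ρ S := by
  ext j
  simp only [positions, List.mem_cons, Prod.mk.injEq, Set.mem_ofPred_eq]
  constructor
  · rintro ⟨q', hq', ⟨rfl, -⟩ | h'⟩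
    · exact (h hq').elim
    · exact ⟨q', hq', h'⟩
  · rintro ⟨q', hq', h'⟩
    exact ⟨q', hq', .inr h'⟩

theorem positions_starRun_left (p s : List α) (ρ₁ : List (σ × ℕ)) (ρ₂ : List (ν × ℕ)) (S : Set σ) :
    positions (starRun AI p s ρ₁ ρ₂) ((Sum.inl '' S) ×ˢ Set.univ) = positions ρ₁ S := by
  have h₁ : starLeft ⁻¹' ((Sum.inl '' S : Set (σ ⊕ (BoxState ⊕ ν))) ×ˢ (Set.univ : Set τ)) =
      S ×ˢ Set.univ := by
    ext ⟨q, r⟩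
    simp [starLeft]
  have h₂ : starRight ⁻¹' ((Sum.inl '' S : Set (σ ⊕ (BoxState ⊕ ν))) ×ˢ (Set.univ : Set τ)) =
      ∅ := by
    ext ⟨q, r⟩
    simp [starRight]
  rw [starRun, positions_append, positions_shiftRun,
    positions_cons_of_notMem (by simp [starBox]), positions_cons_of_notMem (by simp [starBox]),
    positions_mapRun, positions_mapRun, h₁, h₂, positions_trackRun, positions_empty]
  simp

theorem positions_starRun_right (p s : List α) (ρ₁ : List (σ × ℕ)) (ρ₂ : List (ν × ℕ))
    (S : Set ν) :
    positions (starRun AI p s ρ₁ ρ₂) (((fun q => Sum.inr (Sum.inr q)) '' S) ×ˢ Set.univ) =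
      (· + p.length) '' positions ρ₂ S := by
  have h₁ : starLeft ⁻¹' (((fun q => Sum.inr (Sum.inr q)) '' S :
      Set (σ ⊕ (BoxState ⊕ ν))) ×ˢ (Set.univ : Set τ)) = ∅ := by
    ext ⟨q, r⟩
    simp [starLeft]
  have h₂ : starRight ⁻¹' (((fun q => Sum.inr (Sum.inr q)) '' S :
      Set (σ ⊕ (BoxState ⊕ ν))) ×ˢ (Set.univ : Set τ)) = S ×ˢ Set.univ := by
    ext ⟨q, r⟩
    simp [starRight]
  rw [starRun, positions_append, positions_shiftRun,
    positions_cons_of_notMem (by simp [starBox]), positions_cons_of_notMem (by simp [starBox]),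
    positions_mapRun, positions_mapRun, h₁, h₂, positions_trackRun, positions_empty]
  simp

end StarAutomaton

/-! ### Bindable nodes and concatenation nodes -/

namespace Pattern

variable {α : Type}

/-- The bindable nodes, by recursion on the pattern. -/
def IsBindable : Pattern α → Node → Prop
  | _, [] => True
  | alt P _, Dir.one :: n => P.IsBindable n
  | alt _ Q, Dir.two :: n => Q.IsBindable n
  | cat P _, Dir.one :: n => P.IsBindable n
  | cat _ Q, Dir.two :: n => Q.IsBindable n
  | _, _ => False

/-- The bindable nodes that are labeled by a concatenation. -/
def IsCatNode : Pattern α → Node → Prop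
  | cat _ _, [] => True
  | alt P _, Dir.one :: n => P.IsCatNode n
  | alt _ Q, Dir.two :: n => Q.IsCatNode n
  | cat P _, Dir.one :: n => P.IsCatNode n
  | cat _ Q, Dir.two :: n => Q.IsCatNode n
  | _, _ => False

theorem nil_mem_bindable (P : Pattern α) : [] ∈ P.bindable := by
  refine ⟨by cases P <;> simp [label], ?_⟩
  rintro ⟨m, n, hn, h, -⟩
  exact hn (List.append_eq_nil_iff.1 h.symm).2

theorem cons_mem_bindable {P Q : Pattern α} {d : Dir} {n : Node} (h₀ : P.label [] ≠ some .star)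
    (h : ∀ m, P.label (d :: m) = Q.label m) : d :: n ∈ P.bindable ↔ n ∈ Q.bindable := by
  simp only [bindable, Set.mem_ofPred_eq, h]
  refine and_congr_right fun _ => not_congr ⟨?_, ?_⟩
  · rintro ⟨_ | ⟨d', m⟩, n', hn', he, hl⟩
    · exact (h₀ hl).elim
    · obtain ⟨rfl, rfl⟩ := List.cons_eq_cons.1 he
      exact ⟨m, n', hn', rfl, by rwa [← h]⟩
  · rintro ⟨m, n', hn', rfl, hl⟩
    exact ⟨d :: m, n', hn', rfl, by rwa [h]⟩

theorem mem_bindable_iff {P : Pattern α} {n : Node} : n ∈ P.bindable ↔ P.IsBindable n := by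
  induction P generalizing n with
  | eps =>
    rcases n with _ | ⟨d, n⟩
    · simp [IsBindable, nil_mem_bindable]
    · cases d <;> simp [IsBindable, bindable, label]
  | sym a =>
    rcases n with _ | ⟨d, n⟩
    · simp [IsBindable, nil_mem_bindable]
    · cases d <;> simp [IsBindable, bindable, label]
  | star P ih =>
    rcases n with _ | ⟨d, n⟩
    · simp [IsBindable, nil_mem_bindable]
    · refine iff_of_false (fun h => h.2 ⟨[], d :: n, by simp, rfl, rfl⟩) ?_
      cases d <;> simp [IsBindable]
  | alt P Q ih₁ ih₂ =>
    rcases n with _ | ⟨d | d, n⟩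
    · simp [IsBindable, nil_mem_bindable]
    · rw [IsBindable, ← ih₁, cons_mem_bindable (by simp [label]) fun _ => rfl]
    · rw [IsBindable, ← ih₂, cons_mem_bindable (by simp [label]) fun _ => rfl]
  | cat P Q ih₁ ih₂ =>
    rcases n with _ | ⟨d | d, n⟩
    · simp [IsBindable, nil_mem_bindable]
    · rw [IsBindable, ← ih₁, cons_mem_bindable (by simp [label]) fun _ => rfl]
    · rw [IsBindable, ← ih₂, cons_mem_bindable (by simp [label]) fun _ => rfl]

theorem IsAtom.isBase {P : Pattern α} (h : P.IsAtom) : P.IsBase := h.elim .inl fun h => .inr (.inl h)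

theorem IsBase.not_isCatNode {P : Pattern α} (h : P.IsBase) (n : Node) : ¬ P.IsCatNode n := by
  obtain rfl | ⟨a, rfl⟩ | ⟨P, rfl⟩ := h <;> simp [IsCatNode]

/-- The reason why `ε · P₂` and `σ · P₂` can use a plain concatenation of automata: the place of the
split is determined. -/
theorem IsAtom.eq_of_mem {P : Pattern α} (h : P.IsAtom) {u v : List α} (hu : u ∈ P.lang)
    (hv : v ∈ P.lang) : u = v := by
  obtain rfl | ⟨a, rfl⟩ := h
  · exact Eq.trans hu (Eq.symm hv)
  · exact Eq.trans hu (Eq.symm hv)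

end Pattern

/-! ### Concatenation nodes in hyperautomata -/

section CatNodeSpec

variable {α σ τ : Type}

/-- The triples `t`, `t₁`, `t₂` of a node that is labeled by a concatenation and of its two
children: an accepting run that visits `t` passes from the final states of `t₁` to the initial states
of `t₂` without reading a letter, and `t₁` cannot be reached from `t₂`. -/
structure CatNodeSpec (A : εNFA α σ) (t t₁ t₂ : StateTriple σ) : Prop where
  sub_left : t₁.Q ⊆ t.Q
  sub_right : t₂.Q ⊆ t.Q
  not_reach : ∀ q ∈ t₂.Q, ∀ q', Reach A q q' → q' ∉ t₁.Q
  start_sub : t.I ⊆ t₁.I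
  final_sub : t.F ⊆ t₂.F
  switch : ∀ w ρ, IsAcceptingRun A w ρ → (positions ρ t.Q).Nonempty →
    ∃ q q' k, [(q, k), (q', k)].Sublist ρ ∧ q ∈ t₁.F ∧ q' ∈ t₂.I

/-- The triple of all states that are related to a state of the given triple. -/
def StateTriple.rel (R : σ → τ → Prop) (t : StateTriple σ) : StateTriple τ :=
  ⟨{y | ∃ q ∈ t.Q, R q y}, {y | ∃ q ∈ t.I, R q y}, {y | ∃ q ∈ t.F, R q y}⟩

/-- `R` relates a state of `A` to its copies in `B`. A copy has one origin, transitions lead from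
copies to copies, and an accepting run of `B` that meets a copy contains a shifted accepting run of
`A` as its whole part among the copies. Thus paths project to `A`, which gives non-reachability, and
switches lift from `A`. -/
theorem CatNodeSpec.rel {A : εNFA α σ} {B : εNFA α τ} {t t₁ t₂ : StateTriple σ}
    (h : CatNodeSpec A t t₁ t₂) (R : σ → τ → Prop) (hR : ∀ q q' y, R q y → R q' y → q = q')
    (hstep : ∀ q y x y', R q y → y' ∈ B.step y x → ∃ q', R q' y' ∧ q' ∈ A.step q x)
    (hrun : ∀ w ρ, IsAcceptingRun B w ρ → (∃ y ∈ ρ, ∃ q, R q y.1) →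
      ∃ w' ρ' d, ∃ φ : σ × ℕ → τ, IsAcceptingRun A w' ρ' ∧ (∀ x, R x.1 (φ x)) ∧
        (ρ'.map fun x => (φ x, x.2 + d)).Sublist ρ ∧
        ∀ y ∈ ρ, (∃ q, R q y.1) → y ∈ ρ'.map fun x => (φ x, x.2 + d)) :
    CatNodeSpec B (t.rel R) (t₁.rel R) (t₂.rel R) where
  sub_left := fun _ ⟨q, hq, hy⟩ => ⟨q, h.sub_left hq, hy⟩
  sub_right := fun _ ⟨q, hq, hy⟩ => ⟨q, h.sub_right hq, hy⟩
  start_sub := fun _ ⟨q, hq, hy⟩ => ⟨q, h.start_sub hq, hy⟩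
  final_sub := fun _ ⟨q, hq, hy⟩ => ⟨q, h.final_sub hq, hy⟩
  not_reach := by
    rintro y ⟨q, hq, hy⟩ y' hr ⟨q₁, hq₁, hy₁⟩
    have : ∃ q', R q' y' ∧ Reach A q q' := by
      clear hy₁
      induction hr with
      | refl => exact ⟨q, hy, .refl⟩
      | tail _ hs ih =>
        obtain ⟨q', hq', hr⟩ := ih
        obtain ⟨x, hs⟩ := hs
        obtain ⟨q'', h₁, h₂⟩ := hstep _ _ _ _ hq' hs
        exact ⟨q'', h₁, hr.tail ⟨x, h₂⟩⟩
    obtain ⟨q', hq', hr'⟩ := this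
    obtain rfl := hR _ _ _ hq' hy₁
    exact h.not_reach q hq _ hr' hq₁
  switch := by
    rintro w ρ hρ ⟨k, y, ⟨q, hq, hy⟩, hk⟩
    obtain ⟨w', ρ', d, φ, hρ', hφ, hs, hm⟩ := hrun w ρ hρ ⟨_, hk, q, hy⟩
    obtain ⟨⟨p, i⟩, hp, he⟩ := List.mem_map.1 (hm _ hk ⟨q, hy⟩)
    obtain ⟨rfl, -⟩ := Prod.ext_iff.1 he
    obtain rfl : p = q := hR _ _ _ (hφ (p, i)) hy
    obtain ⟨q₁, q₂, j, hj, h₁, h₂⟩ := h.switch w' ρ' hρ' ⟨i, p, hq, hp⟩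
    exact ⟨φ (q₁, j), φ (q₂, j), j + d, (hj.map fun x => (φ x, x.2 + d)).trans hs,
      ⟨q₁, h₁, hφ (q₁, j)⟩, q₂, h₂, hφ (q₂, j)⟩

theorem CatNodeSpec.disjUnion_inl {A : εNFA α σ} {B : εNFA α τ} {t t₁ t₂ : StateTriple σ}
    (h : CatNodeSpec A t t₁ t₂) :
    CatNodeSpec (A.disjUnion B) (t.map Sum.inl) (t₁.map Sum.inl) (t₂.map Sum.inl) := by
  refine h.rel (fun q y => Sum.inl q = y) (fun q q' y h h' => Sum.inl_injective (h.trans h'.symm))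
    ?_ ?_
  · rintro q _ x y rfl ⟨q', hq', rfl⟩
    exact ⟨q', rfl, hq'⟩
  · rintro w ρ hρ ⟨⟨_, k⟩, hy, q, rfl⟩
    obtain ⟨ρ', rfl, hρ'⟩ | ⟨ρ', rfl, hρ'⟩ := isRun_disjUnion.1 hρ
    · exact ⟨w, ρ', 0, fun x => Sum.inl x.1, hρ', fun _ => rfl, .refl _, fun y hy _ => hy⟩
    · simp [mapRun] at hy

theorem CatNodeSpec.disjUnion_inr {A : εNFA α σ} {B : εNFA α τ} {t t₁ t₂ : StateTriple τ}
    (h : CatNodeSpec B t t₁ t₂) :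
    CatNodeSpec (A.disjUnion B) (t.map Sum.inr) (t₁.map Sum.inr) (t₂.map Sum.inr) := by
  refine h.rel (fun q y => Sum.inr q = y) (fun q q' y h h' => Sum.inr_injective (h.trans h'.symm))
    ?_ ?_
  · rintro q _ x y rfl ⟨q', hq', rfl⟩
    exact ⟨q', rfl, hq'⟩
  · rintro w ρ hρ ⟨⟨_, k⟩, hy, q, rfl⟩
    obtain ⟨ρ', rfl, hρ'⟩ | ⟨ρ', rfl, hρ'⟩ := isRun_disjUnion.1 hρ
    · simp [mapRun] at hy
    · exact ⟨w, ρ', 0, fun x => Sum.inr x.1, hρ', fun _ => rfl, .refl _, fun y hy _ => hy⟩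

theorem CatNodeSpec.concat_inr {A : εNFA α σ} {B : εNFA α τ} {t t₁ t₂ : StateTriple τ}
    (h : CatNodeSpec B t t₁ t₂) :
    CatNodeSpec (A.concat B) (t.map Sum.inr) (t₁.map Sum.inr) (t₂.map Sum.inr) := by
  refine h.rel (fun q y => Sum.inr q = y) (fun q q' y h h' => Sum.inr_injective (h.trans h'.symm))
    ?_ ?_
  · rintro q _ x y rfl ⟨q', hq', rfl⟩
    exact ⟨q', rfl, hq'⟩
  · rintro w ρ hρ -
    obtain ⟨w₁, w₂, ρ₁, ρ₂, rfl, -, hρ₂, rfl⟩ := isAcceptingRun_concat.1 hρ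
    have he : shiftRun w₁.length (mapRun Sum.inr ρ₂) =
        ρ₂.map fun x => ((Sum.inr x.1 : σ ⊕ τ), x.2 + w₁.length) := by
      simp [shiftRun, mapRun]
    refine ⟨w₂, ρ₂, w₁.length, fun x => Sum.inr x.1, hρ₂, fun _ => rfl, ?_, ?_⟩
    · rw [concatRun, he]
      exact List.sublist_append_right _ _
    · rintro ⟨_, k⟩ hy ⟨q, rfl⟩
      rw [concatRun, he, List.mem_append] at hy
      refine hy.resolve_left fun hy => ?_
      simp [mapRun] at hy

theorem CatNodeSpec.starAut {ν : Type} {AT : DFA α σ} {AI : DFA (Boxed α) τ} {A₂ : εNFA α ν}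
    {t t₁ t₂ : StateTriple ν} (h : CatNodeSpec A₂ t t₁ t₂) :
    CatNodeSpec (Hyperautomaton.starAut AT AI A₂)
      ((t.map fun q => Sum.inr (Sum.inr q)).timesAll τ)
      ((t₁.map fun q => Sum.inr (Sum.inr q)).timesAll τ)
      ((t₂.map fun q => Sum.inr (Sum.inr q)).timesAll τ) := by
  -- A state of `A₂` has one copy for each state of `AI`; this is why a relation is transported and
  -- not the graph of an embedding.
  have key : ∀ t : StateTriple ν, (t.map fun q => (Sum.inr (Sum.inr q) :
      σ ⊕ (BoxState ⊕ ν))).timesAll τ = t.rel fun q y => ∃ r, starRight (q, r) = y := by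
    intro t
    simp only [StateTriple.map, StateTriple.timesAll, StateTriple.rel, StateTriple.mk.injEq,
      Set.ext_iff]
    refine ⟨?_, ?_, ?_⟩ <;>
    · rintro ⟨y, r⟩
      simp [starRight, Prod.ext_iff]
  rw [key, key, key]
  refine h.rel _ ?_ ?_ ?_
  · rintro q q' _ ⟨r, rfl⟩ ⟨r', h⟩
    exact ((Prod.ext_iff.1 (starRight_injective h)).1).symm
  · rintro q _ x y ⟨r, rfl⟩ hy
    obtain ⟨⟨q', r'⟩, rfl⟩ := starAut_step_right hy
    refine ⟨q', ⟨r', rfl⟩, ?_⟩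
    rw [isEmb_starRight.step] at hy
    cases x <;> exact hy.1
  · rintro w ρ hρ -
    obtain ⟨p, s, ρ₁, ρ₂, rfl, -, hρ₂, -, rfl⟩ := isAcceptingRun_starAut.1 hρ
    -- Which copy is visited depends on the position, through the tracked state of `AI`.
    refine ⟨s, ρ₂, p.length, fun x => starRight (x.1,
      AI.evalFrom (AI.step (AI.evalFrom AI.start (p.map some)) none) ((s.take x.2).map some)),
      hρ₂, fun x => ⟨_, rfl⟩, ?_, ?_⟩
    · refine List.Sublist.trans ?_ (List.sublist_append_right _ _)
      simp only [shiftRun, mapRun, trackRun, List.map_cons, List.map_map]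
      exact ((List.Sublist.refl _).cons _).cons _
    · rintro ⟨_, k⟩ hy ⟨q, r, rfl⟩
      simp only [starRun, shiftRun, mapRun, trackRun, List.map_cons, List.map_map,
        List.mem_append, List.mem_cons] at hy
      rcases hy with hy | hy | hy | hy
      · simp [starLeft, starRight] at hy
      · simp [starBox, starRight] at hy
      · simp [starBox, starRight] at hy
      · exact hy

/-- Uniting two nodes is harmless if the right child of either cannot reach the left child of the
other. In a disjoint union this holds trivially. -/
theorem CatNodeSpec.union {A : εNFA α σ} {t t₁ t₂ u u₁ u₂ : StateTriple σ}
    (h : CatNodeSpec A t t₁ t₂) (h' : CatNodeSpec A u u₁ u₂)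
    (h₁ : ∀ q ∈ t₂.Q, ∀ q', Reach A q q' → q' ∉ u₁.Q)
    (h₂ : ∀ q ∈ u₂.Q, ∀ q', Reach A q q' → q' ∉ t₁.Q) :
    CatNodeSpec A (t.union u) (t₁.union u₁) (t₂.union u₂) where
  sub_left := Set.union_subset_union h.sub_left h'.sub_left
  sub_right := Set.union_subset_union h.sub_right h'.sub_right
  start_sub := Set.union_subset_union h.start_sub h'.start_sub
  final_sub := Set.union_subset_union h.final_sub h'.final_sub
  not_reach := by
    rintro q (hq | hq) q' hr (hq' | hq')
    exacts [h.not_reach q hq q' hr hq', h₁ q hq q' hr hq', h₂ q hq q' hr hq',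
      h'.not_reach q hq q' hr hq']
  switch := by
    rintro w ρ hρ ⟨k, q, hq | hq, hk⟩
    · obtain ⟨q₁, q₂, j, hj, hq₁, hq₂⟩ := h.switch w ρ hρ ⟨k, q, hq, hk⟩
      exact ⟨q₁, q₂, j, hj, .inl hq₁, .inl hq₂⟩
    · obtain ⟨q₁, q₂, j, hj, hq₁, hq₂⟩ := h'.switch w ρ hρ ⟨k, q, hq, hk⟩
      exact ⟨q₁, q₂, j, hj, .inr hq₁, .inr hq₂⟩

theorem reach_disjUnion_inl {A : εNFA α σ} {B : εNFA α τ} {q : σ} {y : σ ⊕ τ}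
    (h : Reach (A.disjUnion B) (Sum.inl q) y) : ∃ q', y = Sum.inl q' := by
  induction h with
  | refl => exact ⟨q, rfl⟩
  | tail _ hs ih =>
    obtain ⟨q', rfl⟩ := ih
    obtain ⟨x, q'', -, rfl⟩ := hs
    exact ⟨q'', rfl⟩

theorem reach_disjUnion_inr {A : εNFA α σ} {B : εNFA α τ} {q : τ} {y : σ ⊕ τ}
    (h : Reach (A.disjUnion B) (Sum.inr q) y) : ∃ q', y = Sum.inr q' := by
  induction h with
  | refl => exact ⟨q, rfl⟩
  | tail _ hs ih =>
    obtain ⟨q', rfl⟩ := ih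
    obtain ⟨x, q'', -, rfl⟩ := hs
    exact ⟨q'', rfl⟩

theorem CatNodeSpec.disjUnion {A : εNFA α σ} {B : εNFA α τ} {t t₁ t₂ : StateTriple σ}
    {u u₁ u₂ : StateTriple τ} (h : CatNodeSpec A t t₁ t₂) (h' : CatNodeSpec B u u₁ u₂) :
    CatNodeSpec (A.disjUnion B) ((t.map Sum.inl).union (u.map Sum.inr))
      ((t₁.map Sum.inl).union (u₁.map Sum.inr)) ((t₂.map Sum.inl).union (u₂.map Sum.inr)) := by
  refine h.disjUnion_inl.union h'.disjUnion_inr ?_ ?_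
  · rintro _ ⟨q, -, rfl⟩ y hr ⟨q', -, rfl⟩
    obtain ⟨_, ⟨⟩⟩ := reach_disjUnion_inl hr
  · rintro _ ⟨q, -, rfl⟩ y hr ⟨q', -, rfl⟩
    obtain ⟨_, ⟨⟩⟩ := reach_disjUnion_inr hr

theorem ofAut_disjUnion (A : εNFA α σ) (B : εNFA α τ) : StateTriple.ofAut (A.disjUnion B) =
    ((StateTriple.ofAut A).map Sum.inl).union ((StateTriple.ofAut B).map Sum.inr) := by
  simp [StateTriple.ofAut, StateTriple.map, StateTriple.union, εNFA.disjUnion]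

/-- A state of `t₁` cannot come after `q'`, nor a state of `t₂` before `q`, since `t₁` is not
reachable from `t₂`. So the position of the switch is the last visit of `t₁` and the first of `t₂`.
-/
theorem CatNodeSpec.isGreatest_isLeast {A : εNFA α σ} {t t₁ t₂ : StateTriple σ}
    (h : CatNodeSpec A t t₁ t₂) (hF : t₁.F ⊆ t₁.Q) (hI : t₂.I ⊆ t₂.Q) {w : List α}
    {ρ : List (σ × ℕ)} (hρ : IsAcceptingRun A w ρ) {q q' : σ} {k : ℕ}
    (hm : (q, k) ∈ ρ) (hm' : (q', k) ∈ ρ) (hq : q ∈ t₁.F) (hq' : q' ∈ t₂.I) :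
    IsGreatest (positions ρ t₁.Q) k ∧ IsLeast (positions ρ t₂.Q) k := by
  refine ⟨⟨⟨q, hF hq, hm⟩, ?_⟩, ⟨q', hI hq', hm'⟩, ?_⟩
  · rintro j ⟨p, hp, hj⟩
    rcases hρ.1.reflTransGen_total hj hm' with h' | h'
    · exact reflTransGen_runStep_le h'
    · exact (h.not_reach _ (hI hq') _ (reflTransGen_runStep_reach h') hp).elim
  · rintro j ⟨p, hp, hj⟩
    rcases hρ.1.reflTransGen_total hm hj with h' | h'
    · exact reflTransGen_runStep_le h'
    · exact (h.not_reach _ hp _ (reflTransGen_runStep_reach h') (hF hq)).elim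

end CatNodeSpec

/-! ### Correct hyperautomata -/

section Correct

variable {α : Type}

/-- The associations that are read off from a run on `w`. -/
noncomputable def Hyperautomaton.assoc (H : Hyperautomaton α) (w : List α)
    (ρ : List (H.State × ℕ)) : Assoc α :=
  fun n => subword w (bound ρ (H.f n).Q)

/-- The properties of the results of the algorithm that are preserved by its recursive calls. -/
structure Correct (P : Pattern α) (C : Language α) (H : Hyperautomaton α) : Prop where
  f_nil : H.f [] = StateTriple.ofAut H.A
  f_empty : ∀ n, ¬ P.IsBindable n → H.f n = StateTriple.empty
  start_sub : ∀ n, (H.f n).I ⊆ (H.f n).Q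
  final_sub : ∀ n, (H.f n).F ⊆ (H.f n).Q
  langAt_cons : ∀ d n, H.langAt (d :: n) = typeOf (d :: n) P C
  unambiguous : ∀ w ρ ρ', IsAcceptingRun H.A w ρ → IsAcceptingRun H.A w ρ' → ρ = ρ'
  matches_iff : ∀ w V, (w ∈ C ∧ Matches P w V) ↔ ∃ ρ, IsAcceptingRun H.A w ρ ∧ V = H.assoc w ρ
  cat : ∀ n, P.IsCatNode n →
    CatNodeSpec H.A (H.f n) (H.f (n ++ [Dir.one])) (H.f (n ++ [Dir.two]))

variable {P P₁ P₂ P₃ : Pattern α} {C : Language α} {H H₁ H₂ : Hyperautomaton α}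

theorem mem_typeOf {n : Node} {u : List α} :
    u ∈ typeOf n P C ↔ ∃ w V, (w ∈ C ∧ Matches P w V) ∧ V n = some u := by
  constructor
  · rintro ⟨w, hw, V, hV, h⟩
    exact ⟨w, V, ⟨hw, hV⟩, h⟩
  · rintro ⟨w, V, ⟨hw, hV⟩, h⟩
    exact ⟨w, hw, V, hV, h⟩

theorem mem_langAt {n : Node} {u : List α} :
    u ∈ H.langAt n ↔ ∃ ρ, IsRun H.A (H.f n).I (H.f n).F u ρ := Iff.rfl

theorem Correct.Q_nil (h : Correct P C H) : (H.f []).Q = Set.univ := by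
  rw [h.f_nil]
  rfl

theorem Correct.assoc_nil (h : Correct P C H) {w : List α} {ρ : List (H.State × ℕ)}
    (hρ : IsAcceptingRun H.A w ρ) : H.assoc w ρ [] = some w := by
  rw [Hyperautomaton.assoc, h.Q_nil, hρ.subword_univ]

/-- The triple of the root is the whole automaton and the root value is the whole word, so the root
needs no separate clause in the invariant. -/
theorem Correct.langAt_nil (h : Correct P C H) : H.langAt [] = typeOf [] P C := by
  ext u
  rw [mem_langAt, mem_typeOf, h.f_nil]
  simp only [h.matches_iff]
  constructor
  · rintro ⟨ρ, hρ⟩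
    exact ⟨u, _, ⟨ρ, hρ, rfl⟩, h.assoc_nil hρ⟩
  · rintro ⟨w, _, ⟨ρ, hρ, rfl⟩, hu⟩
    rw [h.assoc_nil hρ] at hu
    cases hu
    exact ⟨ρ, hρ⟩

theorem Correct.langAt (h : Correct P C H) (n : Node) : H.langAt n = typeOf n P C := by
  cases n with
  | nil => exact h.langAt_nil
  | cons d n => exact h.langAt_cons d n

theorem Correct.mem_of_isAcceptingRun (h : Correct P C H) {w : List α} {ρ : List (H.State × ℕ)}
    (hρ : IsAcceptingRun H.A w ρ) : w ∈ C ∧ Matches P w (H.assoc w ρ) :=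
  (h.matches_iff w _).2 ⟨ρ, hρ, rfl⟩

theorem Correct.mem_lang (h : Correct P C H) {w : List α} {ρ : List (H.State × ℕ)}
    (hρ : IsAcceptingRun H.A w ρ) : w ∈ P.lang :=
  ((Pattern.matchSpec P).mem w).1 ⟨_, (h.mem_of_isAcceptingRun hρ).2⟩

theorem Correct.base {σ : Type} [Finite σ] {M : DFA α σ} (hP : P.IsBase)
    (hM : M.accepts = P.lang ⊓ C) : Correct P C (Hyperautomaton.base M) where
  f_nil := rfl
  f_empty n hn := by
    cases n with
    | nil => exact (hn (by cases P <;> trivial)).elim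
    | cons d n => rfl
  start_sub n := by
    cases n with
    | nil => exact Set.subset_univ _
    | cons d n => exact Set.empty_subset _
  final_sub n := by
    cases n with
    | nil => exact Set.subset_univ _
    | cons d n => exact Set.empty_subset _
  langAt_cons d n := by
    ext u
    simp only [mem_langAt, mem_typeOf, Pattern.matches_base_iff hP]
    refine iff_of_false ?_ ?_
    · rintro ⟨ρ, -, ⟨q, hq, -⟩, -⟩
      exact hq
    · rintro ⟨w, _, ⟨-, -, rfl⟩, ⟨⟩⟩
  unambiguous w ρ ρ' h h' := toLoopNFA_unique h h'
  matches_iff w V := by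
    have hV : ∀ ρ, IsAcceptingRun M.toLoopNFA w ρ →
        (Hyperautomaton.base M).assoc w ρ = Assoc.single w := by
      intro ρ hρ
      funext n
      cases n with
      | nil => exact hρ.subword_univ
      | cons d n => exact subword_bound_eq_none fun ⟨_, _, hq, _⟩ => hq
    have hw : w ∈ M.accepts ↔ w ∈ P.lang ∧ w ∈ C := by rw [hM]; rfl
    rw [Pattern.matches_base_iff hP]
    constructor
    · rintro ⟨h₁, h₂, rfl⟩
      obtain ⟨ρ, hρ⟩ := exists_toLoopNFA_iff.2 (hw.2 ⟨h₂, h₁⟩)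
      exact ⟨ρ, hρ, (hV ρ hρ).symm⟩
    · rintro ⟨ρ, hρ, rfl⟩
      obtain ⟨h₁, h₂⟩ := hw.1 (exists_toLoopNFA_iff.1 ⟨ρ, hρ⟩)
      exact ⟨h₂, h₁, hV ρ hρ⟩
  cat n hn := (hP.not_isCatNode n hn).elim

/-! ### Unions -/

theorem assoc_of_empty {w : List α} {ρ : List (H.State × ℕ)} {n : Node}
    (h : positions ρ (H.f n).Q = ∅) : H.assoc w ρ n = none :=
  subword_bound_eq_none (by rw [h]; exact Set.not_nonempty_empty)

theorem assoc_alt_inl (h₁ : Correct P₁ C H₁) {w : List α} {ρ : List (H₁.State × ℕ)}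
    (hρ : IsAcceptingRun H₁.A w ρ) :
    (H₁.alt H₂).assoc w (mapRun Sum.inl ρ) = (H₁.assoc w ρ).orLeft := by
  funext n
  match n with
  | [] =>
    rw [Assoc.orLeft, h₁.assoc_nil hρ, ← hρ.subword_univ]
    exact subword_bound_congr (positions_mapRun _ _)
  | Dir.one :: n =>
    refine subword_bound_congr ((positions_mapRun _ _).trans ?_)
    exact congrArg _ (Set.preimage_image_eq _ Sum.inl_injective)
  | Dir.two :: n =>
    refine assoc_of_empty ((positions_mapRun _ _).trans ?_)
    exact (congrArg _ (Set.preimage_inl_image_inr _)).trans (positions_empty _)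

theorem assoc_alt_inr (h₂ : Correct P₂ C H₂) {w : List α} {ρ : List (H₂.State × ℕ)}
    (hρ : IsAcceptingRun H₂.A w ρ) :
    (H₁.alt H₂).assoc w (mapRun Sum.inr ρ) = (H₂.assoc w ρ).orRight := by
  funext n
  match n with
  | [] =>
    rw [Assoc.orRight, h₂.assoc_nil hρ, ← hρ.subword_univ]
    exact subword_bound_congr (positions_mapRun _ _)
  | Dir.one :: n =>
    refine assoc_of_empty ((positions_mapRun _ _).trans ?_)
    exact (congrArg _ (Set.preimage_inr_image_inl _)).trans (positions_empty _)
  | Dir.two :: n =>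
    refine subword_bound_congr ((positions_mapRun _ _).trans ?_)
    exact congrArg _ (Set.preimage_image_eq _ Sum.inr_injective)

/-- The second automaton accepts only words of `C - L(P₁)`, and the first only words of `L(P₁)`; two
runs on one word lie in the same summand. Stated outside `Correct.alt` because `distrib` keeps the
automaton and reuses it. -/
theorem unambiguous_alt (h₁ : Correct P₁ C H₁) (h₂ : Correct P₂ (C - P₁.lang) H₂) {w : List α}
    {ρ ρ' : List ((H₁.alt H₂).State × ℕ)} (h : IsAcceptingRun (H₁.alt H₂).A w ρ)
    (h' : IsAcceptingRun (H₁.alt H₂).A w ρ') : ρ = ρ' := by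
  obtain ⟨π, rfl, hπ⟩ | ⟨π, rfl, hπ⟩ := isRun_disjUnion.1 h <;>
    obtain ⟨π', rfl, hπ'⟩ | ⟨π', rfl, hπ'⟩ := isRun_disjUnion.1 h'
  · rw [h₁.unambiguous w _ _ hπ hπ']
  · exact ((h₂.mem_of_isAcceptingRun hπ').1.2 (h₁.mem_lang hπ)).elim
  · exact ((h₂.mem_of_isAcceptingRun hπ).1.2 (h₁.mem_lang hπ')).elim
  · rw [h₂.unambiguous w _ _ hπ hπ']

theorem mem_langAt_alt_one {u : List α} {n : Node} :
    u ∈ (H₁.alt H₂).langAt (Dir.one :: n) ↔ u ∈ H₁.langAt n := by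
  rw [mem_langAt, mem_langAt]
  have := @isRun_disjUnion_inl _ _ _ H₁.A H₂.A u (H₁.f n).I (H₁.f n).F ∅
  rw [Set.image_empty, Set.union_empty] at this
  refine (exists_congr fun ρ => this).trans ⟨?_, ?_⟩
  · rintro ⟨_, ρ, -, h⟩
    exact ⟨ρ, h⟩
  · rintro ⟨ρ, h⟩
    exact ⟨_, ρ, rfl, h⟩

theorem mem_langAt_alt_two {u : List α} {n : Node} :
    u ∈ (H₁.alt H₂).langAt (Dir.two :: n) ↔ u ∈ H₂.langAt n := by
  rw [mem_langAt, mem_langAt]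
  have := @isRun_disjUnion_inr _ _ _ H₁.A H₂.A u (H₂.f n).I (H₂.f n).F ∅
  rw [Set.image_empty, Set.empty_union] at this
  refine (exists_congr fun ρ => this).trans ⟨?_, ?_⟩
  · rintro ⟨_, ρ, -, h⟩
    exact ⟨ρ, h⟩
  · rintro ⟨ρ, h⟩
    exact ⟨_, ρ, rfl, h⟩

theorem StateTriple.map_empty {σ τ : Type} (g : σ → τ) :
    (StateTriple.empty : StateTriple σ).map g = StateTriple.empty := by
  simp [StateTriple.map, StateTriple.empty]

theorem Correct.alt (h₁ : Correct P₁ C H₁) (h₂ : Correct P₂ (C - P₁.lang) H₂) :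
    Correct (P₁.alt P₂) C (H₁.alt H₂) where
  f_nil := rfl
  f_empty n hn := by
    rcases n with _ | ⟨_ | _, n⟩
    · exact (hn trivial).elim
    · exact (congrArg _ (h₁.f_empty n hn)).trans (StateTriple.map_empty _)
    · exact (congrArg _ (h₂.f_empty n hn)).trans (StateTriple.map_empty _)
  start_sub n := by
    rcases n with _ | ⟨_ | _, n⟩
    · exact Set.subset_univ _
    · exact Set.image_mono (h₁.start_sub n)
    · exact Set.image_mono (h₂.start_sub n)
  final_sub n := by
    rcases n with _ | ⟨_ | _, n⟩
    · exact Set.subset_univ _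
    · exact Set.image_mono (h₁.final_sub n)
    · exact Set.image_mono (h₂.final_sub n)
  langAt_cons d n := by
    ext u
    simp only [mem_typeOf, Matches]
    rcases d with _ | _
    · rw [mem_langAt_alt_one, h₁.langAt, mem_typeOf]
      constructor
      · rintro ⟨w, V, ⟨hw, hV⟩, hu⟩
        exact ⟨w, V.orLeft, ⟨hw, .inl ⟨V, hV, rfl⟩⟩, hu⟩
      · rintro ⟨w, _, ⟨hw, ⟨V, hV, rfl⟩ | ⟨V, hV, -, rfl⟩⟩, hu⟩
        · exact ⟨w, V, ⟨hw, hV⟩, hu⟩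
        · cases hu
    · rw [mem_langAt_alt_two, h₂.langAt, mem_typeOf]
      constructor
      · rintro ⟨w, V, ⟨hw, hV⟩, hu⟩
        exact ⟨w, V.orRight, ⟨hw.1, .inr ⟨V, hV, mt ((Pattern.matchSpec _).mem w).1 hw.2, rfl⟩⟩,
          hu⟩
      · rintro ⟨w, _, ⟨hw, ⟨V, hV, rfl⟩ | ⟨V, hV, hn, rfl⟩⟩, hu⟩
        · cases hu
        · exact ⟨w, V, ⟨⟨hw, mt ((Pattern.matchSpec _).mem w).2 hn⟩, hV⟩, hu⟩
  unambiguous w ρ ρ' h h' := unambiguous_alt h₁ h₂ h h'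
  matches_iff w V := by
    rw [Matches]
    constructor
    · rintro ⟨hw, ⟨V, hV, rfl⟩ | ⟨V, hV, hn, rfl⟩⟩
      · obtain ⟨ρ, hρ, rfl⟩ := (h₁.matches_iff w V).1 ⟨hw, hV⟩
        exact ⟨_, isRun_disjUnion.2 (.inl ⟨ρ, rfl, hρ⟩), (assoc_alt_inl h₁ hρ).symm⟩
      · obtain ⟨ρ, hρ, rfl⟩ :=
          (h₂.matches_iff w V).1 ⟨⟨hw, mt ((Pattern.matchSpec _).mem w).2 hn⟩, hV⟩
        exact ⟨_, isRun_disjUnion.2 (.inr ⟨ρ, rfl, hρ⟩), (assoc_alt_inr h₂ hρ).symm⟩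
    · rintro ⟨_, h, rfl⟩
      obtain ⟨ρ, rfl, hρ⟩ | ⟨ρ, rfl, hρ⟩ := isRun_disjUnion.1 h
      · obtain ⟨hw, hm⟩ := h₁.mem_of_isAcceptingRun hρ
        exact ⟨hw, .inl ⟨_, hm, assoc_alt_inl h₁ hρ⟩⟩
      · obtain ⟨hw, hm⟩ := h₂.mem_of_isAcceptingRun hρ
        exact ⟨hw.1, .inr ⟨_, hm, mt ((Pattern.matchSpec _).mem w).1 hw.2, assoc_alt_inr h₂ hρ⟩⟩
  cat n hn := by
    rcases n with _ | ⟨_ | _, n⟩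
    · exact hn.elim
    · exact (h₁.cat n hn).disjUnion_inl
    · exact (h₂.cat n hn).disjUnion_inr

/-! ### Concatenations with `ε` or a letter -/

theorem matches_atomCat_iff (hP : P₁.IsAtom) {w : List α} {V : Assoc α} :
    Matches (P₁.cat P₂) w V ↔
      ∃ w₁ w₂ V₁ V₂, Matches P₁ w₁ V₁ ∧ Matches P₂ w₂ V₂ ∧ w = w₁ ++ w₂ ∧ V = V₁.cat V₂ := by
  simp only [Matches, Pattern.matchesPair_atom_iff hP, and_assoc]

theorem assoc_concat (h₁ : Correct P₁ C H₁) {C₂ : Language α} (h₂ : Correct P₂ C₂ H₂)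
    {w₁ w₂ : List α} {ρ₁ : List (H₁.State × ℕ)} {ρ₂ : List (H₂.State × ℕ)}
    (hρ₁ : IsAcceptingRun H₁.A w₁ ρ₁) (hρ₂ : IsAcceptingRun H₂.A w₂ ρ₂) :
    (H₁.concat H₂).assoc (w₁ ++ w₂) (concatRun w₁.length ρ₁ ρ₂) =
      (H₁.assoc w₁ ρ₁).cat (H₂.assoc w₂ ρ₂) := by
  funext n
  match n with
  | [] =>
    simp only [Assoc.cat, h₁.assoc_nil hρ₁, h₂.assoc_nil hρ₂]
    exact (isAcceptingRun_concat.2 ⟨w₁, w₂, ρ₁, ρ₂, rfl, hρ₁, hρ₂, rfl⟩).subword_univ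
  | Dir.one :: n => exact subword_bound_append_left hρ₁.positions_le (positions_concatRun_inl _ _ _ _)
  | Dir.two :: n =>
    exact subword_bound_append_right hρ₂.positions_le (positions_concatRun_inr _ _ _ _)

theorem reach_concat_inr {σ τ : Type} {A : εNFA α σ} {B : εNFA α τ} {q : τ} {y : σ ⊕ τ}
    (h : Reach (A.concat B) (Sum.inr q) y) : ∃ q', y = Sum.inr q' := by
  induction h with
  | refl => exact ⟨q, rfl⟩
  | tail _ hs ih =>
    obtain ⟨q', rfl⟩ := ih
    obtain ⟨x, q'', -, rfl⟩ := hs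
    exact ⟨q'', rfl⟩

/-- A matched word of either quotient context is completed to a matched word of `C` by a word of the
other operand, so the types of the nodes are those of the components. -/
theorem Correct.catAtom (hP : P₁.IsAtom) (h₁ : Correct P₁ (rightQuot C P₂.lang) H₁)
    (h₂ : Correct P₂ (leftQuot P₁.lang C) H₂) : Correct (P₁.cat P₂) C (H₁.concat H₂) where
  f_nil := rfl
  f_empty n hn := by
    rcases n with _ | ⟨_ | _, n⟩
    · exact (hn trivial).elim
    · exact (congrArg _ (h₁.f_empty n hn)).trans (StateTriple.map_empty _)
    · exact (congrArg _ (h₂.f_empty n hn)).trans (StateTriple.map_empty _)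
  start_sub n := by
    rcases n with _ | ⟨_ | _, n⟩
    · exact Set.subset_univ _
    · exact Set.image_mono (h₁.start_sub n)
    · exact Set.image_mono (h₂.start_sub n)
  final_sub n := by
    rcases n with _ | ⟨_ | _, n⟩
    · exact Set.subset_univ _
    · exact Set.image_mono (h₁.final_sub n)
    · exact Set.image_mono (h₂.final_sub n)
  langAt_cons d n := by
    ext u
    simp only [mem_typeOf, matches_atomCat_iff hP]
    rcases d with _ | _
    · have hr : u ∈ (H₁.concat H₂).langAt (Dir.one :: n) ↔ u ∈ H₁.langAt n := by
        rw [mem_langAt, mem_langAt]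
        refine (exists_congr fun ρ => isRun_concat_inl).trans ⟨?_, ?_⟩
        · rintro ⟨_, ρ, -, h⟩
          exact ⟨ρ, h⟩
        · rintro ⟨ρ, h⟩
          exact ⟨_, ρ, rfl, h⟩
      rw [hr, h₁.langAt, mem_typeOf]
      constructor
      · rintro ⟨w₁, V₁, ⟨⟨w₂, h, hw⟩, hV₁⟩, hu⟩
        obtain ⟨V₂, hV₂⟩ := ((Pattern.matchSpec _).mem _).2 h
        exact ⟨_, V₁.cat V₂, ⟨hw, _, _, _, _, hV₁, hV₂, rfl, rfl⟩, hu⟩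
      · rintro ⟨_, _, ⟨hw, w₁, w₂, V₁, V₂, hV₁, hV₂, rfl, rfl⟩, hu⟩
        exact ⟨w₁, V₁, ⟨⟨w₂, ((Pattern.matchSpec _).mem _).1 ⟨_, hV₂⟩, hw⟩, hV₁⟩, hu⟩
    · have hr : u ∈ (H₁.concat H₂).langAt (Dir.two :: n) ↔ u ∈ H₂.langAt n := by
        rw [mem_langAt, mem_langAt]
        refine (exists_congr fun ρ => isRun_concat_inr).trans ⟨?_, ?_⟩
        · rintro ⟨_, ρ, -, h⟩
          exact ⟨ρ, h⟩
        · rintro ⟨ρ, h⟩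
          exact ⟨_, ρ, rfl, h⟩
      rw [hr, h₂.langAt, mem_typeOf]
      constructor
      · rintro ⟨w₂, V₂, ⟨⟨w₁, h, hw⟩, hV₂⟩, hu⟩
        obtain ⟨V₁, hV₁⟩ := ((Pattern.matchSpec _).mem _).2 h
        exact ⟨_, V₁.cat V₂, ⟨hw, _, _, _, _, hV₁, hV₂, rfl, rfl⟩, hu⟩
      · rintro ⟨_, _, ⟨hw, w₁, w₂, V₁, V₂, hV₁, hV₂, rfl, rfl⟩, hu⟩
        exact ⟨w₂, V₂, ⟨⟨w₁, ((Pattern.matchSpec _).mem _).1 ⟨_, hV₁⟩, hw⟩, hV₂⟩, hu⟩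
  unambiguous w ρ ρ' h h' := by
    obtain ⟨w₁, w₂, ρ₁, ρ₂, rfl, hρ₁, hρ₂, rfl⟩ := isAcceptingRun_concat.1 h
    obtain ⟨w₁', w₂', ρ₁', ρ₂', hw, hρ₁', hρ₂', rfl⟩ := isAcceptingRun_concat.1 h'
    obtain rfl := hP.eq_of_mem (h₁.mem_lang hρ₁) (h₁.mem_lang hρ₁')
    obtain rfl := List.append_cancel_left hw
    rw [h₁.unambiguous _ _ _ hρ₁ hρ₁', h₂.unambiguous _ _ _ hρ₂ hρ₂']
  matches_iff w V := by
    rw [matches_atomCat_iff hP]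
    constructor
    · rintro ⟨hw, w₁, w₂, V₁, V₂, hV₁, hV₂, rfl, rfl⟩
      obtain ⟨ρ₁, hρ₁, rfl⟩ := (h₁.matches_iff w₁ V₁).1
        ⟨⟨w₂, ((Pattern.matchSpec _).mem _).1 ⟨_, hV₂⟩, hw⟩, hV₁⟩
      obtain ⟨ρ₂, hρ₂, rfl⟩ := (h₂.matches_iff w₂ V₂).1
        ⟨⟨w₁, ((Pattern.matchSpec _).mem _).1 ⟨_, hV₁⟩, hw⟩, hV₂⟩
      exact ⟨_, isAcceptingRun_concat.2 ⟨w₁, w₂, ρ₁, ρ₂, rfl, hρ₁, hρ₂, rfl⟩,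
        (assoc_concat h₁ h₂ hρ₁ hρ₂).symm⟩
    · rintro ⟨_, h, rfl⟩
      obtain ⟨w₁, w₂, ρ₁, ρ₂, rfl, hρ₁, hρ₂, rfl⟩ := isAcceptingRun_concat.1 h
      have hm₁ := h₁.mem_of_isAcceptingRun hρ₁
      obtain ⟨⟨u, hu, hw⟩, hm₂⟩ := h₂.mem_of_isAcceptingRun hρ₂
      -- The left quotient provides some prefix `u` of the atom that completes `w₂`; it has to be
      -- the prefix that was read.
      obtain rfl := hP.eq_of_mem hu (h₁.mem_lang hρ₁)
      exact ⟨hw, _, _, _, _, hm₁.2, hm₂, rfl, assoc_concat h₁ h₂ hρ₁ hρ₂⟩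
  cat n hn := by
    rcases n with _ | ⟨_ | _, n⟩
    · have e₁ := h₁.f_nil
      have e₂ := h₂.f_nil
      refine ⟨Set.subset_univ _, Set.subset_univ _, ?_, ?_, ?_, ?_⟩
      · rintro _ ⟨q, -, rfl⟩ y hr ⟨q', -, rfl⟩
        obtain ⟨_, ⟨⟩⟩ := reach_concat_inr hr
      · exact (congrArg (fun t => (StateTriple.map Sum.inl t).I) e₁).ge
      · exact (congrArg (fun t => (StateTriple.map Sum.inr t).F) e₂).ge
      · intro w ρ hρ _
        obtain ⟨w₁, w₂, ρ₁, ρ₂, rfl, hρ₁, hρ₂, rfl⟩ := isAcceptingRun_concat.1 hρ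
        obtain ⟨-, -, q, hq, hl⟩ := hρ₁
        obtain ⟨-, ⟨q', hq', hh⟩, -⟩ := hρ₂
        -- The last state of the first run and the first state of the second one share the position
        -- `|w₁|`, as the connecting move reads nothing.
        refine ⟨Sum.inl q, Sum.inr q', w₁.length, ?_, ?_, ?_⟩
        · rw [concatRun]
          refine List.Sublist.append (l₁ := [_]) (r₁ := [_]) ?_ ?_
          · exact List.singleton_sublist.2 (List.mem_map.2 ⟨_, List.mem_of_getLast? hl, rfl⟩)
          · exact List.singleton_sublist.2
              (List.mem_map.2 ⟨_, List.mem_map.2 ⟨_, List.mem_of_head? hh, rfl⟩, Prod.ext rfl (Nat.zero_add _)⟩)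
        · exact ⟨q, by rw [e₁]; exact hq, rfl⟩
        · exact ⟨q', by rw [e₂]; exact hq', rfl⟩
    · exact (hP.isBase.not_isCatNode n hn).elim
    · exact (h₂.cat n hn).concat_inr

end Correct

/-! ### Concatenations with a repetition -/

section CorrectStar

variable {α : Type}

theorem boxWord_inj {p p' s s' : List α} (h : boxWord p s = boxWord p' s') : p = p' ∧ s = s' := by
  induction p generalizing p' with
  | nil =>
    cases p' with
    | nil => simpa [boxWord, List.map_inj_right (Option.some_injective α)] using h
    | cons a p' => simp [boxWord] at h
  | cons a p ih =>
    cases p' with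
    | nil => simp [boxWord] at h
    | cons b p' =>
      simp only [boxWord, List.map_cons, List.cons_append, List.cons.injEq, Option.some.injEq] at h
      obtain ⟨rfl, rfl⟩ := ih h.2
      exact ⟨by rw [h.1], rfl⟩

theorem boxWord_mem_starI {P₁ P₂ : Pattern α} {C : Language α} {p s : List α} :
    boxWord p s ∈ starI P₁ P₂ C ↔ StarSplit P₁ P₂ C p s := by
  constructor
  · rintro ⟨p', s', h, hs⟩
    obtain ⟨rfl, rfl⟩ := boxWord_inj h
    exact hs
  · exact fun h => ⟨p, s, rfl, h⟩

/-- The triples of the nodes leave the component of `AI` arbitrary at both ends, so it imposes no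
condition on the runs between them. -/
theorem exists_isRun_track_iff {σ τ : Type} {A : εNFA α σ} {D : DFA (Boxed α) τ} {I F : Set σ}
    {w : List α} : (∃ ρ, IsRun (A.track D) (I ×ˢ Set.univ) (F ×ˢ Set.univ) w ρ) ↔
      ∃ ρ, IsRun A I F w ρ := by
  constructor
  · rintro ⟨ρ, h₁, ⟨⟨q, r⟩, ⟨hq, -⟩, h₂⟩, h₃⟩
    obtain ⟨ρ', -, h, -⟩ := track_isRun_iff.1
      (show IsRun (A.track D) (I ×ˢ {r}) (F ×ˢ Set.univ) w ρ from ⟨h₁, ⟨_, ⟨hq, rfl⟩, h₂⟩, h₃⟩)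
    exact ⟨ρ', h⟩
  · rintro ⟨ρ, h⟩
    exact ⟨_, ((track_isRun_iff (r := D.start) (T := Set.univ)).2 ⟨ρ, rfl, h, trivial⟩).mono
      (Set.prod_mono le_rfl (Set.subset_univ _)) le_rfl⟩

theorem StateTriple.timesAll_empty (σ τ : Type) :
    (StateTriple.empty : StateTriple σ).timesAll τ = StateTriple.empty := by
  simp [StateTriple.timesAll, StateTriple.empty]

variable {σ τ : Type}

theorem image_starLeft {ν : Type} (S : Set σ) :
    ((Sum.inl '' S : Set (σ ⊕ (BoxState ⊕ ν))) ×ˢ (Set.univ : Set τ)) =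
      starLeft '' (S ×ˢ Set.univ) := by
  ext ⟨q, r⟩
  simp [starLeft]

theorem image_starRight {ν : Type} (S : Set ν) :
    (((fun q => Sum.inr (Sum.inr q)) '' S : Set (σ ⊕ (BoxState ⊕ ν))) ×ˢ (Set.univ : Set τ)) =
      starRight '' (S ×ˢ Set.univ) := by
  ext ⟨q, r⟩
  simp [starRight]

theorem reach_starAut_inr {ν : Type} {AT : DFA α σ} {AI : DFA (Boxed α) τ} {A₂ : εNFA α ν}
    {q : BoxState ⊕ ν} {r : τ} {y : (σ ⊕ (BoxState ⊕ ν)) × τ}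
    (h : Reach (Hyperautomaton.starAut AT AI A₂) (Sum.inr q, r) y) :
    ∃ q' r', y = (Sum.inr q', r') := by
  induction h with
  | refl => exact ⟨_, _, rfl⟩
  | tail _ hs ih =>
    obtain ⟨q', r', rfl⟩ := ih
    obtain ⟨x, hx⟩ := hs
    exact starAut_step_inr hx

variable [Finite σ] [Finite τ] {AT : DFA α σ} {AI : DFA (Boxed α) τ} {H₂ : Hyperautomaton α}
  {P₁ P₂ : Pattern α} {C : Language α}

theorem mem_langAt_starConcat_one {u : List α} :
    u ∈ (Hyperautomaton.starConcat AT AI H₂).langAt [Dir.one] ↔ u ∈ AT.accepts := by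
  rw [← exists_toLoopNFA_iff, mem_langAt]
  refine Iff.trans ?_ (exists_isRun_track_iff (D := AI))
  change (∃ ρ, IsRun (Hyperautomaton.starAut AT AI H₂.A)
    ((Sum.inl '' AT.toLoopNFA.start) ×ˢ Set.univ) ((Sum.inl '' AT.toLoopNFA.accept) ×ˢ Set.univ)
    u ρ) ↔ _
  rw [image_starLeft, image_starLeft]
  refine (exists_congr fun ρ => isRun_starAut_left).trans ⟨?_, ?_⟩
  · rintro ⟨_, ρ, -, h⟩
    exact ⟨ρ, h⟩
  · rintro ⟨ρ, h⟩
    exact ⟨_, ρ, rfl, h⟩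

theorem mem_langAt_starConcat_two {u : List α} {n : Node} :
    u ∈ (Hyperautomaton.starConcat AT AI H₂).langAt (Dir.two :: n) ↔ u ∈ H₂.langAt n := by
  rw [mem_langAt, mem_langAt]
  refine Iff.trans ?_ (exists_isRun_track_iff (D := AI))
  change (∃ ρ, IsRun (Hyperautomaton.starAut AT AI H₂.A)
    (((fun q => Sum.inr (Sum.inr q)) '' (H₂.f n).I) ×ˢ Set.univ)
    (((fun q => Sum.inr (Sum.inr q)) '' (H₂.f n).F) ×ˢ Set.univ) u ρ) ↔ _
  rw [image_starRight, image_starRight]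
  refine (exists_congr fun ρ => isRun_starAut_right).trans ⟨?_, ?_⟩
  · rintro ⟨_, ρ, -, h⟩
    exact ⟨ρ, h⟩
  · rintro ⟨ρ, h⟩
    exact ⟨_, ρ, rfl, h⟩

theorem assoc_starConcat {C₂ : Language α} (h₂ : Correct P₂ C₂ H₂) {p s : List α}
    {ρ₁ : List (σ × ℕ)} {ρ₂ : List (H₂.State × ℕ)} (hρ₁ : IsAcceptingRun AT.toLoopNFA p ρ₁)
    (hρ₂ : IsAcceptingRun H₂.A s ρ₂) (hb : boxWord p s ∈ AI.accepts) :
    (Hyperautomaton.starConcat AT AI H₂).assoc (p ++ s) (starRun AI p s ρ₁ ρ₂) =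
      (Assoc.single p).cat (H₂.assoc s ρ₂) := by
  funext n
  match n with
  | [] =>
    simp only [Assoc.cat, Assoc.single, h₂.assoc_nil hρ₂]
    exact (isAcceptingRun_starAut.2 ⟨p, s, ρ₁, ρ₂, rfl, hρ₁, hρ₂, hb, rfl⟩).subword_univ
  | [Dir.one] =>
    exact (subword_bound_append_left hρ₁.positions_le
      (positions_starRun_left p s ρ₁ ρ₂ Set.univ)).trans hρ₁.subword_univ
  | Dir.one :: _ :: _ => exact subword_bound_eq_none fun ⟨_, _, hq, _⟩ => hq
  | Dir.two :: n =>
    exact subword_bound_append_right hρ₂.positions_le (positions_starRun_right p s ρ₁ ρ₂ _)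

/-- For accepting runs `AI` alone selects the split, and uniqueness of the longest-match split gives
unambiguity. The exact languages `T₁` and `C₂` matter for the types, because a run inside one
component is not checked by `AI`. -/
theorem Correct.catStar (hT : AT.accepts = starT P₁ P₂ C) (hI : AI.accepts = starI P₁ P₂ C)
    (h₂ : Correct P₂ (starC P₁ P₂ C) H₂) :
    Correct (P₁.star.cat P₂) C (Hyperautomaton.starConcat AT AI H₂) where
  f_nil := rfl
  f_empty n hn := by
    match n with
    | [] => exact (hn trivial).elim
    | [Dir.one] => exact (hn trivial).elim
    | Dir.one :: _ :: _ => rfl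
    | Dir.two :: n =>
      change ((H₂.f n).map _).timesAll τ = _
      rw [h₂.f_empty n hn, StateTriple.map_empty, StateTriple.timesAll_empty]
      rfl
  start_sub n := by
    match n with
    | [] => exact Set.subset_univ _
    | [Dir.one] => exact Set.prod_mono (Set.image_mono (Set.subset_univ _)) le_rfl
    | Dir.one :: _ :: _ => exact le_rfl
    | Dir.two :: n => exact Set.prod_mono (Set.image_mono (h₂.start_sub n)) le_rfl
  final_sub n := by
    match n with
    | [] => exact Set.subset_univ _
    | [Dir.one] => exact Set.prod_mono (Set.image_mono (Set.subset_univ _)) le_rfl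
    | Dir.one :: _ :: _ => exact le_rfl
    | Dir.two :: n => exact Set.prod_mono (Set.image_mono (h₂.final_sub n)) le_rfl
  langAt_cons d n := by
    ext u
    simp only [mem_typeOf, Pattern.matches_starCat_iff]
    match d, n with
    | .one, [] =>
      rw [mem_langAt_starConcat_one, hT]
      constructor
      · rintro ⟨s, hs⟩
        obtain ⟨V, hV⟩ := ((Pattern.matchSpec _).mem s).2 hs.2.2.1
        exact ⟨_, _, ⟨u, s, V, rfl, hs, hV, rfl⟩, rfl⟩
      · rintro ⟨_, _, ⟨p, s, V, rfl, hs, hV, rfl⟩, ⟨⟩⟩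
        exact ⟨s, hs⟩
    | .one, _ :: _ =>
      refine iff_of_false ?_ ?_
      · rintro ⟨ρ, -, ⟨q, hq, -⟩, -⟩
        exact hq
      · rintro ⟨_, _, ⟨p, s, V, rfl, hs, hV, rfl⟩, ⟨⟩⟩
    | .two, n =>
      rw [mem_langAt_starConcat_two, h₂.langAt, mem_typeOf]
      constructor
      · rintro ⟨s, V, ⟨⟨p, hs⟩, hV⟩, hu⟩
        exact ⟨_, _, ⟨p, s, V, rfl, hs, hV, rfl⟩, hu⟩
      · rintro ⟨_, _, ⟨p, s, V, rfl, hs, hV, rfl⟩, hu⟩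
        exact ⟨s, V, ⟨⟨p, hs⟩, hV⟩, hu⟩
  unambiguous w ρ ρ' h h' := by
    obtain ⟨p, s, ρ₁, ρ₂, rfl, hρ₁, hρ₂, hb, rfl⟩ := isAcceptingRun_starAut.1 h
    obtain ⟨p', s', ρ₁', ρ₂', hw, hρ₁', hρ₂', hb', rfl⟩ := isAcceptingRun_starAut.1 h'
    rw [hI, boxWord_mem_starI] at hb hb'
    obtain ⟨rfl, rfl⟩ := Pattern.starSplit_unique hb hb' hw
    rw [toLoopNFA_unique hρ₁ hρ₁', h₂.unambiguous _ _ _ hρ₂ hρ₂']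
  matches_iff w V := by
    rw [Pattern.matches_starCat_iff]
    constructor
    · rintro ⟨p, s, V, rfl, hs, hV, rfl⟩
      obtain ⟨ρ₁, hρ₁⟩ := exists_toLoopNFA_iff.2 (show p ∈ AT.accepts from hT ▸ ⟨s, hs⟩)
      obtain ⟨ρ₂, hρ₂, rfl⟩ := (h₂.matches_iff s V).1 ⟨⟨p, hs⟩, hV⟩
      have hb : boxWord p s ∈ AI.accepts := hI ▸ boxWord_mem_starI.2 hs
      exact ⟨_, isAcceptingRun_starAut.2 ⟨p, s, ρ₁, ρ₂, rfl, hρ₁, hρ₂, hb, rfl⟩,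
        (assoc_starConcat h₂ hρ₁ hρ₂ hb).symm⟩
    · rintro ⟨_, h, rfl⟩
      obtain ⟨p, s, ρ₁, ρ₂, rfl, hρ₁, hρ₂, hb, rfl⟩ := isAcceptingRun_starAut.1 h
      exact ⟨p, s, _, rfl, boxWord_mem_starI.1 (hI ▸ hb), (h₂.mem_of_isAcceptingRun hρ₂).2,
        assoc_starConcat h₂ hρ₁ hρ₂ hb⟩
  cat n hn := by
    match n, hn with
    | [], _ =>
      have e₂ := h₂.f_nil
      refine ⟨Set.subset_univ _, Set.subset_univ _, ?_, ?_, ?_, ?_⟩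
      · rintro ⟨_, r⟩ ⟨⟨q, -, rfl⟩, -⟩ y hr ⟨⟨q', -, hq'⟩, -⟩
        obtain ⟨_, _, rfl⟩ := reach_starAut_inr hr
        cases hq'
      · change (Hyperautomaton.starAut AT AI H₂.A).start ⊆
          (Sum.inl '' AT.toLoopNFA.start) ×ˢ Set.univ
        rw [image_starLeft, starAut_start]
        exact Set.image_mono (Set.prod_mono le_rfl (Set.subset_univ _))
      · change (Hyperautomaton.starAut AT AI H₂.A).accept ⊆
          ((fun q => Sum.inr (Sum.inr q)) '' (H₂.f []).F) ×ˢ Set.univ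
        rw [image_starRight, starAut_accept, e₂]
        exact Set.image_mono (Set.prod_mono le_rfl (Set.subset_univ _))
      · intro w ρ hρ _
        obtain ⟨p, s, ρ₁, ρ₂, rfl, hρ₁, hρ₂, -, rfl⟩ := isAcceptingRun_starAut.1 hρ
        obtain ⟨-, -, q, hq, hl⟩ := hρ₁
        obtain ⟨-, ⟨q', hq', hh⟩, -⟩ := hρ₂
        refine ⟨starLeft (q, AI.evalFrom AI.start ((p.take p.length).map some)),
          starRight (q', AI.evalFrom (AI.step (AI.evalFrom AI.start (p.map some)) none)
            ((s.take 0).map some)), p.length, ?_, ⟨⟨q, hq, rfl⟩, trivial⟩, ?_⟩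
        · refine List.Sublist.append (l₁ := [_]) (r₁ := [_]) ?_ ?_
          · exact List.singleton_sublist.2 (List.mem_map.2 ⟨_, List.mem_map.2
              ⟨_, List.mem_of_getLast? hl, rfl⟩, rfl⟩)
          · refine List.singleton_sublist.2 (List.mem_map.2 ⟨_, List.mem_cons_of_mem _
              (List.mem_cons_of_mem _ (List.mem_map.2 ⟨_, List.mem_map.2
                ⟨_, List.mem_of_head? hh, rfl⟩, rfl⟩)), Prod.ext rfl (Nat.zero_add _)⟩)
        · exact ⟨⟨q', (congrArg StateTriple.I e₂).ge hq', rfl⟩, trivial⟩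
    | Dir.one :: n, hn =>
      exact (Pattern.IsBase.not_isCatNode (.inr (.inr ⟨P₁, rfl⟩)) n hn).elim
    | Dir.two :: n, hn => exact (h₂.cat n hn).starAut

end CorrectStar

/-! ### Reassociation -/

section Reassoc

variable {α : Type}

/-- Prolongs a chain at its beginning and keeps all its members, so that prescribed states remain
visited when runs are assembled piece by piece. -/
theorem exists_isChain_of_reflTransGen {β : Type} {R : β → β → Prop} {x y : β} {l : List β}
    (h : Relation.ReflTransGen R x y) (hl : l.IsChain R) (hy : l.head? = some y) :
    ∃ l', l'.IsChain R ∧ l'.head? = some x ∧ l'.getLast? = l.getLast? ∧ l ⊆ l' := by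
  induction h using Relation.ReflTransGen.head_induction_on with
  | refl => exact ⟨l, hl, hy, rfl, fun _ => id⟩
  | @head a b hab _ ih =>
    obtain ⟨l', h₁, h₂, h₃, h₄⟩ := ih
    cases l' with
    | nil => cases h₂
    | cons b' l' =>
      obtain rfl : b' = b := by simpa using h₂
      exact ⟨a :: b' :: l', List.isChain_cons_cons.2 ⟨hab, h₁⟩, rfl, by
        rw [List.getLast?_cons_cons, h₃], fun z hz => List.mem_cons_of_mem _ (h₄ hz)⟩

section

variable {σ : Type} {A : εNFA α σ} {q q' : σ}

theorem EpsReach.reflTransGen_runStep (h : EpsReach A q q') (w : List α) (k : ℕ) :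
    Relation.ReflTransGen (RunStep A w) (q, k) (q', k) := by
  induction h with
  | refl => exact .refl
  | @tail y z _ hs ih =>
    by_cases hyz : y = z
    · exact hyz ▸ ih
    · exact ih.tail (.inr ⟨hs, rfl, hyz⟩)

/-- A path in the automaton spells a word `v`, which is collected letter by letter; loops labeled λ
are dropped, as they are no moves. -/
theorem Reach.exists_reflTransGen_runStep (h : Reach A q q') (u : List α) :
    ∃ v, Relation.ReflTransGen (RunStep A (u ++ v)) (q, u.length) (q', (u ++ v).length) := by
  induction h with
  | refl => exact ⟨[], by rw [List.append_nil]⟩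
  | @tail y z _ hs ih =>
    obtain ⟨v, hv⟩ := ih
    obtain ⟨_ | a, hs⟩ := hs
    · refine ⟨v, hv.trans ?_⟩
      exact EpsReach.reflTransGen_runStep (.single hs) _ _
    · refine ⟨v ++ [a], .tail (b := (y, (u ++ v).length)) ?_ (.inl ⟨a, ?_, hs, ?_⟩)⟩
      · rw [← List.append_assoc]
        exact Relation.ReflTransGen.mono (fun _ _ h => h.append) _ _ hv
      · rw [← List.append_assoc]
        simp
      · simp
        omega

theorem reflTransGen_runStep_of_append {u w : List α} {x y : σ × ℕ}
    (h : Relation.ReflTransGen (RunStep A (u ++ w)) x y) (hy : y.2 ≤ u.length) :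
    Relation.ReflTransGen (RunStep A u) x y := by
  induction h with
  | refl => exact .refl
  | tail _ hs ih => exact (ih (hs.pos_le.trans hy)).tail (hs.of_append hy)

end

variable {P₁ P₂ P₃ : Pattern α} {C : Language α} {H : Hyperautomaton α}

theorem Correct.start_sub_one {P Q : Pattern α} (h : Correct (P.cat Q) C H) :
    H.A.start ⊆ (H.f [Dir.one]).I := by
  have := (h.cat [] trivial).start_sub
  rwa [h.f_nil] at this

/-- The positions at which an accepting run passes from `P₁` to `P₂` and from `P₂` to `P₃`. -/
theorem Correct.exists_switches (h : Correct (P₁.cat (P₂.cat P₃)) C H) {w : List α}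
    {ρ : List (H.State × ℕ)} (hρ : IsAcceptingRun H.A w ρ) :
    ∃ k₀ k₁, k₀ ≤ k₁ ∧ k₁ ≤ w.length ∧
      (IsLeast (positions ρ (H.f [Dir.one]).Q) 0 ∧
        IsGreatest (positions ρ (H.f [Dir.one]).Q) k₀) ∧
      (IsLeast (positions ρ (H.f [Dir.two, Dir.one]).Q) k₀ ∧
        IsGreatest (positions ρ (H.f [Dir.two, Dir.one]).Q) k₁) ∧
      ∃ q q', [(q, k₁), (q', k₁)].Sublist ρ ∧ q ∈ H.reassocTriple.F ∧
        q' ∈ (H.f [Dir.two, Dir.two]).I := by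
  have c := h.cat [] trivial
  have c' := h.cat [Dir.two] trivial
  have hne : (positions ρ (H.f []).Q).Nonempty := by
    obtain ⟨-, ⟨q, -, hq⟩, -⟩ := hρ
    exact ⟨0, q, by rw [h.Q_nil]; trivial, List.mem_of_head? hq⟩
  obtain ⟨q₀, q₀', k₀, hs₀, hq₀, hq₀'⟩ := c.switch w ρ hρ hne
  have hm₀ := hs₀.subset (List.mem_cons_self)
  have hm₀' : (q₀', k₀) ∈ ρ := hs₀.subset (by simp)
  obtain ⟨q₁, q₁', k₁, hs₁, hq₁, hq₁'⟩ :=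
    c'.switch w ρ hρ ⟨k₀, q₀', h.start_sub _ hq₀', hm₀'⟩
  have hm₁ := hs₁.subset (List.mem_cons_self)
  have hm₁' : (q₁', k₁) ∈ ρ := hs₁.subset (by simp)
  obtain ⟨g₀, l₀⟩ := c.isGreatest_isLeast (h.final_sub _) (h.start_sub _) hρ hm₀ hm₀' hq₀ hq₀'
  obtain ⟨g₁, -⟩ := c'.isGreatest_isLeast (h.final_sub _) (h.start_sub _) hρ hm₁ hm₁' hq₁ hq₁'
  -- The state `q₀'` entered at the first switch is initial for node `2`, hence for node `21`; and
  -- node `21` is visited only when node `2` is.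
  have l₁ : IsLeast (positions ρ (H.f [Dir.two, Dir.one]).Q) k₀ :=
    ⟨⟨q₀', h.start_sub _ (c'.start_sub hq₀'), hm₀'⟩, fun j hj =>
      l₀.2 (positions_mono c'.sub_left hj)⟩
  refine ⟨k₀, k₁, l₁.2 g₁.1, hρ.positions_le _ g₁.1,
    ⟨hρ.isLeast (h.start_sub_one.trans (h.start_sub _)), g₀⟩, ⟨l₁, g₁⟩, q₁, q₁', hs₁,
    ⟨hq₁, q₁', hq₁', ?_, ?_⟩, hq₁'⟩
  -- In the run `q₁` precedes `q₁'` at the same position, so only λ-moves lie between them; this is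
  -- the condition in the definition of `F₁`.
  · have := (List.pairwise_iff_forall_sublist.1 hρ.1.pairwise_reflTransGen) hs₁
    exact reflTransGen_runStep_epsReach this rfl
  · obtain ⟨h₁, -, q, hq, hl⟩ := hρ
    exact ⟨q, hq, reflTransGen_runStep_reach (h₁.reflTransGen_getLast hl hm₁')⟩

theorem take_append_drop_take {i j : ℕ} {w : List α} (h : i ≤ j) :
    w.take i ++ (w.take j).drop i = w.take j := by
  have := List.take_append_drop i (w.take j)
  rwa [List.take_take, min_eq_left h] at this

theorem assoc_reassoc (h : Correct (P₁.cat (P₂.cat P₃)) C H) {w : List α}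
    {ρ : List (H.State × ℕ)} (hρ : IsAcceptingRun H.A w ρ) :
    H.reassoc.assoc w ρ = (H.assoc w ρ).reassoc := by
  funext n
  match n with
  | [] => rfl
  | [Dir.one] =>
    obtain ⟨k₀, k₁, hk, hk₁, ⟨l₀, g₀⟩, ⟨l₁, g₁⟩, -⟩ := h.exists_switches hρ
    have e₀ : H.assoc w ρ [Dir.one] = _ := subword_bound l₀ g₀ (hk.trans hk₁)
    have e₁ : H.assoc w ρ [Dir.two, Dir.one] = _ := subword_bound l₁ g₁ hk₁
    simp only [Assoc.reassoc, e₀, e₁]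
    have hu := positions_union (ρ := ρ) (H.f [Dir.one]).Q (H.f [Dir.two, Dir.one]).Q
    have l : IsLeast (positions ρ ((H.f [Dir.one]).Q ∪ (H.f [Dir.two, Dir.one]).Q)) 0 := by
      rw [hu]
      exact ⟨.inl l₀.1, fun _ _ => Nat.zero_le _⟩
    have g : IsGreatest (positions ρ ((H.f [Dir.one]).Q ∪ (H.f [Dir.two, Dir.one]).Q)) k₁ := by
      rw [hu]
      refine ⟨.inr g₁.1, ?_⟩
      rintro j (hj | hj)
      · exact (g₀.2 hj).trans hk
      · exact g₁.2 hj
    refine (subword_bound l g hk₁).trans ?_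
    rw [List.drop_zero, List.drop_zero, take_append_drop_take hk]
  | Dir.one :: Dir.one :: n => rfl
  | Dir.one :: Dir.two :: n => rfl
  | Dir.two :: n => rfl

theorem assoc_reassoc_one (h : Correct (P₁.cat (P₂.cat P₃)) C H) {w : List α}
    {ρ : List (H.State × ℕ)} (hρ : IsAcceptingRun H.A w ρ) {k : ℕ}
    (hk : IsGreatest (positions ρ (H.f [Dir.two, Dir.one]).Q) k) :
    H.reassoc.assoc w ρ [Dir.one] = some (w.take k) := by
  obtain ⟨k₀, k₁, hk₀, hk₁, ⟨l₀, g₀⟩, ⟨l₁, g₁⟩, -⟩ := h.exists_switches hρ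
  obtain rfl := hk.unique g₁
  have e₀ : H.assoc w ρ [Dir.one] = _ := subword_bound l₀ g₀ (hk₀.trans hk₁)
  have e₁ : H.assoc w ρ [Dir.two, Dir.one] = _ := subword_bound l₁ g₁ hk₁
  simp only [assoc_reassoc h hρ, Assoc.reassoc, e₀, e₁, List.drop_zero, Option.some.injEq]
  exact take_append_drop_take hk₀

/-- The two reachability conditions in `F₁` let a run on `u` that ends there be continued to an
accepting run on some `u ++ v`. It switches from node `21` to node `22` at `|u|`, so its value at
the new node is `u`. Conversely, an accepting run is truncated at its last visit of node `21`. -/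
theorem mem_langAt_reassoc_one (h : Correct (P₁.cat (P₂.cat P₃)) C H) {u : List α} :
    u ∈ H.reassoc.langAt [Dir.one] ↔
      ∃ w ρ, IsAcceptingRun H.A w ρ ∧ H.reassoc.assoc w ρ [Dir.one] = some u := by
  constructor
  · rintro ⟨π, hπ, ⟨q₀, hq₀, hh⟩, q, ⟨hq, q', hq', hr, q'', hq'', hr'⟩, hl⟩
    -- The accepting run is built from its end: a path on `v` from `q'` to a final state, the λ-path
    -- from `q` to `q'` in front of it, and the part on `u` in front of both.
    obtain ⟨v, hv⟩ := Reach.exists_reflTransGen_runStep hr' u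
    obtain ⟨l, h₁, h₂, h₃, h₄⟩ :=
      exists_isChain_of_reflTransGen hv (List.isChain_singleton _) rfl
    obtain ⟨l', h₁', h₂', h₃', h₄'⟩ := exists_isChain_of_reflTransGen
      (EpsReach.reflTransGen_runStep hr (u ++ v) u.length) h₁ h₂
    have hr₀ := hπ.reflTransGen_head hh (List.mem_of_getLast? hl)
    obtain ⟨ρ, h₁'', h₂'', h₃'', h₄''⟩ := exists_isChain_of_reflTransGen
      (Relation.ReflTransGen.mono (fun _ _ h => RunStep.append (u := v) h) _ _ hr₀) h₁' h₂'
    have hρ : IsAcceptingRun H.A (u ++ v) ρ :=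
      ⟨h₁'', ⟨q₀, hq₀.2, h₂''⟩, q'', hq'', h₃''.trans (h₃'.trans h₃)⟩
    have g := ((h.cat [Dir.two] trivial).isGreatest_isLeast (h.final_sub _) (h.start_sub _) hρ
      (h₄'' (List.mem_of_head? h₂')) (h₄'' (h₄' (List.mem_of_head? h₂))) hq hq').1
    exact ⟨u ++ v, ρ, hρ, by rw [assoc_reassoc_one h hρ g, List.take_left']; rfl⟩
  · rintro ⟨w, ρ, hρ, hu⟩
    obtain ⟨k₀, k, -, hk, -, ⟨-, g⟩, q, q', hs, hq, -⟩ := h.exists_switches hρ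
    rw [assoc_reassoc_one h hρ g] at hu
    cases hu
    obtain ⟨h₁, ⟨q₀, hq₀, hh⟩, -⟩ := hρ
    refine exists_isRun (A := H.A) (I := H.reassocTriple.I) (F := H.reassocTriple.F)
      ⟨.inl (h.start_sub _ (h.start_sub_one hq₀)), hq₀⟩ hq ?_
    have := h₁.reflTransGen_head hh (hs.subset List.mem_cons_self)
    rw [← List.take_append_drop k w] at this
    have hl : (w.take k).length = k := by simp [hk]
    rw [hl]
    exact reflTransGen_runStep_of_append this hl.ge

theorem Correct.reassoc (h : Correct (P₁.cat (P₂.cat P₃)) C H) :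
    Correct ((P₁.cat P₂).cat P₃) C H.reassoc where
  f_nil := h.f_nil
  f_empty n hn := by
    match n with
    | [] => exact (hn trivial).elim
    | [Dir.one] => exact (hn trivial).elim
    | Dir.one :: Dir.one :: n => exact h.f_empty (Dir.one :: n) hn
    | Dir.one :: Dir.two :: n => exact h.f_empty (Dir.two :: Dir.one :: n) hn
    | Dir.two :: n => exact h.f_empty (Dir.two :: Dir.two :: n) hn
  start_sub n := by
    match n with
    | [] => exact h.start_sub []
    | [Dir.one] => exact Set.inter_subset_left
    | Dir.one :: Dir.one :: n => exact h.start_sub (Dir.one :: n)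
    | Dir.one :: Dir.two :: n => exact h.start_sub (Dir.two :: Dir.one :: n)
    | Dir.two :: n => exact h.start_sub (Dir.two :: Dir.two :: n)
  final_sub n := by
    match n with
    | [] => exact h.final_sub []
    | [Dir.one] => exact fun q hq => .inr (h.final_sub _ hq.1)
    | Dir.one :: Dir.one :: n => exact h.final_sub (Dir.one :: n)
    | Dir.one :: Dir.two :: n => exact h.final_sub (Dir.two :: Dir.one :: n)
    | Dir.two :: n => exact h.final_sub (Dir.two :: Dir.two :: n)
  langAt_cons d n := by
    have key : ∀ u m m', (∀ V : Assoc α, V.reassoc m = V m') →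
        (u ∈ typeOf m ((P₁.cat P₂).cat P₃) C ↔ u ∈ typeOf m' (P₁.cat (P₂.cat P₃)) C) := by
      intro u m m' hm
      simp only [mem_typeOf, Pattern.matches_catCat_iff]
      constructor
      · rintro ⟨w, _, ⟨hw, V, hV, rfl⟩, hu⟩
        exact ⟨w, V, ⟨hw, hV⟩, hm V ▸ hu⟩
      · rintro ⟨w, V, ⟨hw, hV⟩, hu⟩
        exact ⟨w, _, ⟨hw, V, hV, rfl⟩, (hm V).trans hu⟩
    ext u
    match d, n with
    | .one, [] =>
      rw [mem_langAt_reassoc_one h]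
      simp only [mem_typeOf, Pattern.matches_catCat_iff]
      constructor
      · rintro ⟨w, ρ, hρ, hu⟩
        obtain ⟨hw, hm⟩ := h.mem_of_isAcceptingRun hρ
        exact ⟨w, _, ⟨hw, _, hm, rfl⟩, by rw [← assoc_reassoc h hρ, hu]⟩
      · rintro ⟨w, _, ⟨hw, V, hV, rfl⟩, hu⟩
        obtain ⟨ρ, hρ, rfl⟩ := (h.matches_iff w V).1 ⟨hw, hV⟩
        exact ⟨w, ρ, hρ, by rw [assoc_reassoc h hρ, hu]⟩
    | .one, .one :: n => rw [key u _ (Dir.one :: n) fun _ => rfl, ← h.langAt]; rfl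
    | .one, .two :: n => rw [key u _ (Dir.two :: Dir.one :: n) fun _ => rfl, ← h.langAt]; rfl
    | .two, n => rw [key u _ (Dir.two :: Dir.two :: n) fun _ => rfl, ← h.langAt]; rfl
  unambiguous := h.unambiguous
  matches_iff w V := by
    rw [Pattern.matches_catCat_iff]
    constructor
    · rintro ⟨hw, V, hV, rfl⟩
      obtain ⟨ρ, hρ, rfl⟩ := (h.matches_iff w V).1 ⟨hw, hV⟩
      exact ⟨ρ, hρ, (assoc_reassoc h hρ).symm⟩
    · rintro ⟨ρ, hρ, rfl⟩
      obtain ⟨hw, hm⟩ := h.mem_of_isAcceptingRun hρ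
      exact ⟨hw, _, hm, assoc_reassoc h hρ⟩
  cat n hn := by
    have c := h.cat [] trivial
    have c' := h.cat [Dir.two] trivial
    match n, hn with
    | [], _ =>
      refine ⟨?_, ?_, ?_, ?_, ?_, ?_⟩
      · exact h.Q_nil.symm ▸ Set.subset_univ _
      · exact h.Q_nil.symm ▸ Set.subset_univ _
      · rintro q hq q' hr (hq' | hq')
        · exact c.not_reach q (c'.sub_right hq) q' hr hq'
        · exact c'.not_reach q hq q' hr hq'
      · intro q hq
        have hq' : q ∈ H.A.start := by
          rw [show H.reassoc.f [] = H.f [] from rfl, h.f_nil] at hq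
          exact hq
        exact ⟨.inl (h.start_sub _ (h.start_sub_one hq')), hq'⟩
      · exact c.final_sub.trans c'.final_sub
      · intro w ρ hρ _
        obtain ⟨_, k, -, -, -, -, q, q', hs, hq, hq'⟩ := h.exists_switches hρ
        exact ⟨q, q', k, hs, hq, hq'⟩
    | [Dir.one], _ =>
      refine ⟨Set.subset_union_left, Set.subset_union_right, ?_, ?_, ?_, ?_⟩
      · exact fun q hq => c.not_reach q (c'.sub_left hq)
      · exact fun q hq => h.start_sub_one hq.2
      · exact fun q hq => hq.1
      · intro w ρ hρ _
        have hne : (positions ρ (H.f []).Q).Nonempty := by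
          obtain ⟨-, ⟨q, -, hq⟩, -⟩ := hρ
          exact ⟨0, q, by rw [h.Q_nil]; trivial, List.mem_of_head? hq⟩
        -- The switch of the old root is the switch of the new node `1`: an initial state of the old
        -- node `2` is one of the old node `21`.
        obtain ⟨q, q', k, hs, hq, hq'⟩ := c.switch w ρ hρ hne
        exact ⟨q, q', k, hs, hq, c'.start_sub hq'⟩
    | Dir.one :: Dir.one :: n, hn => exact h.cat (Dir.one :: n) hn
    | Dir.one :: Dir.two :: n, hn => exact h.cat (Dir.two :: Dir.one :: n) hn
    | Dir.two :: n, hn => exact h.cat (Dir.two :: Dir.two :: n) hn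

end Reassoc

/-! ### Distributivity -/

section Distrib

variable {α : Type} {P P₁ P₂ P₃ : Pattern α} {C : Language α} {H H₁ H₂ : Hyperautomaton α}

theorem assoc_distrib_inl (h₁ : Correct (P₁.cat P₃) C H₁) {w : List α}
    {ρ : List (H₁.State × ℕ)} (hρ : IsAcceptingRun H₁.A w ρ) :
    (H₁.alt H₂).distrib.assoc w (mapRun Sum.inl ρ) = (H₁.assoc w ρ).distribLeft := by
  have key : ∀ (S : Set H₁.State) (T : Set H₂.State),
      positions (mapRun Sum.inl ρ) (Sum.inl '' S ∪ Sum.inr '' T) = positions ρ S := by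
    intro S T
    rw [positions_mapRun, Set.preimage_union, Set.preimage_image_eq _ Sum.inl_injective,
      Set.preimage_inl_image_inr, Set.union_empty]
  funext n
  match n with
  | [] => exact (congrFun (assoc_alt_inl h₁ hρ) []).trans rfl
  | [Dir.one] => exact subword_bound_congr (key _ _)
  | Dir.one :: Dir.one :: n => exact congrFun (assoc_alt_inl h₁ hρ) (Dir.one :: Dir.one :: n)
  | Dir.one :: Dir.two :: n => exact congrFun (assoc_alt_inl h₁ hρ) (Dir.two :: Dir.one :: n)
  | Dir.two :: n => exact subword_bound_congr (key _ _)

theorem assoc_distrib_inr {C₂ : Language α} (h₂ : Correct (P₂.cat P₃) C₂ H₂) {w : List α}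
    {ρ : List (H₂.State × ℕ)} (hρ : IsAcceptingRun H₂.A w ρ) :
    (H₁.alt H₂).distrib.assoc w (mapRun Sum.inr ρ) = (H₂.assoc w ρ).distribRight := by
  have key : ∀ (S : Set H₁.State) (T : Set H₂.State),
      positions (mapRun Sum.inr ρ) (Sum.inl '' S ∪ Sum.inr '' T) = positions ρ T := by
    intro S T
    rw [positions_mapRun, Set.preimage_union, Set.preimage_image_eq _ Sum.inr_injective,
      Set.preimage_inr_image_inl, Set.empty_union]
  funext n
  match n with
  | [] => exact (congrFun (assoc_alt_inr h₂ hρ) []).trans rfl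
  | [Dir.one] => exact subword_bound_congr (key _ _)
  | Dir.one :: Dir.one :: n => exact congrFun (assoc_alt_inr h₂ hρ) (Dir.one :: Dir.one :: n)
  | Dir.one :: Dir.two :: n => exact congrFun (assoc_alt_inr h₂ hρ) (Dir.two :: Dir.one :: n)
  | Dir.two :: n => exact subword_bound_congr (key _ _)

theorem mem_typeOf_catAlt {u : List α} {n : Node} :
    u ∈ typeOf n ((P₁.alt P₂).cat P₃) C ↔
      (∃ w V, (w ∈ C ∧ Matches (P₁.cat P₃) w V) ∧ V.distribLeft n = some u) ∨
      ∃ w V, (w ∈ C - (P₁.cat P₃).lang ∧ Matches (P₂.cat P₃) w V) ∧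
        V.distribRight n = some u := by
  simp only [mem_typeOf, Pattern.matches_catAlt_iff]
  constructor
  · rintro ⟨w, _, ⟨hw, ⟨V, hV, rfl⟩ | ⟨V, hV, hn, rfl⟩⟩, hu⟩
    · exact .inl ⟨w, V, ⟨hw, hV⟩, hu⟩
    · exact .inr ⟨w, V, ⟨⟨hw, mt ((Pattern.matchSpec _).mem w).2 hn⟩, hV⟩, hu⟩
  · rintro (⟨w, V, ⟨hw, hV⟩, hu⟩ | ⟨w, V, ⟨hw, hV⟩, hu⟩)
    · exact ⟨w, _, ⟨hw, .inl ⟨V, hV, rfl⟩⟩, hu⟩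
    · exact ⟨w, _, ⟨hw.1, .inr ⟨V, hV, mt ((Pattern.matchSpec _).mem w).1 hw.2, rfl⟩⟩, hu⟩

/-- Argues with the results for the two products and not with their sum, since each value or type at
a merged node has to be traced to one of the halves. -/
theorem Correct.distrib (h₁ : Correct (P₁.cat P₃) C H₁)
    (h₂ : Correct (P₂.cat P₃) (C - (P₁.cat P₃).lang) H₂) :
    Correct ((P₁.alt P₂).cat P₃) C (H₁.alt H₂).distrib where
  f_nil := rfl
  f_empty n hn := by
    have key : ∀ n, H₁.f n = .empty → H₂.f n = .empty →
        ((H₁.f n).map Sum.inl).union ((H₂.f n).map Sum.inr) = StateTriple.empty := by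
      intro n h₁ h₂
      rw [h₁, h₂, StateTriple.map_empty, StateTriple.map_empty]
      simp [StateTriple.union, StateTriple.empty]
    match n with
    | [] => exact (hn trivial).elim
    | [Dir.one] => exact (hn trivial).elim
    | Dir.one :: Dir.one :: n =>
      exact (congrArg _ (h₁.f_empty (Dir.one :: n) hn)).trans (StateTriple.map_empty _)
    | Dir.one :: Dir.two :: n =>
      exact (congrArg _ (h₂.f_empty (Dir.one :: n) hn)).trans (StateTriple.map_empty _)
    | Dir.two :: n =>
      exact key _ (h₁.f_empty (Dir.two :: n) hn) (h₂.f_empty (Dir.two :: n) hn)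
  start_sub n := by
    match n with
    | [] => exact Set.subset_univ _
    | [Dir.one] =>
      exact Set.union_subset_union (Set.image_mono (h₁.start_sub _))
          (Set.image_mono (h₂.start_sub _))
    | Dir.one :: Dir.one :: n => exact Set.image_mono (h₁.start_sub _)
    | Dir.one :: Dir.two :: n => exact Set.image_mono (h₂.start_sub _)
    | Dir.two :: n =>
      exact Set.union_subset_union (Set.image_mono (h₁.start_sub _))
          (Set.image_mono (h₂.start_sub _))
  final_sub n := by
    match n with
    | [] => exact Set.subset_univ _
    | [Dir.one] =>
      exact Set.union_subset_union (Set.image_mono (h₁.final_sub _))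
          (Set.image_mono (h₂.final_sub _))
    | Dir.one :: Dir.one :: n => exact Set.image_mono (h₁.final_sub _)
    | Dir.one :: Dir.two :: n => exact Set.image_mono (h₂.final_sub _)
    | Dir.two :: n =>
      exact Set.union_subset_union (Set.image_mono (h₁.final_sub _))
          (Set.image_mono (h₂.final_sub _))
  langAt_cons d n := by
    -- No run goes from one half to the other, so uniting initial and final states just unites the
    -- languages.
    have key : ∀ (u : List α) (n : Node), (∃ ρ, IsRun (H₁.A.disjUnion H₂.A)
        (Sum.inl '' (H₁.f n).I ∪ Sum.inr '' (H₂.f n).I)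
        (Sum.inl '' (H₁.f n).F ∪ Sum.inr '' (H₂.f n).F) u ρ) ↔
        u ∈ H₁.langAt n ∨ u ∈ H₂.langAt n := by
      intro u n
      simp only [isRun_disjUnion, mem_langAt]
      constructor
      · rintro ⟨_, ⟨ρ, -, h⟩ | ⟨ρ, -, h⟩⟩
        exacts [.inl ⟨ρ, h⟩, .inr ⟨ρ, h⟩]
      · rintro (⟨ρ, h⟩ | ⟨ρ, h⟩)
        exacts [⟨_, .inl ⟨ρ, rfl, h⟩⟩, ⟨_, .inr ⟨ρ, rfl, h⟩⟩]
    have no : ∀ {p : List α → Assoc α → Prop} {u : List α},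
        ¬ ∃ w V, p w V ∧ (none : Option (List α)) = some u := by
      rintro p u ⟨w, V, -, ⟨⟩⟩
    ext u
    rw [mem_typeOf_catAlt]
    match d, n with
    | .one, [] =>
      refine (key u [Dir.one]).trans ?_
      rw [h₁.langAt, h₂.langAt, mem_typeOf, mem_typeOf]
      rfl
    | .one, .one :: n =>
      refine mem_langAt_alt_one.trans ?_
      rw [h₁.langAt, mem_typeOf]
      exact (or_iff_left no).symm
    | .one, .two :: n =>
      refine (mem_langAt_alt_two (n := Dir.one :: n)).trans ?_
      rw [h₂.langAt, mem_typeOf]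
      exact (or_iff_right no).symm
    | .two, n =>
      refine (key u (Dir.two :: n)).trans ?_
      rw [h₁.langAt, h₂.langAt, mem_typeOf, mem_typeOf]
      rfl
  unambiguous w ρ ρ' h h' := unambiguous_alt h₁ h₂ h h'
  matches_iff w V := by
    rw [Pattern.matches_catAlt_iff]
    constructor
    · rintro ⟨hw, ⟨V, hV, rfl⟩ | ⟨V, hV, hn, rfl⟩⟩
      · obtain ⟨ρ, hρ, rfl⟩ := (h₁.matches_iff w V).1 ⟨hw, hV⟩
        exact ⟨_, isRun_disjUnion.2 (.inl ⟨ρ, rfl, hρ⟩), (assoc_distrib_inl h₁ hρ).symm⟩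
      · obtain ⟨ρ, hρ, rfl⟩ :=
          (h₂.matches_iff w V).1 ⟨⟨hw, mt ((Pattern.matchSpec _).mem w).2 hn⟩, hV⟩
        exact ⟨_, isRun_disjUnion.2 (.inr ⟨ρ, rfl, hρ⟩), (assoc_distrib_inr h₂ hρ).symm⟩
    · rintro ⟨_, h, rfl⟩
      obtain ⟨ρ, rfl, hρ⟩ | ⟨ρ, rfl, hρ⟩ := isRun_disjUnion.1 h
      · obtain ⟨hw, hm⟩ := h₁.mem_of_isAcceptingRun hρ
        exact ⟨hw, .inl ⟨_, hm, assoc_distrib_inl h₁ hρ⟩⟩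
      · obtain ⟨hw, hm⟩ := h₂.mem_of_isAcceptingRun hρ
        exact ⟨hw.1, .inr ⟨_, hm, mt ((Pattern.matchSpec _).mem w).1 hw.2,
          assoc_distrib_inr h₂ hρ⟩⟩
  cat n hn := by
    match n, hn with
    | [], _ =>
      have := (h₁.cat [] trivial).disjUnion (h₂.cat [] trivial)
      rw [h₁.f_nil, h₂.f_nil, ← ofAut_disjUnion] at this
      exact this
    | Dir.one :: Dir.one :: n, hn => exact (h₁.cat (Dir.one :: n) hn).disjUnion_inl
    | Dir.one :: Dir.two :: n, hn => exact (h₂.cat (Dir.one :: n) hn).disjUnion_inr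
    | Dir.two :: n, hn => exact (h₁.cat (Dir.two :: n) hn).disjUnion (h₂.cat (Dir.two :: n) hn)

/-- The second clause is needed for `catAlt`: correctness for the sum of the products does not
expose the two summands, while the derivation of the sum still contains their results. -/
theorem Computes.correct (h : Computes P C H) : Correct P C H ∧
    ∀ P₁ P₂ P₃, P = .alt (.cat P₁ P₃) (.cat P₂ P₃) →
      Correct (.cat (.alt P₁ P₂) P₃) C H.distrib := by
  induction h with
  | base M hP hM =>
    refine ⟨.base hP hM, ?_⟩
    rintro P₁ P₂ P₃ rfl
    obtain h | ⟨a, h⟩ | ⟨P', h⟩ := hP <;> cases h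
  | alt _ _ h₁ h₂ =>
    refine ⟨h₁.1.alt h₂.1, ?_⟩
    rintro P₁ P₂ P₃ ⟨⟩
    exact h₁.1.distrib h₂.1
  | catAtom hP _ _ h₁ h₂ => exact ⟨.catAtom hP h₁.1 h₂.1, nofun⟩
  | catStar AT AI hT hI _ h₂ => exact ⟨.catStar hT hI h₂.1, nofun⟩
  | catCat _ h => exact ⟨h.1.reassoc, nofun⟩
  | catAlt _ h => exact ⟨h.2 _ _ _ rfl, nofun⟩

end Distrib

/-! ### Regular languages -/

section Regular

variable {α : Type}

/-- A Myhill–Nerode argument: the values of `b` are the states, and compatibility with appending a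
letter gives the transitions. -/
theorem isRegular_of_snoc {X : Type} [Finite X] {L : Language α} (b : List α → X) (φ : X → Prop)
    (hb : ∀ s s' c, b s = b s' → b (s ++ [c]) = b (s' ++ [c])) (hL : ∀ s, s ∈ L ↔ φ (b s)) :
    L.IsRegular := by
  classical
  have := Fintype.ofFinite X
  -- A transition is computed from any word with the given value, which by `hb` does not depend on
  -- the choice; values that do not occur are never reached.
  let M : DFA α X := ⟨fun x c => if h : ∃ s, b s = x then b (h.choose ++ [c]) else x, b [], {x | φ x}⟩
  have hM : ∀ s, M.eval s = b s := by
    intro s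
    induction s using List.reverseRecOn with
    | nil => rfl
    | append_singleton s c ih =>
      rw [DFA.eval_append_singleton, ih]
      have h : ∃ s', b s' = b s := ⟨s, rfl⟩
      exact (dif_pos h).trans (hb _ _ c h.choose_spec)
  refine ⟨X, inferInstance, M, ?_⟩
  ext s
  rw [DFA.mem_accepts, hM, hL]
  rfl

theorem isRegular_of_cons {X : Type} [Finite X] {L : Language α} (b : List α → X) (φ : X → Prop)
    (hb : ∀ c s s', b s = b s' → b (c :: s) = b (c :: s')) (hL : ∀ s, s ∈ L ↔ φ (b s)) :
    L.IsRegular := by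
  refine .of_reverse (isRegular_of_snoc (fun s => b s.reverse) φ ?_ ?_)
  · intro s s' c h
    simpa using hb c _ _ h
  · intro s
    rw [Language.mem_reverse, hL]

namespace DFA

/-- The transformation of the states that is induced by a word. -/
def transform {σ : Type} (M : DFA α σ) (s : List α) : σ → σ := fun q => M.evalFrom q s

theorem transform_cons {σ : Type} (M : DFA α σ) (c : α) (s : List α) :
    M.transform (c :: s) = fun q => M.transform s (M.step q c) := rfl

theorem mem_accepts_iff_transform {σ : Type} {M : DFA α σ} {s : List α} :
    s ∈ M.accepts ↔ M.transform s M.start ∈ M.accept := Iff.rfl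

theorem append_mem_accepts_iff_transform {σ : Type} {M : DFA α σ} {p s : List α} :
    p ++ s ∈ M.accepts ↔ M.transform s (M.transform p M.start) ∈ M.accept := by
  rw [mem_accepts_iff_transform, transform, DFA.evalFrom_of_append]
  rfl

/-- The transformations induced by the prefixes of a word whose remainder is in `L`. -/
def prefixTransforms {σ : Type} (M : DFA α σ) (L : Language α) (s : List α) : Set (σ → σ) :=
  {g | ∃ u v, u ++ v = s ∧ v ∈ L ∧ g = M.transform u}

/-- The transformations induced by the nonempty prefixes of a word whose remainder is in `L`. -/
def properPrefixTransforms {σ : Type} (M : DFA α σ) (L : Language α) (s : List α) : Set (σ → σ) :=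
  {g | ∃ u v, u ≠ [] ∧ u ++ v = s ∧ v ∈ L ∧ g = M.transform u}

/-- Nonempty prefixes behave uniformly when a letter is put in front: the remainder does not change.
The empty prefix is separate, as it asks whether the whole word lies in `L`. -/
theorem properPrefixTransforms_cons {σ : Type} (M : DFA α σ) (L : Language α) (c : α)
    (s : List α) : M.properPrefixTransforms L (c :: s) =
      (fun g q => g (M.step q c)) '' M.prefixTransforms L s := by
  ext g
  constructor
  · rintro ⟨u, v, hu, h, hv, rfl⟩
    cases u with
    | nil => exact (hu rfl).elim
    | cons d u =>
      obtain ⟨rfl, h'⟩ := List.cons_eq_cons.1 h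
      exact ⟨_, ⟨u, v, h', hv, rfl⟩, rfl⟩
  · rintro ⟨_, ⟨u, v, h, hv, rfl⟩, rfl⟩
    exact ⟨c :: u, v, by simp, by simp [h], hv, rfl⟩

theorem prefixTransforms_eq {σ : Type} (M : DFA α σ) (L : Language α) (s : List α) :
    M.prefixTransforms L s = M.properPrefixTransforms L s ∪ {g | g = id ∧ s ∈ L} := by
  ext g
  constructor
  · rintro ⟨u, v, h, hv, rfl⟩
    by_cases hu : u = []
    · subst hu
      exact .inr ⟨rfl, h ▸ hv⟩
    · exact .inl ⟨u, v, hu, h, hv, rfl⟩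
  · rintro (⟨u, v, hu, h, hv, rfl⟩ | ⟨rfl, hs⟩)
    · exact ⟨u, v, h, hv, rfl⟩
    · exact ⟨[], s, rfl, hs, rfl⟩

end DFA

open DFA

/-- It suffices to know which transformations of the states of `M` come from prefixes with remainder
in `L`; the transformation of `N` is carried along to update this when a letter is put in front. -/
theorem Language.IsRegular.mul {K L : Language α} (hK : K.IsRegular) (hL : L.IsRegular) :
    (K * L).IsRegular := by
  obtain ⟨σ, _, M, rfl⟩ := hK
  obtain ⟨τ, _, N, rfl⟩ := hL
  refine isRegular_of_cons (fun s => (M.prefixTransforms N.accepts s, N.transform s))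
    (fun x => ∃ g ∈ x.1, g M.start ∈ M.accept) ?_ ?_
  · intro c s s' h
    obtain ⟨h₁, h₂⟩ := Prod.ext_iff.1 h
    simp only at h₁ h₂
    simp only [prefixTransforms_eq M _ (c :: _), properPrefixTransforms_cons, h₁,
      mem_accepts_iff_transform, transform_cons, h₂]
  · intro s
    rw [Language.mem_mul]
    constructor
    · rintro ⟨u, hu, v, hv, h⟩
      exact ⟨_, ⟨u, v, h, hv, rfl⟩, hu⟩
    · rintro ⟨_, ⟨u, v, h, hv, rfl⟩, hu⟩
      exact ⟨u, hu, v, hv, h⟩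

theorem Language.cons_mem_kstar_iff {L : Language α} {c : α} {s : List α} :
    c :: s ∈ KStar.kstar L ↔ ∃ u v, u ++ v = s ∧ v ∈ KStar.kstar L ∧ c :: u ∈ L := by
  constructor
  · rw [Language.mem_kstar_iff_exists_nonempty]
    rintro ⟨S, h, hS⟩
    cases S with
    | nil => cases h
    | cons w S =>
      obtain ⟨hw, hne⟩ := hS w (by simp)
      cases w with
      | nil => exact (hne rfl).elim
      | cons d u =>
        obtain ⟨rfl, h'⟩ := List.cons_eq_cons.1 h
        exact ⟨u, S.flatten, h'.symm, Language.mem_kstar.2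
          ⟨S, rfl, fun y hy => (hS y (List.mem_cons_of_mem _ hy)).1⟩, hw⟩
  · rintro ⟨u, v, rfl, hv, hu⟩
    obtain ⟨S, rfl, hS⟩ := Language.mem_kstar.1 hv
    refine Language.mem_kstar.2 ⟨(c :: u) :: S, rfl, ?_⟩
    rintro y (_ | ⟨_, hy⟩)
    · exact hu
    · exact hS y hy

/-- Membership of `c :: s` is decided by the end of its first nonempty factor, that is, by the
transformations of those prefixes of `s` whose remainder is again in the star. -/
theorem Language.IsRegular.kstar {L : Language α} (hL : L.IsRegular) :
    (KStar.kstar L).IsRegular := by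
  obtain ⟨σ, _, M, rfl⟩ := hL
  have key : ∀ c s, c :: s ∈ KStar.kstar M.accepts ↔
      ∃ g ∈ M.prefixTransforms (KStar.kstar M.accepts) s, g (M.step M.start c) ∈ M.accept := by
    intro c s
    rw [Language.cons_mem_kstar_iff]
    constructor
    · rintro ⟨u, v, h, hv, hu⟩
      exact ⟨_, ⟨u, v, h, hv, rfl⟩, hu⟩
    · rintro ⟨_, ⟨u, v, h, hv, rfl⟩, hu⟩
      exact ⟨u, v, h, hv, hu⟩
  refine isRegular_of_cons
    (fun s => (M.prefixTransforms (KStar.kstar M.accepts) s, s ∈ KStar.kstar M.accepts))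
    (fun x => x.2) ?_ fun s => Iff.rfl
  intro c s s' h
  have h₁ : M.prefixTransforms _ s = M.prefixTransforms _ s' := (Prod.ext_iff.1 h).1
  simp only [prefixTransforms_eq M _ (c :: _), properPrefixTransforms_cons, h₁, key]

theorem Pattern.isRegular_lang (P : Pattern α) : P.lang.IsRegular := by
  induction P with
  | eps => 
    exact isRegular_of_cons (fun s => s = []) id (by simp) fun s => Language.mem_one s
  | sym a =>
    refine isRegular_of_cons (fun s => (s = [], s = [a])) (fun x => x.2) ?_ fun s => Iff.rfl
    intro c s s' h
    have h₁ : (s = []) = (s' = []) := (Prod.ext_iff.1 h).1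
    simp [h₁]
  | alt P Q hP hQ => exact hP.add hQ
  | cat P Q hP hQ => exact hP.mul hQ
  | star P hP => exact hP.kstar

theorem Language.IsRegular.sub {K L : Language α} (hK : K.IsRegular) (hL : L.IsRegular) :
    (K - L).IsRegular := hK.inf hL.compl

/-- Only the transformation induced by `s` matters, whatever the language `K` is. -/
theorem Language.IsRegular.leftQuot {C : Language α} (hC : C.IsRegular) (K : Language α) :
    (leftQuot K C).IsRegular := by
  obtain ⟨σ, _, M, rfl⟩ := hC
  refine isRegular_of_cons M.transform
    (fun g => ∃ p ∈ K, g (M.transform p M.start) ∈ M.accept) ?_ ?_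
  · intro c s s' h
    rw [transform_cons, transform_cons, h]
  · intro s
    exact exists_congr fun p => and_congr_right fun _ => append_mem_accepts_iff_transform

theorem Language.IsRegular.rightQuot {C : Language α} (hC : C.IsRegular) (K : Language α) :
    (rightQuot C K).IsRegular := by
  obtain ⟨σ, _, M, rfl⟩ := hC
  refine isRegular_of_snoc M.eval (fun q => ∃ s ∈ K, M.transform s q ∈ M.accept) ?_ ?_
  · intro s s' c h
    rw [DFA.eval_append_singleton, DFA.eval_append_singleton, h]
  · intro s
    exact exists_congr fun p => and_congr_right fun _ => append_mem_accepts_iff_transform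

-- Regularity of the longest-match languages

section StarSplit

variable {P₁ P₂ : Pattern α} {σ σ₁ σ₂ : Type} {M : DFA α σ} {M₁ : DFA α σ₁} {M₂ : DFA α σ₂}

/-- Separates the two parts: `p` enters only through the states it reaches, and `s` only through
finitely many possible transformations, including those of the prefixes that could prolong the match
of `P₁*`. -/
theorem starSplit_iff (h₁ : M₁.accepts = P₁.star.lang) (h₂ : M₂.accepts = P₂.lang)
    {p s : List α} : StarSplit P₁ P₂ M.accepts p s ↔
      M.transform s (M.transform p M.start) ∈ M.accept ∧
      M₁.transform p M₁.start ∈ M₁.accept ∧ M₂.transform s M₂.start ∈ M₂.accept ∧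
      ¬ ∃ g ∈ M₁.properPrefixTransforms P₂.lang s,
        g (M₁.transform p M₁.start) ∈ M₁.accept := by
  rw [StarSplit, append_mem_accepts_iff_transform, ← h₁, ← h₂, mem_accepts_iff_transform,
    mem_accepts_iff_transform]
  refine and_congr_right fun _ => and_congr_right fun _ => and_congr_right fun _ =>
    not_congr ⟨?_, ?_⟩
  · rintro ⟨u, v, hu, rfl, h, hv⟩
    exact ⟨_, ⟨u, v, hu, rfl, hv, rfl⟩, append_mem_accepts_iff_transform.1 h⟩
  · rintro ⟨_, ⟨u, v, hu, rfl, hv, rfl⟩, h⟩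
    exact ⟨u, v, hu, rfl, append_mem_accepts_iff_transform.2 h, hv⟩

/-- The information on `s` that determines for which `p` a word `p ++ s` is split after `p`. -/
def splitInvariant (M : DFA α σ) (M₁ : DFA α σ₁) (M₂ : DFA α σ₂) (s : List α) :
    (σ → σ) × (σ₂ → σ₂) × Set (σ₁ → σ₁) :=
  (M.transform s, M₂.transform s, M₁.properPrefixTransforms M₂.accepts s)

theorem splitInvariant_cons {c : α} {s s' : List α}
    (h : splitInvariant M M₁ M₂ s = splitInvariant M M₁ M₂ s') :
    splitInvariant M M₁ M₂ (c :: s) = splitInvariant M M₁ M₂ (c :: s') := by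
  obtain ⟨h₁, h⟩ := Prod.ext_iff.1 h
  obtain ⟨h₂, h₃⟩ := Prod.ext_iff.1 h
  simp only [splitInvariant] at h₁ h₂ h₃
  simp only [splitInvariant, transform_cons, h₁, h₂, properPrefixTransforms_cons,
    prefixTransforms_eq, h₃, mem_accepts_iff_transform]

end StarSplit

theorem Language.IsRegular.starT {C : Language α} (hC : C.IsRegular) (P₁ P₂ : Pattern α) :
    (starT P₁ P₂ C).IsRegular := by
  obtain ⟨σ, _, M, rfl⟩ := hC
  obtain ⟨σ₁, _, M₁, h₁⟩ := P₁.star.isRegular_lang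
  obtain ⟨σ₂, _, M₂, h₂⟩ := P₂.isRegular_lang
  refine isRegular_of_snoc (fun p => (M.eval p, M₁.eval p)) (fun x => ∃ s,
      M.transform s x.1 ∈ M.accept ∧ x.2 ∈ M₁.accept ∧ M₂.transform s M₂.start ∈ M₂.accept ∧
      ¬ ∃ g ∈ M₁.properPrefixTransforms P₂.lang s, g x.2 ∈ M₁.accept) ?_ ?_
  · intro s s' c h
    obtain ⟨h, h'⟩ := Prod.ext_iff.1 h
    simp only at h h'
    simp only [DFA.eval_append_singleton, h, h']
  · exact fun p => exists_congr fun s => starSplit_iff h₁ h₂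

theorem Language.IsRegular.starC {C : Language α} (hC : C.IsRegular) (P₁ P₂ : Pattern α) :
    (starC P₁ P₂ C).IsRegular := by
  obtain ⟨σ, _, M, rfl⟩ := hC
  obtain ⟨σ₁, _, M₁, h₁⟩ := P₁.star.isRegular_lang
  obtain ⟨σ₂, _, M₂, h₂⟩ := P₂.isRegular_lang
  refine isRegular_of_cons (splitInvariant M M₁ M₂) (fun x => ∃ p,
      x.1 (M.transform p M.start) ∈ M.accept ∧ M₁.transform p M₁.start ∈ M₁.accept ∧
      x.2.1 M₂.start ∈ M₂.accept ∧
      ¬ ∃ g ∈ x.2.2, g (M₁.transform p M₁.start) ∈ M₁.accept) ?_ ?_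
  · exact fun c s s' => splitInvariant_cons
  · intro s
    rw [splitInvariant, h₂]
    exact exists_congr fun s => starSplit_iff h₁ h₂

theorem cons_eq_map_some {c : Option α} {u : List (Option α)} {s : List α} :
    c :: u = s.map some ↔ ∃ d s', c = some d ∧ u = s'.map some ∧ s = d :: s' := by
  cases s with
  | nil => simp
  | cons d s => aesop

theorem cons_eq_boxWord {c : Option α} {u : List (Option α)} {p s : List α} :
    c :: u = boxWord p s ↔ (c = none ∧ u = s.map some ∧ p = []) ∨
      ∃ d p', c = some d ∧ u = boxWord p' s ∧ p = d :: p' := by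
  cases p with
  | nil => simp [boxWord]
  | cons d p => simp [boxWord]

/-- A word over the extended alphabet is `s`, or `p □ s`, or of neither form; the two sets record
the data for the first two cases. A letter in front prolongs `s` or `p`, and a `□` in front turns
`s` into `□ s`. -/
theorem Language.IsRegular.starI {C : Language α} (hC : C.IsRegular) (P₁ P₂ : Pattern α) :
    (starI P₁ P₂ C).IsRegular := by
  obtain ⟨σ, _, M, rfl⟩ := hC
  obtain ⟨σ₁, _, M₁, h₁⟩ := P₁.star.isRegular_lang
  obtain ⟨σ₂, _, M₂, h₂⟩ := P₂.isRegular_lang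
  refine isRegular_of_cons (fun u : List (Boxed α) =>
      ({x | ∃ s, u = s.map some ∧ x = splitInvariant M M₁ M₂ s},
        {x | ∃ p s, u = boxWord p s ∧
          x = (M.transform p, M₁.transform p, splitInvariant M M₁ M₂ s)}))
    (fun y => ∃ x ∈ y.2, x.2.2.1 (x.1 M.start) ∈ M.accept ∧ x.2.1 M₁.start ∈ M₁.accept ∧
      x.2.2.2.1 M₂.start ∈ M₂.accept ∧ ¬ ∃ g ∈ x.2.2.2.2, g (x.2.1 M₁.start) ∈ M₁.accept) ?_ ?_
  -- The hypotheses are symmetric in `u` and `u'`, so one inclusion for each component is enough.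
  · suffices key : ∀ (c : Boxed α) (u u' : List (Boxed α)),
        ({x | ∃ s, u = s.map some ∧ x = splitInvariant M M₁ M₂ s} =
          {x | ∃ s, u' = s.map some ∧ x = splitInvariant M M₁ M₂ s}) →
        ({x | ∃ p s, u = boxWord p s ∧
            x = (M.transform p, M₁.transform p, splitInvariant M M₁ M₂ s)} =
          {x | ∃ p s, u' = boxWord p s ∧
            x = (M.transform p, M₁.transform p, splitInvariant M M₁ M₂ s)}) →
        ({x | ∃ s, c :: u = s.map some ∧ x = splitInvariant M M₁ M₂ s} ⊆
          {x | ∃ s, c :: u' = s.map some ∧ x = splitInvariant M M₁ M₂ s}) ∧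
        ({x | ∃ p s, c :: u = boxWord p s ∧
            x = (M.transform p, M₁.transform p, splitInvariant M M₁ M₂ s)} ⊆
          {x | ∃ p s, c :: u' = boxWord p s ∧
            x = (M.transform p, M₁.transform p, splitInvariant M M₁ M₂ s)}) by
      intro c u u' h
      obtain ⟨h, h'⟩ := Prod.ext_iff.1 h
      have k₁ := key c u u' h h'
      have k₂ := key c u' u h.symm h'.symm
      exact Prod.ext (k₁.1.antisymm k₂.1) (k₁.2.antisymm k₂.2)
    intro c u u' h h'
    constructor
    · rintro _ ⟨s, hs, rfl⟩
      obtain ⟨d, s, rfl, hu, rfl⟩ := cons_eq_map_some.1 hs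
      obtain ⟨s', hu', hs'⟩ := h.le ⟨s, hu, rfl⟩
      exact ⟨d :: s', by rw [hu']; rfl, splitInvariant_cons hs'⟩
    · rintro _ ⟨p, s, hs, rfl⟩
      obtain ⟨rfl, hu, rfl⟩ | ⟨d, p, rfl, hu, rfl⟩ := cons_eq_boxWord.1 hs
      · obtain ⟨s', hu', hs'⟩ := h.le ⟨s, hu, rfl⟩
        exact ⟨[], s', by rw [hu']; rfl, by rw [hs']⟩
      · obtain ⟨p', s', hu', hs'⟩ := h'.le ⟨p, s, hu, rfl⟩
        simp only [Prod.mk.injEq] at hs'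
        exact ⟨d :: p', s', by rw [hu']; rfl, by simp only [transform_cons, hs']⟩
  · intro u
    constructor
    · rintro ⟨p, s, rfl, h⟩
      refine ⟨_, ⟨p, s, rfl, rfl⟩, ?_⟩
      have := (starSplit_iff h₁ h₂).1 h
      rwa [← h₂] at this
    · rintro ⟨_, ⟨p, s, rfl, rfl⟩, h⟩
      refine ⟨p, s, rfl, (starSplit_iff h₁ h₂).2 ?_⟩
      rw [← h₂]
      exact h

-- Existence of a result

theorem exists_computes_base {P : Pattern α} (hP : P.IsBase) {C : Language α} (hC : C.IsRegular) :
    ∃ H, Computes P C H := by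
  obtain ⟨σ, _, M, hM⟩ := P.isRegular_lang.inf hC
  exact ⟨_, .base M hP hM⟩

/-- Reassociation keeps the size and shrinks the left operand. Distribution would enlarge the
pattern, so the recursion goes directly to the two products, each smaller than `(P₁ + P₂) · P₃`, and
their sum is formed afterwards. -/
theorem exists_computes : ∀ (P : Pattern α) {C : Language α}, C.IsRegular → ∃ H, Computes P C H
  | .eps, _, hC => exists_computes_base (.inl rfl) hC
  | .sym _, _, hC => exists_computes_base (.inr (.inl ⟨_, rfl⟩)) hC
  | .star _, _, hC => exists_computes_base (.inr (.inr ⟨_, rfl⟩)) hC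
  | .alt P₁ P₂, _, hC => by
    obtain ⟨H₁, h₁⟩ := exists_computes P₁ hC
    obtain ⟨H₂, h₂⟩ := exists_computes P₂ (hC.sub P₁.isRegular_lang)
    exact ⟨_, .alt h₁ h₂⟩
  | .cat .eps P₂, _, hC => by
    obtain ⟨H₁, h₁⟩ := exists_computes_base (P := .eps) (.inl rfl) (hC.rightQuot P₂.lang)
    obtain ⟨H₂, h₂⟩ := exists_computes P₂ (hC.leftQuot (Pattern.eps : Pattern α).lang)
    exact ⟨_, .catAtom (.inl rfl) h₁ h₂⟩
  | .cat (.sym a) P₂, _, hC => by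
    obtain ⟨H₁, h₁⟩ :=
      exists_computes_base (P := .sym a) (.inr (.inl ⟨_, rfl⟩)) (hC.rightQuot P₂.lang)
    obtain ⟨H₂, h₂⟩ := exists_computes P₂ (hC.leftQuot (Pattern.sym a).lang)
    exact ⟨_, .catAtom (.inr ⟨_, rfl⟩) h₁ h₂⟩
  | .cat (.star P₁) P₂, _, hC => by
    obtain ⟨H₂, h₂⟩ := exists_computes P₂ (hC.starC P₁ P₂)
    obtain ⟨σ, _, AT, hT⟩ := hC.starT P₁ P₂
    obtain ⟨τ, _, AI, hI⟩ := hC.starI P₁ P₂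
    exact ⟨_, .catStar AT AI hT hI h₂⟩
  | .cat (.cat P₁ P₂) P₃, _, hC => by
    obtain ⟨H, h⟩ := exists_computes (.cat P₁ (.cat P₂ P₃)) hC
    exact ⟨_, .catCat h⟩
  | .cat (.alt P₁ P₂) P₃, _, hC => by
    obtain ⟨H₁, h₁⟩ := exists_computes (.cat P₁ P₃) hC
    obtain ⟨H₂, h₂⟩ := exists_computes (.cat P₂ P₃) (hC.sub (P₁.cat P₃).isRegular_lang)
    exact ⟨_, .catAlt (.alt h₁ h₂)⟩
termination_by P => (P.size, P.leftSize)
decreasing_by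
  all_goals simp [Prod.lex_def, Pattern.size, Pattern.leftSize]
  all_goals omega

end Regular

/-! ### Scanning words on a multi-stack machine -/

section ReachesIn

variable {σ : Type*} {f : σ → Option σ} {a b c : σ} {m n : ℕ}

/-- `b` is reached from `a` in at most `n` steps. -/
def ReachesIn (f : σ → Option σ) (n : ℕ) (a b : σ) : Prop :=
  ∃ m ≤ n, (flip bind f)^[m] (some a) = some b

theorem ReachesIn.trans (h : ReachesIn f m a b) (h' : ReachesIn f n b c) :
    ReachesIn f (m + n) a c := by
  obtain ⟨i, hi, h⟩ := h
  obtain ⟨j, hj, h'⟩ := h'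
  exact ⟨j + i, by omega, by rw [Function.iterate_add_apply, h, h']⟩

theorem ReachesIn.single (h : f a = some b) : ReachesIn f 1 a b := ⟨1, le_rfl, h⟩

theorem ReachesIn.head (h : f a = some b) (h' : ReachesIn f n b c) : ReachesIn f (n + 1) a c := by
  rw [add_comm]
  exact (ReachesIn.single h).trans h'

theorem ReachesIn.mono (h : ReachesIn f m a b) (hmn : m ≤ n) : ReachesIn f n a b :=
  h.imp fun _ h => ⟨h.1.trans hmn, h.2⟩

end ReachesIn

/-- Finite-state data that select `r` subwords of a word: a letter `a` with `w = u ++ a :: v` belongs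
to the `k`-th subword if `span k` holds for the state of a forward scan of `u`, the letter, and the
state of a backward scan of `v`. The state of the forward scan of `w` determines whether there is a
result (`acc`), and whether the `k`-th subword exists (`vis k`). -/
structure SpanScan (α : Type) (r : ℕ) where
  Fwd : Type
  Bwd : Type
  finite_fwd : Finite Fwd
  finite_bwd : Finite Bwd
  stepF : Fwd → α → Fwd
  stepB : α → Bwd → Bwd
  startF : Fwd
  startB : Bwd
  span : Fin r → Fwd → α → Bwd → Prop
  vis : Fin r → Fwd → Prop
  acc : Fwd → Prop

namespace SpanScan

variable {α : Type} {r : ℕ} (T : SpanScan α r)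

/-- The state after the backward scan. -/
def bwd (v : List α) : T.Bwd := v.foldr T.stepB T.startB

/-- The state after the forward scan. -/
def fwd (u : List α) : T.Fwd := u.foldl T.stepF T.startF

open Classical in
/-- The selected letters of a word, if the forward scan starts in the state `y`. -/
noncomputable def letters (k : Fin r) : T.Fwd → List α → List α
  | _, [] => []
  | y, a :: v =>
    if T.span k y a (T.bwd v) then a :: letters k (T.stepF y a) v else letters k (T.stepF y a) v

theorem length_letters_le (k : Fin r) (y : T.Fwd) (w : List α) :
    (T.letters k y w).length ≤ w.length := by
  induction w generalizing y with
  | nil => exact le_rfl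
  | cons a w ih =>
    rw [letters]
    split_ifs
    · simpa using ih _
    · exact (ih _).trans (Nat.le_succ _)

open Classical in
/-- The value of the `k`-th subword. -/
noncomputable def value (w : List α) (k : Fin r) : Option (List α) :=
  if T.vis k (T.fwd w) then some (T.letters k T.startF w) else none

open Classical in
/-- The result of the scan. -/
noncomputable def result (w : List α) : Option (List (Option (List α))) :=
  if T.acc (T.fwd w) then some (List.ofFn (T.value w)) else none

/-- The stacks of the machine. -/
inductive Stack (r : ℕ) : Type
  | input : Stack r
  | copy : Stack r
  | marked : Stack r
  | output : Stack r
  | span : Fin r → Stack r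
deriving DecidableEq, Fintype

/-- The labels of the machine. -/
inductive Label (r : ℕ) : Type
  | move : Label r
  | annotate : Label r
  | distribute : Label r
  | mark : Fin (r + 1) → Label r
  | emit : Fin r → Label r
deriving Fintype

/-- The alphabets of the stacks. -/
@[reducible] def Alphabet : Stack r → Type
  | .input => α
  | .copy => Option α
  | .marked => Option α × T.Bwd
  | .output => OutSym α
  | .span _ => Option α

/-- The contents of the internal memory of the machine. -/
abbrev Var : Type := Option α × T.Bwd × T.Fwd

/-- The initial contents of the internal memory. -/
def init : T.Var := (none, T.startB, T.startF)

/-- The contents of the stacks. -/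
def tapes (i : List α) (c : List (Option α)) (m : List (Option α × T.Bwd)) (o : List (OutSym α))
    (s : Fin r → List (Option α)) : ∀ k : Stack r, List (T.Alphabet k)
  | .input => i
  | .copy => c
  | .marked => m
  | .output => o
  | .span k => s k

theorem update_span (i : List α) (c : List (Option α)) (m : List (Option α × T.Bwd))
    (o : List (OutSym α)) (s : Fin r → List (Option α)) (k : Fin r) (l : List (Option α)) :
    Function.update (T.tapes i c m o s) (.span k) l =
      T.tapes i c m o (Function.update s k l) := by
  funext k'
  cases k' with
  | span k' =>
    by_cases h : k' = k
    · subst h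
      exact (Function.update_self _ _ _).trans (Function.update_self k' l s).symm
    · rw [Function.update_of_ne (fun h' => h (Stack.span.inj h'))]
      change s k' = Function.update s k l k'
      rw [Function.update_of_ne h]
  | _ => rfl

open Turing.TM2

/-- The statements of the machine. -/
abbrev Statement : Type := Stmt T.Alphabet (Label r) T.Var

open Classical in
/-- Push the current letter on the stacks of the subwords to which it belongs. -/
noncomputable def pushSpans : List (Fin r) → T.Statement → T.Statement
  | [], q => q
  | k :: ks, q =>
    .branch (fun v => decide (∃ a ∈ v.1, T.span k v.2.2 a v.2.1))
      (.push (.span k) (fun v => v.1) (pushSpans ks q)) (pushSpans ks q)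

open Classical in
/-- The program of the machine: copy the input in reverse order, annotate its letters with the states
of the backward scan, distribute the letters to the stacks of the subwords during the forward scan,
and write the contents of these stacks to the output. -/
noncomputable def program : Label r → T.Statement
  | .move => .pop .input (fun v x => (x, v.2))
      (.branch (fun v => v.1.isSome)
        (.push .copy (fun v => v.1) (.goto fun _ => .move))
        (.goto fun _ => .annotate))
  | .annotate => .pop .copy (fun v x => (x.join, v.2))
      (.branch (fun v => v.1.isSome)
        (.push .marked (fun v => (v.1, v.2.1))
          (.load (fun v => (v.1, v.1.elim v.2.1 fun a => T.stepB a v.2.1, v.2.2))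
            (.goto fun _ => .annotate)))
        (.goto fun _ => .distribute))
  | .distribute => .pop .marked (fun v x => ((x.map Prod.fst).join,
        (x.map Prod.snd).getD T.startB, v.2.2))
      (.branch (fun v => v.1.isSome)
        (T.pushSpans (List.finRange r)
          (.load (fun v => (v.1, v.2.1, v.1.elim v.2.2 fun a => T.stepF v.2.2 a))
            (.goto fun _ => .distribute)))
        (.branch (fun v => decide (T.acc v.2.2))
          (.goto fun _ => .mark (Fin.last r))
          (.push .output (fun _ => OutSym.noMatch) (.load (fun _ => T.init) .halt))))
  | .mark j => Fin.cases (motive := fun _ => T.Statement) (.load (fun _ => T.init) .halt)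
      (fun k => .push .output
        (fun v => if T.vis k v.2.2 then OutSym.endMark else OutSym.bot)
        (.goto fun _ => .emit k)) j
  | .emit k => .pop (.span k) (fun v x => (x.join, v.2))
      (.branch (fun v => v.1.isSome)
        (.push .output (fun v => v.1.elim OutSym.bot OutSym.letter) (.goto fun _ => .emit k))
        (.goto fun _ => .mark k.castSucc))

/-- The configurations of the machine. -/
abbrev Config : Type := Cfg T.Alphabet (Label r) T.Var

/-- At most `n` steps of the machine lead from one configuration to the other. -/
def Runs (n : ℕ) (x y : T.Config) : Prop := ReachesIn (step T.program) n x y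

variable {T}

theorem runs_move (i : List α) (c : List (Option α)) (v : T.Var) :
    T.Runs (i.length + 1) ⟨some .move, v, T.tapes i c [] [] fun _ => []⟩
      ⟨some .annotate, (none, v.2), T.tapes [] (i.reverse.map some ++ c) [] [] fun _ => []⟩ := by
  induction i generalizing c v with
  | nil =>
    refine ReachesIn.single (congrArg some (congrArg (Cfg.mk _ _) ?_))
    funext k
    cases k <;> rfl
  | cons a i ih =>
    refine ReachesIn.head (b := ⟨some .move, (some a, v.2), T.tapes i (some a :: c) [] []
      fun _ => []⟩) (congrArg some (congrArg (Cfg.mk _ _) ?_)) ?_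
    · funext k
      cases k <;> rfl
    · have := ih (some a :: c) (some a, v.2)
      rwa [show (a :: i).reverse.map some ++ c = i.reverse.map some ++ some a :: c by simp]

variable (T) in
/-- The letters of a word, annotated with the states of the backward scan. -/
def marks : List α → List (Option α × T.Bwd)
  | [] => []
  | a :: v => (some a, T.bwd v) :: marks v

/-- Each letter is stored with the state of the backward scan before that letter is processed, so
the mark describes the suffix strictly after it. The extra step notices the empty stack. -/
theorem runs_annotate (l v : List α) (x : Option α) (y : T.Fwd) :
    T.Runs (l.length + 1)
      ⟨some .annotate, (x, T.bwd v, y), T.tapes [] (l.map some) (T.marks v) [] fun _ => []⟩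
      ⟨some .distribute, (none, T.bwd (l.reverse ++ v), y),
        T.tapes [] [] (T.marks (l.reverse ++ v)) [] fun _ => []⟩ := by
  induction l generalizing v x with
  | nil =>
    refine ReachesIn.single (congrArg some (congrArg (Cfg.mk _ _) ?_))
    funext k
    cases k <;> rfl
  | cons a l ih =>
    refine ReachesIn.head (b := ⟨some .annotate, (some a, T.bwd (a :: v), y),
      T.tapes [] (l.map some) (T.marks (a :: v)) [] fun _ => []⟩)
      (congrArg some (congrArg (Cfg.mk _ _) ?_)) ?_
    · funext k
      cases k <;> rfl
    · have := ih (a :: v) (some a)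
      rwa [show (a :: l).reverse ++ v = l.reverse ++ a :: v by simp]

open Classical in
-- All pushes happen within a single machine step, which is why the forward scan costs one step per
-- letter whatever `r` is.
theorem stepAux_pushSpans {ks : List (Fin r)} (hks : ks.Nodup) (q : T.Statement) (v : T.Var)
    (i : List α) (c : List (Option α)) (m : List (Option α × T.Bwd)) (o : List (OutSym α))
    (s : Fin r → List (Option α)) :
    stepAux (T.pushSpans ks q) v (T.tapes i c m o s) = stepAux q v (T.tapes i c m o fun k =>
      if k ∈ ks ∧ ∃ a ∈ v.1, T.span k v.2.2 a v.2.1 then v.1 :: s k else s k) := by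
  induction ks generalizing s with
  | nil => simp [pushSpans]
  | cons k ks ih =>
    obtain ⟨hk, hks⟩ := List.nodup_cons.1 hks
    by_cases h : ∃ a ∈ v.1, T.span k v.2.2 a v.2.1
    · have h₁ : stepAux (T.pushSpans (k :: ks) q) v (T.tapes i c m o s) =
          stepAux (T.pushSpans ks q) v
            (T.tapes i c m o (Function.update s k (v.1 :: s k))) := by
        rw [← T.update_span]
        simp only [pushSpans, stepAux, h, decide_true, cond_true]
        rfl
      rw [h₁, ih hks]
      congr 2
      funext k'
      by_cases hk' : k' = k
      · subst hk'
        rw [if_neg (fun h => hk h.1), if_pos ⟨List.mem_cons_self, h⟩, Function.update_self]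
      · simp [hk']
    · have h₁ : stepAux (T.pushSpans (k :: ks) q) v (T.tapes i c m o s) =
          stepAux (T.pushSpans ks q) v (T.tapes i c m o s) := by
        simp only [pushSpans, stepAux, h, decide_false, cond_false]
      rw [h₁, ih hks]
      congr 2
      funext k'
      by_cases hk' : k' = k
      · subst hk'
        rw [if_neg (fun h => hk h.1), if_neg (fun h' => h h'.2)]
      · simp [hk']

open Classical in
variable (T) in
/-- The configuration after the forward scan. -/
noncomputable def scanned (y : T.Fwd) (s : Fin r → List (Option α)) : T.Config :=
  if T.acc y then ⟨some (.mark (Fin.last r)), (none, T.startB, y), T.tapes [] [] [] [] s⟩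
  else ⟨none, T.init, T.tapes [] [] [] [OutSym.noMatch] s⟩

open Classical in
-- The stacks of the subwords receive their letters in reading order and thus hold them reversed.
theorem runs_distribute (v : List α) (x : Option α) (z : T.Bwd) (y : T.Fwd)
    (s : Fin r → List (Option α)) :
    T.Runs (v.length + 1) ⟨some .distribute, (x, z, y), T.tapes [] [] (T.marks v) [] s⟩
      (T.scanned (v.foldl T.stepF y) fun k => (T.letters k y v).reverse.map some ++ s k) := by
  induction v generalizing x z y s with
  | nil =>
    refine ReachesIn.single (congrArg some ?_)
    have h : Function.update (T.tapes [] [] [] [] s) .marked [] = T.tapes [] [] [] [] s := by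
      funext k
      cases k <;> rfl
    have h' : Function.update (T.tapes [] [] [] [] s) .output [OutSym.noMatch] =
        T.tapes [] [] [] [OutSym.noMatch] s := by
      funext k
      cases k <;> rfl
    have h₁ : stepAux (T.program .distribute) (x, z, y) (T.tapes [] [] [] [] s) =
        cond (decide (T.acc y))
          ⟨some (.mark (Fin.last r)), (none, T.startB, y),
            Function.update (T.tapes [] [] [] [] s) .marked []⟩
          ⟨none, T.init, Function.update (Function.update (T.tapes [] [] [] [] s) .marked [])
            .output [OutSym.noMatch]⟩ := rfl
    refine h₁.trans ?_
    rw [h, h']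
    by_cases hy : T.acc y <;> simp [hy, scanned, letters]
  | cons a v ih =>
    refine ReachesIn.head (b := ⟨some .distribute, (some a, T.bwd v, T.stepF y a),
      T.tapes [] [] (T.marks v) [] fun k =>
        if T.span k y a (T.bwd v) then some a :: s k else s k⟩) (congrArg some ?_) ?_
    · have h : Function.update (T.tapes [] [] (T.marks (a :: v)) [] s) .marked (T.marks v) =
          T.tapes [] [] (T.marks v) [] s := by
        funext k
        cases k <;> rfl
      have h₁ : stepAux (T.program .distribute) (x, z, y) (T.tapes [] [] (T.marks (a :: v)) [] s) =
          stepAux (T.pushSpans (List.finRange r)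
            (.load (fun v => (v.1, v.2.1, v.1.elim v.2.2 fun a => T.stepF v.2.2 a))
            (.goto fun _ => .distribute))) (some a, T.bwd v, y)
            (Function.update (T.tapes [] [] (T.marks (a :: v)) [] s) .marked (T.marks v)) := rfl
      rw [h₁, h, stepAux_pushSpans (List.nodup_finRange r)]
      simp [List.mem_finRange]
    · have h : (fun k => (T.letters k y (a :: v)).reverse.map some ++ s k) =
          fun k => (T.letters k (T.stepF y a) v).reverse.map some ++
            if T.span k y a (T.bwd v) then some a :: s k else s k := by
        funext k
        rw [letters]
        split_ifs <;> simp
      rw [h]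
      exact ih _ _ _ _

theorem runs_emit (k : Fin r) (v : T.Var) (l : List α) (o : List (OutSym α))
    (s : Fin r → List (Option α)) :
    T.Runs (l.length + 1)
      ⟨some (.emit k), v, T.tapes [] [] [] o (Function.update s k (l.map some))⟩
      ⟨some (.mark k.castSucc), (none, v.2), T.tapes [] [] [] (l.reverse.map OutSym.letter ++ o)
        (Function.update s k [])⟩ := by
  have hk : ∀ l o, T.tapes [] [] [] o (Function.update s k l) (.span k) = l :=
    fun l _ => show Function.update s k l k = l from Function.update_self k l s
  have hu : ∀ (l l' : List (Option α)) o, Function.update (T.tapes [] [] [] o (Function.update s k l)) (.span k) l' =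
      T.tapes [] [] [] o (Function.update s k l') := by
    intro l l' o
    rw [update_span, Function.update_idem]
  induction l generalizing v o with
  | nil =>
    refine ReachesIn.single (congrArg some ?_)
    simp only [program, stepAux, hk, hu]
    rfl
  | cons a l ih =>
    refine ReachesIn.head (b := ⟨some (.emit k), (some a, v.2), T.tapes [] [] []
      (OutSym.letter a :: o) (Function.update s k (l.map some))⟩) (congrArg some ?_) ?_
    · simp only [program, stepAux, hk, hu]
      refine congrArg (Cfg.mk _ _) ?_
      funext k
      cases k <;> rfl
    · have := ih (some a, v.2) (OutSym.letter a :: o)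
      rwa [show (a :: l).reverse.map OutSym.letter ++ o =
        l.reverse.map OutSym.letter ++ OutSym.letter a :: o by simp]

open Classical in
-- The output is a stack, so it is produced from its end: the last subword first, and for each
-- subword the end marker before the letters. The counter `j` is the number of subwords still to be
-- written. By `hu` a missing subword has an empty stack, so `⊥` is written alone.
theorem runs_mark {N : ℕ} {y : T.Fwd} {u : Fin r → List α} (hN : ∀ k, (u k).length ≤ N)
    (hu : ∀ k, ¬ T.vis k y → u k = []) (j : ℕ) (hj : j < r + 1) (x : Option α) (z : T.Bwd)
    (o : List (OutSym α)) :
    T.Runs (j * (N + 2) + 1) ⟨some (.mark ⟨j, hj⟩), (x, z, y), T.tapes [] [] [] o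
        fun k => if k.1 < j then (u k).reverse.map some else []⟩
      ⟨none, T.init, T.tapes [] [] []
        (((List.ofFn fun k => if T.vis k y then some (u k) else none).take j).flatMap encodeValue
          ++ o) fun _ => []⟩ := by
  induction j generalizing x o with
  | zero =>
    rw [Nat.zero_mul]
    refine ReachesIn.single (congrArg some ?_)
    simp only [Nat.not_lt_zero, if_false, List.take_zero, List.flatMap_nil, List.nil_append]
    rfl
  | succ j ih =>
    let k : Fin r := ⟨j, Nat.lt_of_succ_lt_succ hj⟩
    let e := if T.vis k y then OutSym.endMark else (OutSym.bot : OutSym α)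
    have h₁ : (fun i : Fin r => if i.1 < j + 1 then (u i).reverse.map some else []) =
        Function.update (fun i : Fin r => if i.1 < j then (u i).reverse.map some else []) k
          ((u k).reverse.map some) := by
      funext i
      by_cases hi : i = k
      · subst hi
        rw [Function.update_self, if_pos (Nat.lt_succ_self j)]
      · have hi' : i.1 ≠ j := fun h => hi (Fin.ext h)
        rw [Function.update_of_ne hi]
        congr 1
        exact propext (by omega)
    have h₂ : Function.update (fun i : Fin r => if i.1 < j then (u i).reverse.map some else []) k
          [] = fun i : Fin r => if i.1 < j then (u i).reverse.map some else [] := by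
      rw [Function.update_eq_self_iff, if_neg (lt_irrefl j)]
    have h₃ : (List.ofFn fun k => if T.vis k y then some (u k) else none).take (j + 1) =
        (List.ofFn fun k => if T.vis k y then some (u k) else none).take j ++
          [if T.vis k y then some (u k) else none] := by
      rw [List.take_add_one, List.getElem?_ofFn, dif_pos k.2]
      rfl
    have h₄ : encodeValue (if T.vis k y then some (u k) else none) =
        (u k).map OutSym.letter ++ [e] := by
      by_cases hv : T.vis k y
      · simp [e, hv, encodeValue]
      · simp [e, hv, hu k hv, encodeValue]
    have s₁ : T.Runs 1 ⟨some (.mark ⟨j + 1, hj⟩), (x, z, y), T.tapes [] [] [] o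
        fun k => if k.1 < j + 1 then (u k).reverse.map some else []⟩
        ⟨some (.emit k), (x, z, y), T.tapes [] [] [] (e :: o)
          fun k => if k.1 < j + 1 then (u k).reverse.map some else []⟩ := by
      refine ReachesIn.single (congrArg some (congrArg (Cfg.mk _ _) ?_))
      funext k
      cases k <;> rfl
    rw [h₁] at s₁ ⊢
    have s₂ := runs_emit k (x, z, y) (u k).reverse (e :: o)
      fun i : Fin r => if i.1 < j then (u i).reverse.map some else []
    rw [h₂, List.reverse_reverse] at s₂
    have s₃ := ih (Nat.lt_of_succ_lt hj) none ((u k).map OutSym.letter ++ e :: o)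
    have hk := hN k
    rw [List.length_reverse] at s₂
    rw [h₃, List.flatMap_append, List.flatMap_singleton, h₄, List.append_assoc, List.append_assoc]
    -- One step for the marker and at most `N + 1` for the letters, hence `N + 2` for each subword.
    exact ((s₁.trans s₂).trans s₃).mono (by rw [Nat.succ_mul]; omega)

variable (T) in
-- Three scans take `|w| + 1` steps each, and the output follows. By `hacc` the stacks of the
-- subwords are empty also when there is no match, as a halting configuration has nothing but the
-- output.
theorem runs_program (hacc : ∀ w k, ¬ T.acc (T.fwd w) → T.letters k T.startF w = [])
    (hvis : ∀ w k, ¬ T.vis k (T.fwd w) → T.letters k T.startF w = []) (w : List α) :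
    T.Runs (3 * (w.length + 1) + (r * (w.length + 2) + 1))
      ⟨some .move, T.init, T.tapes w [] [] [] fun _ => []⟩
      ⟨none, T.init, T.tapes [] [] [] (encodeResult (T.result w)) fun _ => []⟩ := by
  have s₁ := T.runs_move w [] T.init
  have s₂ := T.runs_annotate w.reverse [] none T.startF
  rw [List.append_nil] at s₁
  rw [List.reverse_reverse, List.append_nil, List.length_reverse] at s₂
  have s₃ := T.runs_distribute w none (T.bwd w) T.startF fun _ => []
  have s := (s₁.trans s₂).trans s₃
  simp only [List.append_nil] at s
  by_cases h : T.acc (T.fwd w)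
  · have s₄ := T.runs_mark (y := T.fwd w) (fun k => T.length_letters_le k T.startF w)
      (hvis w) r (Nat.lt_succ_self r) none T.startB []
    rw [scanned, if_pos (show T.acc (w.foldl T.stepF T.startF) from h)] at s
    simp only [Fin.is_lt, if_true, List.append_nil] at s₄
    rw [List.take_of_length_le (by simp)] at s₄
    rw [result, if_pos h]
    exact (s.trans s₄).mono (by omega)
  · rw [scanned, if_neg (show ¬ T.acc (w.foldl T.stepF T.startF) from h)] at s
    simp only [hacc w _ h] at s
    rw [result, if_neg h]
    exact ReachesIn.mono s (by omega)

variable (T) in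
/-- The machine as a bundled multi-stack Turing machine. -/
noncomputable def machine [Finite α] : Turing.FinTM2 where
  K := Stack r
  k₀ := .input
  k₁ := .output
  Γ := T.Alphabet
  Λ := Label r
  main := .move
  σ := T.Var
  initialState := T.init
  σFin := by
    have := T.finite_fwd
    have := T.finite_bwd
    exact Fintype.ofFinite _
  Γk₀Fin := Fintype.ofFinite α
  m := T.program

theorem exists_linearTime [Finite α]
    (hacc : ∀ w k, ¬ T.acc (T.fwd w) → T.letters k T.startF w = [])
    (hvis : ∀ w k, ¬ T.vis k (T.fwd w) → T.letters k T.startF w = []) :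
    ∃ M : Turing.TM2ComputableInTime (fun w : List α => w) encodeResult T.result,
      ∃ c : ℕ, ∀ k, M.time k ≤ c * (k + 1) := by
  have hinit : ∀ w, Turing.initList T.machine w =
      (⟨some .move, T.init, T.tapes w [] [] [] fun _ => []⟩ : T.Config) := by
    intro w
    refine congrArg (Cfg.mk _ _) ?_
    funext k
    cases k <;> rfl
  have hhalt : ∀ w, Turing.haltList T.machine w =
      (⟨none, T.init, T.tapes [] [] [] w fun _ => []⟩ : T.Config) := by
    intro w
    refine congrArg (Cfg.mk _ _) ?_
    funext k
    cases k <;> rfl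
  choose n hn hs using T.runs_program hacc hvis
  refine ⟨⟨⟨T.machine, Equiv.refl α, Equiv.refl (OutSym α)⟩,
    fun k => 3 * (k + 1) + (r * (k + 2) + 1), fun w => ⟨⟨n w, ?_⟩, hn w⟩⟩, 2 * r + 4, fun k => ?_⟩
  · have e := (congrArg (Turing.initList T.machine) (List.map_id w)).trans (hinit w)
    have e' := (congrArg (Turing.haltList T.machine)
      (List.map_id (encodeResult (T.result w)))).trans (hhalt _)
    exact (congrArg (fun x => (flip bind (step T.program))^[n w] (some x)) e).trans
      ((hs w).trans (congrArg some e'.symm))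
  -- The bound follows from `r (k + 2) ≤ 2 r (k + 1)` and `3 (k + 1) + 1 ≤ 4 (k + 1)`.
  · change 3 * (k + 1) + (r * (k + 2) + 1) ≤ (2 * r + 4) * (k + 1)
    nlinarith [Nat.zero_le (r * k)]

end SpanScan

/-! ### Matching in linear time -/

section Connected

variable {α σ : Type} {A : εNFA α σ} {u v w x y z : List α} {p q q' : σ}

/-- A path on `u` connects `q` to `q'`. -/
def Connected (A : εNFA α σ) (u : List α) (q q' : σ) : Prop :=
  Relation.ReflTransGen (RunStep A u) (q, 0) (q', u.length)

theorem reflTransGen_runStep_append_left (u : List α) {a b : σ × ℕ}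
    (h : Relation.ReflTransGen (RunStep A v) a b) :
    Relation.ReflTransGen (RunStep A (u ++ v)) (a.1, a.2 + u.length) (b.1, b.2 + u.length) := by
  induction h with
  | refl => exact .refl
  | tail _ hs ih => exact ih.tail (runStep_shift.2 hs)

theorem reflTransGen_runStep_of_append_left {a b : σ × ℕ}
    (h : Relation.ReflTransGen (RunStep A (u ++ v)) a b) (ha : u.length ≤ a.2) :
    Relation.ReflTransGen (RunStep A v) (a.1, a.2 - u.length) (b.1, b.2 - u.length) := by
  induction h with
  | refl => exact .refl
  | @tail b c h hs ih =>
    have hb := ha.trans (reflTransGen_runStep_le h)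
    have hc := hb.trans hs.pos_le
    refine ih.tail (runStep_shift (u := u).1 ?_)
    rw [Nat.sub_add_cancel hb, Nat.sub_add_cancel hc]
    exact hs

theorem exists_reflTransGen_runStep_at {a b : σ × ℕ} {k : ℕ}
    (h : Relation.ReflTransGen (RunStep A w) a b) (ha : a.2 ≤ k) (hb : k ≤ b.2) :
    ∃ m, Relation.ReflTransGen (RunStep A w) a (m, k) ∧
      Relation.ReflTransGen (RunStep A w) (m, k) b := by
  induction h with
  | refl =>
    obtain rfl := ha.antisymm hb
    exact ⟨a.1, .refl, .refl⟩
  | @tail b c h hs ih =>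
    by_cases hk : k ≤ b.2
    · obtain ⟨m, h₁, h₂⟩ := ih hk
      exact ⟨m, h₁, h₂.tail hs⟩
    · obtain rfl : k = c.2 := by
        obtain ⟨_, _, _, h'⟩ | ⟨_, h', _⟩ := hs <;> omega
      exact ⟨c.1, h.tail hs, .refl⟩

/-- A path on `y` reads only letters of `y`, so it may be viewed as a segment of a run on any word
around `y`. -/
theorem connected_iff_append : Connected A y q q' ↔
    Relation.ReflTransGen (RunStep A (x ++ (y ++ z))) (q, x.length) (q', x.length + y.length) := by
  constructor
  · intro h
    have := reflTransGen_runStep_append_left x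
      (Relation.ReflTransGen.mono (fun _ _ h => RunStep.append (u := z) h) _ _ h)
    simpa [add_comm] using this
  · intro h
    have := reflTransGen_runStep_of_append_left h le_rfl
    simp only [Nat.sub_self, Nat.add_sub_cancel_left] at this
    exact reflTransGen_runStep_of_append this le_rfl

theorem connected_append :
    Connected A (u ++ v) q q' ↔ ∃ m, Connected A u q m ∧ Connected A v m q' := by
  constructor
  · intro h
    obtain ⟨m, h₁, h₂⟩ := exists_reflTransGen_runStep_at (k := u.length) h (Nat.zero_le _) (by simp)
    refine ⟨m, reflTransGen_runStep_of_append h₁ le_rfl, ?_⟩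
    refine (connected_iff_append (x := u) (z := [])).2 ?_
    simpa using h₂
  · rintro ⟨m, h₁, h₂⟩
    have h₁' := (connected_iff_append (x := []) (z := v)).1 h₁
    have h₂' := (connected_iff_append (x := u) (z := [])).1 h₂
    simp only [List.nil_append, List.length_nil, Nat.zero_add, List.append_nil] at h₁' h₂'
    rw [Connected, List.length_append]
    exact h₁'.trans h₂'

/-- Paths on `u` and on `v` that meet in `p` form an accepting run; by unambiguity this is `ρ`, so
`ρ` itself visits `p`. This turns a question about the run into one about the prefix and the suffix
separately. -/
theorem mem_positions_iff {ρ : List (σ × ℕ)} {S : Set σ} {k : ℕ}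
    (hA : ∀ w ρ ρ', IsAcceptingRun A w ρ → IsAcceptingRun A w ρ' → ρ = ρ')
    (hρ : IsAcceptingRun A (u ++ v) ρ) (hk : u.length = k) : k ∈ positions ρ S ↔
      ∃ q ∈ A.start, ∃ p ∈ S, ∃ f ∈ A.accept, Connected A u q p ∧ Connected A v p f := by
  subst hk
  constructor
  · rintro ⟨p, hp, h⟩
    obtain ⟨h₁, ⟨q, hq, hh⟩, f, hf, hl⟩ := hρ
    refine ⟨q, hq, p, hp, f, hf, (connected_iff_append (x := []) (z := v)).2 ?_,
      (connected_iff_append (x := u) (z := [])).2 ?_⟩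
    · simpa using h₁.reflTransGen_head hh h
    · simpa using h₁.reflTransGen_getLast hl h
  · rintro ⟨q, hq, p, hp, f, hf, h₁, h₂⟩
    have h₁' := (connected_iff_append (x := []) (z := v)).1 h₁
    have h₂' := (connected_iff_append (x := u) (z := [])).1 h₂
    simp only [List.nil_append, List.length_nil, Nat.zero_add, List.append_nil] at h₁' h₂'
    obtain ⟨l, hl₁, hl₂, hl₃, -⟩ :=
      exists_isChain_of_reflTransGen h₂' (List.isChain_singleton _) rfl
    obtain ⟨l', hl₁', hl₂', hl₃', hl₄'⟩ := exists_isChain_of_reflTransGen h₁' hl₁ hl₂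
    have hr : IsAcceptingRun A (u ++ v) l' := by
      refine ⟨hl₁', ⟨q, hq, hl₂'⟩, f, hf, ?_⟩
      rw [hl₃', hl₃, List.length_append]
      rfl
    obtain rfl := hA _ _ _ hρ hr
    exact ⟨p, hp, hl₄' (List.mem_of_head? hl₂)⟩

end Connected

-- The scans given by sets of states

section AutomatonScan

variable {α σ : Type} {r : ℕ} (A : εNFA α σ) (S : Fin r → Set σ)

/-- The states that are reached from an initial state on `u`. -/
def reachedOn (u : List α) : Set σ := {q | ∃ s ∈ A.start, Connected A u s q}

/-- The states that are reached from an initial state on `u` by a path through `T`. -/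
def reachedThrough (T : Set σ) (u : List α) : Set σ :=
  {q | ∃ s ∈ A.start, ∃ p ∈ T, ∃ u₁ u₂, u = u₁ ++ u₂ ∧ Connected A u₁ s p ∧ Connected A u₂ p q}

/-- The states from which a final state is reached on `v`. -/
def acceptingOn (v : List α) : Set σ := {q | ∃ f ∈ A.accept, Connected A v q f}

/-- The states from which a final state is reached on `v` by a path through `T`. -/
def acceptingThrough (T : Set σ) (v : List α) : Set σ :=
  {q | ∃ f ∈ A.accept, ∃ p ∈ T, ∃ v₁ v₂, v = v₁ ++ v₂ ∧ Connected A v₁ q p ∧ Connected A v₂ p f}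

/-- The states that are reached from `X` on `u`. -/
def imageOn (u : List α) (X : Set σ) : Set σ := {q | ∃ p ∈ X, Connected A u p q}

/-- The states from which `X` is reached on `u`. -/
def preimageOn (u : List α) (X : Set σ) : Set σ := {q | ∃ p ∈ X, Connected A u q p}

theorem reachedOn_append (u v : List α) :
    reachedOn A (u ++ v) = imageOn A v (reachedOn A u) := by
  ext q
  simp only [reachedOn, imageOn, connected_append, Set.mem_ofPred_eq]
  constructor
  · rintro ⟨s, hs, m, h₁, h₂⟩
    exact ⟨m, ⟨s, hs, h₁⟩, h₂⟩
  · rintro ⟨m, ⟨s, hs, h₁⟩, h₂⟩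
    exact ⟨s, hs, m, h₁, h₂⟩

theorem acceptingOn_append (u v : List α) :
    acceptingOn A (u ++ v) = preimageOn A u (acceptingOn A v) := by
  ext q
  simp only [acceptingOn, preimageOn, connected_append, Set.mem_ofPred_eq]
  constructor
  · rintro ⟨f, hf, m, h₁, h₂⟩
    exact ⟨m, ⟨f, hf, h₂⟩, h₁⟩
  · rintro ⟨m, ⟨f, hf, h₂⟩, h₁⟩
    exact ⟨f, hf, m, h₁, h₂⟩

/-- The visit of `T` happens before the letter `c` is read, or after it; in the latter case only
λ-moves follow, which are collected by `imageOn A []`. -/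
theorem reachedThrough_snoc (T : Set σ) (u : List α) (c : α) : reachedThrough A T (u ++ [c]) =
    imageOn A [c] (reachedThrough A T u) ∪ imageOn A [] (reachedOn A (u ++ [c]) ∩ T) := by
  ext q
  constructor
  · rintro ⟨s, hs, p, hp, u₁, u₂, h, h₁, h₂⟩
    rcases List.eq_nil_or_concat u₂ with rfl | ⟨u₂, d, rfl⟩
    · rw [List.append_nil] at h
      subst h
      exact .inr ⟨p, ⟨⟨s, hs, h₁⟩, hp⟩, h₂⟩
    · rw [List.concat_eq_append, ← List.append_assoc] at h
      obtain ⟨rfl, h⟩ := List.append_inj' h rfl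
      obtain rfl : c = d := by simpa using h
      rw [List.concat_eq_append] at h₂
      obtain ⟨m, hm, h₃⟩ := connected_append.1 h₂
      exact .inl ⟨m, ⟨s, hs, p, hp, u₁, u₂, rfl, h₁, hm⟩, h₃⟩
  · rintro (⟨m, ⟨s, hs, p, hp, u₁, u₂, rfl, h₁, h₂⟩, h₃⟩ | ⟨p, ⟨⟨s, hs, h₁⟩, hp⟩, h₂⟩)
    · exact ⟨s, hs, p, hp, u₁, u₂ ++ [c], by simp, h₁, connected_append.2 ⟨m, h₂, h₃⟩⟩
    · exact ⟨s, hs, p, hp, u ++ [c], [], by simp, h₁, h₂⟩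

theorem acceptingThrough_cons (T : Set σ) (c : α) (v : List α) : acceptingThrough A T (c :: v) =
    preimageOn A [c] (acceptingThrough A T v) ∪ preimageOn A [] (acceptingOn A (c :: v) ∩ T) := by
  ext q
  constructor
  · rintro ⟨f, hf, p, hp, v₁, v₂, h, h₁, h₂⟩
    rcases v₁ with _ | ⟨d, v₁⟩
    · rw [List.nil_append] at h
      subst h
      exact .inr ⟨p, ⟨⟨f, hf, h₂⟩, hp⟩, h₁⟩
    · obtain ⟨rfl, rfl⟩ := List.cons_eq_cons.1 h
      obtain ⟨m, hm, h₃⟩ := connected_append.1 (show Connected A ([c] ++ v₁) q p from h₁)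
      exact .inl ⟨m, ⟨f, hf, p, hp, v₁, v₂, rfl, h₃, h₂⟩, hm⟩
  · rintro (⟨m, ⟨f, hf, p, hp, v₁, v₂, rfl, h₁, h₂⟩, h₃⟩ | ⟨p, ⟨⟨f, hf, h₂⟩, hp⟩, h₁⟩)
    · exact ⟨f, hf, p, hp, c :: v₁, v₂, rfl,
        (connected_append (u := [c]) (v := v₁)).2 ⟨m, h₃, h₁⟩, h₂⟩
    · exact ⟨f, hf, p, hp, [], c :: v, rfl, h₁, h₂⟩

theorem reachedThrough_nil (T : Set σ) :
    reachedThrough A T [] = imageOn A [] (reachedOn A [] ∩ T) := by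
  ext q
  constructor
  · rintro ⟨s, hs, p, hp, u₁, u₂, h, h₁, h₂⟩
    obtain ⟨rfl, rfl⟩ := List.append_eq_nil_iff.1 h.symm
    exact ⟨p, ⟨⟨s, hs, h₁⟩, hp⟩, h₂⟩
  · rintro ⟨p, ⟨⟨s, hs, h₁⟩, hp⟩, h₂⟩
    exact ⟨s, hs, p, hp, [], [], rfl, h₁, h₂⟩

theorem acceptingThrough_nil (T : Set σ) :
    acceptingThrough A T [] = preimageOn A [] (acceptingOn A [] ∩ T) := by
  ext q
  constructor
  · rintro ⟨f, hf, p, hp, u₁, u₂, h, h₁, h₂⟩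
    obtain ⟨rfl, rfl⟩ := List.append_eq_nil_iff.1 h.symm
    exact ⟨p, ⟨⟨f, hf, h₂⟩, hp⟩, h₁⟩
  · rintro ⟨p, ⟨⟨f, hf, h₂⟩, hp⟩, h₁⟩
    exact ⟨f, hf, p, hp, [], [], rfl, h₁, h₂⟩

/-- The scan that selects the subwords between the first and the last visit of the sets `S k`. -/
def automatonScan [Finite σ] : SpanScan α r where
  Fwd := Set σ × (Fin r → Set σ)
  Bwd := Set σ × (Fin r → Set σ)
  finite_fwd := inferInstance
  finite_bwd := inferInstance
  stepF x c := (imageOn A [c] x.1,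
    fun k => imageOn A [c] (x.2 k) ∪ imageOn A [] (imageOn A [c] x.1 ∩ S k))
  stepB c x := (preimageOn A [c] x.1,
    fun k => preimageOn A [c] (x.2 k) ∪ preimageOn A [] (preimageOn A [c] x.1 ∩ S k))
  startF := (reachedOn A [], fun k => imageOn A [] (reachedOn A [] ∩ S k))
  startB := (acceptingOn A [], fun k => preimageOn A [] (acceptingOn A [] ∩ S k))
  span k x a y := ∃ q ∈ x.2 k, ∃ q' ∈ y.2 k, Connected A [a] q q'
  vis k x := ∃ q ∈ x.2 k, q ∈ A.accept
  acc x := ∃ q ∈ x.1, q ∈ A.accept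

variable [Finite σ] {A S}

theorem automatonScan_fwd (u : List α) :
    (automatonScan A S).fwd u = (reachedOn A u, fun k => reachedThrough A (S k) u) := by
  induction u using List.reverseRecOn with
  | nil =>
    simp only [reachedThrough_nil]
    rfl
  | append_singleton u c ih =>
    rw [SpanScan.fwd, List.foldl_append, ← SpanScan.fwd, ih]
    simp only [reachedThrough_snoc, reachedOn_append]
    rfl

theorem automatonScan_bwd (v : List α) :
    (automatonScan A S).bwd v = (acceptingOn A v, fun k => acceptingThrough A (S k) v) := by
  induction v with
  | nil =>
    simp only [acceptingThrough_nil]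
    rfl
  | cons c v ih =>
    rw [SpanScan.bwd, List.foldr_cons, ← SpanScan.bwd, ih]
    simp only [acceptingThrough_cons]
    rw [← List.singleton_append, acceptingOn_append]
    rfl

/-- The letter is selected if some accepting path visits `S k` both before and after it. -/
theorem automatonScan_span {k : Fin r} {u v : List α} {a : α} :
    (automatonScan A S).span k ((automatonScan A S).fwd u) a ((automatonScan A S).bwd v) ↔
      ∃ s ∈ A.start, ∃ p ∈ S k, ∃ p' ∈ S k, ∃ f ∈ A.accept, ∃ u₁ u₂ v₁ v₂, u = u₁ ++ u₂ ∧
        v = v₁ ++ v₂ ∧ Connected A u₁ s p ∧ Connected A (u₂ ++ a :: v₁) p p' ∧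
        Connected A v₂ p' f := by
  rw [automatonScan_fwd, automatonScan_bwd]
  have key : ∀ {u₂ v₁ : List α} {p p' : σ}, Connected A (u₂ ++ a :: v₁) p p' ↔
      ∃ m, Connected A u₂ p m ∧ ∃ m', Connected A [a] m m' ∧ Connected A v₁ m' p' := by
    intro u₂ v₁ p p'
    rw [connected_append, ← List.singleton_append]
    simp only [connected_append]
  constructor
  · rintro ⟨m, ⟨s, hs, p, hp, u₁, u₂, hu, h₁, h₂⟩, m', ⟨f, hf, p', hp', v₁, v₂, hv, h₃, h₄⟩, h⟩
    exact ⟨s, hs, p, hp, p', hp', f, hf, u₁, u₂, v₁, v₂, hu, hv, h₁,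
      key.2 ⟨m, h₂, m', h, h₃⟩, h₄⟩
  · rintro ⟨s, hs, p, hp, p', hp', f, hf, u₁, u₂, v₁, v₂, hu, hv, h₁, h, h₄⟩
    obtain ⟨m, h₂, m', h, h₃⟩ := key.1 h
    exact ⟨m, ⟨s, hs, p, hp, u₁, u₂, hu, h₁, h₂⟩, m', ⟨f, hf, p', hp', v₁, v₂, hv, h₃, h₄⟩, h⟩

theorem automatonScan_acc {w : List α} :
    (automatonScan A S).acc ((automatonScan A S).fwd w) ↔ ∃ ρ, IsAcceptingRun A w ρ := by
  rw [automatonScan_fwd]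
  constructor
  · rintro ⟨f, ⟨s, hs, h⟩, hf⟩
    exact exists_isRun hs hf h
  · rintro ⟨ρ, h, ⟨s, hs, hh⟩, f, hf, hl⟩
    exact ⟨f, ⟨s, hs, h.reflTransGen_head hh (List.mem_of_getLast? hl)⟩, hf⟩

theorem automatonScan_vis (hA : ∀ w ρ ρ', IsAcceptingRun A w ρ → IsAcceptingRun A w ρ' → ρ = ρ')
    {k : Fin r} {w : List α} {ρ : List (σ × ℕ)} (hρ : IsAcceptingRun A w ρ) :
    (automatonScan A S).vis k ((automatonScan A S).fwd w) ↔ (positions ρ (S k)).Nonempty := by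
  rw [automatonScan_fwd]
  constructor
  · rintro ⟨f, ⟨s, hs, p, hp, u₁, u₂, rfl, h₁, h₂⟩, hf⟩
    exact ⟨_, (mem_positions_iff hA hρ rfl).2 ⟨s, hs, p, hp, f, hf, h₁, h₂⟩⟩
  · rintro ⟨j, hj⟩
    have hj' := hρ.positions_le j hj
    rw [← List.take_append_drop j w] at hρ
    obtain ⟨s, hs, p, hp, f, hf, h₁, h₂⟩ :=
      (mem_positions_iff hA hρ (List.length_take_of_le hj')).1 hj
    exact ⟨f, ⟨s, hs, p, hp, _, _, (List.take_append_drop j w).symm, h₁, h₂⟩, hf⟩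

/-- The letter after `u'` sits between the positions `|u'|` and `|u'| + 1`, hence the half-open
condition. Truncated subtraction absorbs the bounds that the scanned part `u` has already passed. -/
theorem SpanScan.letters_eq (T : SpanScan α r) (k : Fin r) {i j : ℕ} (u v : List α)
    (h : ∀ u' a v', u ++ v = u' ++ a :: v' →
      (T.span k (T.fwd u') a (T.bwd v') ↔ i ≤ u'.length ∧ u'.length < j)) :
    T.letters k (T.fwd u) v = (v.take (j - u.length)).drop (i - u.length) := by
  induction v generalizing u with
  | nil => simp [SpanScan.letters]
  | cons a v ih =>
    have hu : T.stepF (T.fwd u) a = T.fwd (u ++ [a]) := by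
      rw [SpanScan.fwd, SpanScan.fwd, List.foldl_append]
      rfl
    have ih' := ih (u ++ [a]) (by simpa using h)
    rw [List.length_append, List.length_singleton] at ih'
    rw [SpanScan.letters, hu, ih']
    split_ifs with hs
    · obtain ⟨h₁, h₂⟩ := (h u a v rfl).1 hs
      rw [show j - u.length = j - (u.length + 1) + 1 by omega, List.take_succ_cons,
        show i - u.length = 0 by omega, show i - (u.length + 1) = 0 by omega]
      rfl
    · rw [h u a v rfl] at hs
      by_cases hj : j ≤ u.length
      · simp [show j - u.length = 0 by omega, show j - (u.length + 1) = 0 by omega]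
      · rw [show j - u.length = j - (u.length + 1) + 1 by omega, List.take_succ_cons,
          show i - u.length = i - (u.length + 1) + 1 by omega, List.drop_succ_cons]

theorem SpanScan.letters_eq_nil (T : SpanScan α r) (k : Fin r) (w : List α)
    (h : ∀ u a v, w = u ++ a :: v → ¬ T.span k (T.fwd u) a (T.bwd v)) :
    T.letters k T.startF w = [] := by
  have := T.letters_eq k (i := 0) (j := 0) [] w
    fun u a v hw => iff_of_false (h u a v hw) (by omega)
  exact this.trans (by simp)

/-- A selected letter comes with an accepting path on the whole word, so without one the stacks stay
empty. -/
theorem automatonScan_letters_of_not_acc (w : List α) (k : Fin r)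
    (h : ¬ (automatonScan A S).acc ((automatonScan A S).fwd w)) :
    (automatonScan A S).letters k (automatonScan A S).startF w = [] := by
  refine SpanScan.letters_eq_nil _ _ _ fun u a v hw hspan => h ?_
  obtain ⟨s, hs, p, hp, p', hp', f, hf, u₁, u₂, v₁, v₂, rfl, rfl, h₁, h₂, h₃⟩ :=
    automatonScan_span.1 hspan
  refine automatonScan_acc.2 (exists_isRun hs hf (show Connected A w s f from ?_))
  have : Connected A (u₁ ++ ((u₂ ++ a :: v₁) ++ v₂)) s f :=
    connected_append.2 ⟨p, h₁, connected_append.2 ⟨p', h₂, h₃⟩⟩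
  rw [hw]
  simpa using this

theorem automatonScan_letters_of_not_vis (w : List α) (k : Fin r)
    (h : ¬ (automatonScan A S).vis k ((automatonScan A S).fwd w)) :
    (automatonScan A S).letters k (automatonScan A S).startF w = [] := by
  refine SpanScan.letters_eq_nil _ _ _ fun u a v hw hspan => h ?_
  obtain ⟨s, hs, p, hp, p', hp', f, hf, u₁, u₂, v₁, v₂, rfl, rfl, h₁, h₂, h₃⟩ :=
    automatonScan_span.1 hspan
  rw [automatonScan_fwd]
  exact ⟨f, ⟨s, hs, p, hp, u₁, (u₂ ++ a :: v₁) ++ v₂, by rw [hw]; simp, h₁,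
    connected_append.2 ⟨p', h₂, h₃⟩⟩, hf⟩

/-- The letters with a visit before and a visit after them are exactly those between the least and
the greatest visited position. Unambiguity guarantees that the visits found by the scans belong to
`ρ`. -/
theorem automatonScan_value (hA : ∀ w ρ ρ', IsAcceptingRun A w ρ → IsAcceptingRun A w ρ' → ρ = ρ')
    {k : Fin r} {w : List α} {ρ : List (σ × ℕ)} (hρ : IsAcceptingRun A w ρ) :
    (automatonScan A S).value w k = subword w (bound ρ (S k)) := by
  rw [SpanScan.value]
  split_ifs with hv
  · rw [automatonScan_vis hA hρ] at hv
    obtain ⟨i, j, hi, hj⟩ := exists_isLeast_isGreatest hv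
    rw [subword_bound hi hj (hρ.positions_le _ hj.1)]
    have := SpanScan.letters_eq (automatonScan A S) k (i := i) (j := j) [] w ?_
    · exact congrArg some this
    · rintro u a v hw
      rw [List.nil_append] at hw
      subst hw
      rw [automatonScan_span]
      constructor
      · rintro ⟨s, hs, p, hp, p', hp', f, hf, u₁, u₂, v₁, v₂, rfl, rfl, h₁, h₂, h₃⟩
        -- The word is regrouped around the two visits, at positions `|u₁|` and `|u₁| + |u₂ ++ a ::
        -- v₁|`, which are compared with `i` and `j`.
        have e₁ : (u₁ ++ u₂) ++ a :: (v₁ ++ v₂) = u₁ ++ ((u₂ ++ a :: v₁) ++ v₂) := by simp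
        have e₂ : (u₁ ++ u₂) ++ a :: (v₁ ++ v₂) = (u₁ ++ (u₂ ++ a :: v₁)) ++ v₂ := by simp
        have m₁ := hi.2 ((mem_positions_iff hA (e₁ ▸ hρ) rfl).2
          ⟨s, hs, p, hp, f, hf, h₁, connected_append.2 ⟨p', h₂, h₃⟩⟩)
        have m₂ := hj.2 ((mem_positions_iff hA (e₂ ▸ hρ) rfl).2
          ⟨s, hs, p', hp', f, hf, connected_append.2 ⟨p, h₁, h₂⟩, h₃⟩)
        simp only [List.length_append, List.length_cons] at m₂ ⊢
        omega
      · rintro ⟨h₁, h₂⟩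
        have hj' := hρ.positions_le _ hj.1
        simp only [List.length_append, List.length_cons] at hj'
        obtain ⟨⟨p, hp, hpi⟩, -⟩ := hi
        obtain ⟨⟨p', hp', hpj⟩, -⟩ := hj
        obtain ⟨hc, ⟨s, hs, hh⟩, f, hf, hl⟩ := hρ
        obtain ⟨u₁, u₂, rfl, rfl⟩ : ∃ u₁ u₂, u = u₁ ++ u₂ ∧ u₁.length = i :=
          ⟨u.take i, u.drop i, (List.take_append_drop _ _).symm, List.length_take_of_le h₁⟩
        obtain ⟨v₁, v₂, rfl, hv₁⟩ : ∃ v₁ v₂, v = v₁ ++ v₂ ∧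
            v₁.length = j - ((u₁ ++ u₂).length + 1) :=
          ⟨v.take _, v.drop _, (List.take_append_drop _ _).symm,
            List.length_take_of_le (by simp only [List.length_append] at hj' ⊢; omega)⟩
        have e₁ : (u₁ ++ u₂) ++ a :: (v₁ ++ v₂) = u₁ ++ ((u₂ ++ a :: v₁) ++ v₂) := by simp
        have e₂ : (u₁ ++ u₂) ++ a :: (v₁ ++ v₂) = (u₁ ++ (u₂ ++ a :: v₁)) ++ (v₂ ++ []) := by simp
        have hj₁ : j = u₁.length + (u₂ ++ a :: v₁).length := by
          simp only [List.length_append, List.length_cons] at hv₁ h₂ ⊢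
          omega
        have r₁ := hc.reflTransGen_head hh hpi
        have r₃ := hc.reflTransGen_getLast hl hpj
        -- The visit at `j` cannot precede the one at `i < j`, because positions never decrease
        -- along a run.
        have r₂ : Relation.ReflTransGen (RunStep A ((u₁ ++ u₂) ++ a :: (v₁ ++ v₂)))
            (p, u₁.length) (p', j) := by
          refine (hc.reflTransGen_total hpi hpj).resolve_right fun h => ?_
          have := reflTransGen_runStep_le h
          simp only [List.length_append] at h₂
          simp only at this
          omega
        refine ⟨s, hs, p, hp, p', hp', f, hf, u₁, u₂, v₁, v₂, rfl, rfl, ?_, ?_, ?_⟩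
        · rw [e₁] at r₁
          refine (connected_iff_append (x := []) (z := (u₂ ++ a :: v₁) ++ v₂)).2 ?_
          simpa using r₁
        · rw [e₁, hj₁] at r₂
          exact connected_iff_append.2 r₂
        · rw [e₂, hj₁, ← List.length_append] at r₃
          refine (connected_iff_append (x := u₁ ++ (u₂ ++ a :: v₁)) (z := [])).2 ?_
          have e : u₁.length + (u₂.length + (v₁.length + 1)) + v₂.length =
            u₁.length + (u₂.length + (v₁.length + v₂.length + 1)) := by omega
          simpa [e] using r₃
  · exact (subword_bound_eq_none fun h => hv ((automatonScan_vis hA hρ).2 h)).symm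

end AutomatonScan

/-- The scan for the state sets `Q_n` of any correct result does the matching: acceptance decides
whether there is a match, and the bounded subwords are the values. -/
theorem Correct.linearTimeMatching {α : Type} [Finite α] {P : Pattern α} {C : Language α}
    {H : Hyperautomaton α} (h : Correct P C H) (ns : List Node) : LinearTimeMatching P C ns := by
  have := H.finite
  let T := automatonScan H.A fun k : Fin ns.length => (H.f (ns.get k)).Q
  refine ⟨T.result, ⟨?_, ?_⟩, T.exists_linearTime
    (fun w k => automatonScan_letters_of_not_acc w k)
    (fun w k => automatonScan_letters_of_not_vis w k)⟩
  · intro w V hw hV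
    obtain ⟨ρ, hρ, rfl⟩ := (h.matches_iff w V).1 ⟨hw, hV⟩
    rw [SpanScan.result, if_pos (automatonScan_acc.2 ⟨ρ, hρ⟩)]
    have : T.value w = fun k => H.assoc w ρ (ns.get k) :=
      funext fun k => automatonScan_value h.unambiguous hρ
    rw [this, show (fun k => H.assoc w ρ (ns.get k)) = H.assoc w ρ ∘ ns.get from rfl,
      ← List.map_ofFn, List.ofFn_get]
  · intro w hw
    rw [SpanScan.result, if_neg]
    rw [automatonScan_acc]
    rintro ⟨ρ, hρ⟩
    exact hw ⟨(h.mem_of_isAcceptingRun hρ).1, _, (h.mem_of_isAcceptingRun hρ).2⟩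

/-! ### The main theorem -/

theorem theorem3 {α : Type} [Finite α] (P : Pattern α) (C : Language α) (hC : C.IsRegular) :
    (∃ H, Computes P C H) ∧
    (∀ H, Computes P C H →
      (∀ n ∈ P.bindable, (H.f n).I ⊆ (H.f n).Q ∧ (H.f n).F ⊆ (H.f n).Q ∧
        H.langAt n = typeOf n P C) ∧
      (∀ w ρ ρ', IsAcceptingRun H.A w ρ → IsAcceptingRun H.A w ρ' → ρ = ρ') ∧
      (∀ (w : List α) (V : Assoc α), (∀ n ∉ P.bindable, V n = none) →
        ((w ∈ C ∧ Matches P w V) ↔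
          ∃ ρ, IsAcceptingRun H.A w ρ ∧
            ∀ n ∈ P.bindable, V n = subword w (bound ρ (H.f n).Q)))) ∧
    (∀ ns : List Node, (∀ n ∈ ns, n ∈ P.bindable) → LinearTimeMatching P C ns) := by
  refine ⟨exists_computes P hC, fun H hH => ?_, fun ns _ => ?_⟩
  · have h := hH.correct.1
    refine ⟨fun n _ => ⟨h.start_sub n, h.final_sub n, h.langAt n⟩, h.unambiguous, ?_⟩
    intro w V hV
    rw [h.matches_iff]
    refine exists_congr fun ρ => and_congr_right fun _ => ⟨?_, fun hn => funext fun n => ?_⟩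
    · rintro rfl n _
      rfl
    · by_cases hb : n ∈ P.bindable
      · exact hn n hb
      -- At addresses that are not bindable nodes both sides are `⊥`: on the right because the
      -- triple is empty there.
      · rw [hV n hb, Hyperautomaton.assoc, h.f_empty n (mt Pattern.mem_bindable_iff.2 hb)]
        exact (subword_bound_eq_none fun ⟨_, _, hq, _⟩ => hq).symm
  · obtain ⟨H, hH⟩ := exists_computes P hC
    exact hH.correct.1.linearTimeMatching ns
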